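/- Let $\Bbbk$ be an algebraically closed field of characteristic zero. *Connections.* Let $\mathcal{C}_\infty$ be the category of pairs $(V,\nabla_\zeta)$, where $V$ is a finite-dimensional vector space over $\Bbbk((\zeta))$ and $\nabla_\zeta:V\to V$ is $\Bbbk$-linear with $\nabla_\zeta(fv)=f\nabla_\zeta(v)+\frac{df}{d\zeta}v$; morphisms are the $\Bbbk((\zeta))$-linear maps commuting with the connections. Put $z=\zeta^{-1}$ and $\nabla=\nabla_z=-\zeta^2\nabla_\zeta$. For $q\ge 1$ and $f\in\Bbbk((\zeta^{1/q}))$ let $E_f=\bigl(\Bbbk((\zeta^{1/q})),\frac{d}{d\zeta}+\zeta^{-1}f\bigr)$; every irreducible object of $\mathcal{C}_\infty$ is isomorphic to some $E_f$, and its slope is $\max(0,-\mathrm{ord}(f))$, where $\mathrm{ord}(\zeta)=1$. Let $\mathcal{C}_\infty^{>0}$ be the full subcategory of the objects all of whose irreducible components (Jordan–Hölder factors) have positive slope. *Difference operators.* Let $\varphi$ be the automorphism $\theta\mapsto\frac{\theta}{1+\theta}$ of $\Bbbk((\theta))$, extended to $\Bbbk((\theta^{1/q}))$ by $\theta^{1/q}\mapsto\theta^{1/q}(1+\theta)^{-1/q}$.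 Let $\mathcal{N}$ be the category of pairs $(V,\Phi)$, where $V$ is a finite-dimensional vector space over $\Bbbk((\theta))$ and $\Phi:V\to V$ is $\Bbbk$-linear and bijective with $\Phi(fv)=\varphi(f)\Phi(v)$; morphisms are the $\Bbbk((\theta))$-linear maps commuting with the operators $\Phi$. For $0\ne g\in\Bbbk((\theta^{1/q}))$ let $D_g=\bigl(\Bbbk((\theta^{1/q})),g\varphi\bigr)$; every irreducible object of $\mathcal{N}$ is isomorphic to some $D_g$, and its order is $\mathrm{ord}(g)$, where $\mathrm{ord}(\theta)=1$. Let $\mathcal{N}^{<0}$ be the full subcategory of the objects all of whose irreducible components have negative order. **Theorem.** For every $E=(V,\nabla)\in\mathcal{C}_\infty^{>0}$ the operator $z\nabla$ on $V$ is invertible, and $\theta:=-(z\nabla)^{-1}$ extends to a structure of finite-dimensional $\Bbbk((\theta))$-vector space $V_\theta$ on $V$ whose $\theta$-adic topology is the $\zeta$-adic topology of $V$ (this determines the structure). With $\Phi:=z$, the object $\mathcal{M}^{(\infty,\infty)}(E):=(V_\theta,\Phi)$ belongs to $\mathcal{N}^{<0}$, and $\mathcal{M}^{(\infty,\infty)}$,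 acting as the identity on the underlying maps of morphisms, is an equivalence of categories $$\mathcal{M}^{(\infty,\infty)}:\ \mathcal{C}_\infty^{>0}\ \xrightarrow{\ \sim\ }\ \mathcal{N}^{<0}.$$ The functor with this description is unique up to isomorphism. -/

import Mathlib

open CategoryTheory

universe u

noncomputable section

namespace LocalMellin

/-! ### Laurent series: substitutions, ramification, derivative -/

section Series

variable {k : Type u} [Field k]

/-- The ring homomorphism `k[[x]] → k((x))`, `p ↦ p(s(x))`, for a power series `s` without constant
term. -/
def substCoe (s : PowerSeries k) (h0 : PowerSeries.constantCoeff s = 0) :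
    PowerSeries k →+* LaurentSeries k :=
  (HahnSeries.ofPowerSeries ℤ k).comp
    (PowerSeries.substAlgHom (R := k) (PowerSeries.HasSubst.of_constantCoeff_zero' h0)).toRingHom

theorem substCoe_apply (s : PowerSeries k) (h0 : PowerSeries.constantCoeff s = 0)
    (p : PowerSeries k) : substCoe s h0 p = HahnSeries.ofPowerSeries ℤ k (p.subst s) := by
  simp [substCoe, PowerSeries.coe_substAlgHom]

theorem isUnit_substCoe_X (s : PowerSeries k) (h0 : PowerSeries.constantCoeff s = 0)
    (hs : s ≠ 0) : IsUnit (substCoe s h0 PowerSeries.X) := by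
  rw [substCoe_apply, PowerSeries.subst_X (PowerSeries.HasSubst.of_constantCoeff_zero' h0),
    isUnit_iff_ne_zero]
  exact fun h => hs (HahnSeries.ofPowerSeries_injective (by rw [h, map_zero]))

/-- The substitution `x ↦ s(x)` on `k((x))`, where `s` is a nonzero power series without
constant term. -/
def substHom (s : PowerSeries k) (h0 : PowerSeries.constantCoeff s = 0) (hs : s ≠ 0) :
    LaurentSeries k →+* LaurentSeries k :=
  IsLocalization.Away.lift (S := LaurentSeries k) (PowerSeries.X : PowerSeries k)
    (isUnit_substCoe_X s h0 hs)

theorem substHom_coe (s : PowerSeries k) (h0 : PowerSeries.constantCoeff s = 0) (hs : s ≠ 0)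
    (p : PowerSeries k) :
    substHom s h0 hs (HahnSeries.ofPowerSeries ℤ k p) =
      HahnSeries.ofPowerSeries ℤ k (p.subst s) := by
  have := IsLocalization.Away.lift_eq (S := LaurentSeries k) (PowerSeries.X : PowerSeries k)
    (isUnit_substCoe_X s h0 hs) p
  rw [LaurentSeries.coe_algebraMap] at this
  exact this.trans (substCoe_apply s h0 p)

/-- Ring endomorphisms of `k((x))` that agree on `k[[x]]` are equal. -/
theorem ringHom_ext {f g : LaurentSeries k →+* LaurentSeries k}
    (h : ∀ p : PowerSeries k, f (HahnSeries.ofPowerSeries ℤ k p) =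
      g (HahnSeries.ofPowerSeries ℤ k p)) : f = g := by
  refine IsLocalization.ringHom_ext (Submonoid.powers (PowerSeries.X : PowerSeries k)) ?_
  ext p
  rw [RingHom.comp_apply, RingHom.comp_apply, LaurentSeries.coe_algebraMap, h]

/-- Multiplication by `a`, as a `k`-linear operator on `k((x))`. -/
def mulOp (a : LaurentSeries k) : LaurentSeries k →ₗ[k] LaurentSeries k where
  toFun v := a * v
  map_add' := mul_add a
  map_smul' c v := by
    rw [RingHom.id_apply, ← HahnSeries.C_mul_eq_smul, ← HahnSeries.C_mul_eq_smul, mul_left_comm]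

theorem mulOp_apply (a v : LaurentSeries k) : mulOp a v = a * v := rfl

/-- The embedding `k((x)) → k((t))`, `x ↦ t ^ q`, that is `t = x ^ (1/q)`. -/
def ramify (k : Type u) [Field k] (q : ℕ+) : LaurentSeries k →+* LaurentSeries k :=
  HahnSeries.embDomainRingHom (AddMonoidHom.mulLeft ((q : ℕ) : ℤ))
    (fun a b h => by
      have hq : ((q : ℕ) : ℤ) ≠ 0 := by exact_mod_cast q.ne_zero
      exact mul_left_cancel₀ hq h)
    (fun a b => by
      have hq : (0 : ℤ) < ((q : ℕ) : ℤ) := by exact_mod_cast q.pos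
      exact mul_le_mul_iff_right₀ hq)

theorem ramify_coeff_mul (q : ℕ+) (f : LaurentSeries k) (n : ℤ) :
    (ramify k q f).coeff (((q : ℕ) : ℤ) * n) = f.coeff n :=
  HahnSeries.embDomain_mk_coeff (f := fun n : ℤ => ((q : ℕ) : ℤ) * n) _ _

theorem ramify_coeff_of_not_dvd (q : ℕ+) (f : LaurentSeries k) (n : ℤ)
    (h : ¬ ((q : ℕ) : ℤ) ∣ n) : (ramify k q f).coeff n = 0 := by
  refine HahnSeries.embDomain_of_notMem_range ?_
  rintro ⟨m, rfl⟩
  exact h (Dvd.intro _ rfl)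

theorem ramify_C (q : ℕ+) (c : k) : ramify k q (HahnSeries.C c) = HahnSeries.C c := by
  ext n
  by_cases h : ((q : ℕ) : ℤ) ∣ n
  · obtain ⟨m, rfl⟩ := h
    rw [ramify_coeff_mul]
    have hq : ((q : ℕ) : ℤ) ≠ 0 := by exact_mod_cast q.ne_zero
    by_cases hm : m = 0
    · simp [hm]
    · simp [HahnSeries.C_apply, HahnSeries.coeff_single_of_ne, hm]
  · rw [ramify_coeff_of_not_dvd q _ _ h, HahnSeries.C_apply, HahnSeries.coeff_single_of_ne]
    rintro rfl
    exact h (dvd_zero _)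

theorem ramify_coe (q : ℕ+) (p : PowerSeries k) :
    ramify k q (HahnSeries.ofPowerSeries ℤ k p) =
      HahnSeries.ofPowerSeries ℤ k (p.subst (PowerSeries.X ^ (q : ℕ) : PowerSeries k)) := by
  have hq : (0 : ℤ) < ((q : ℕ) : ℤ) := by exact_mod_cast q.pos
  ext n
  rw [PowerSeries.coeff_coe]
  by_cases h : ((q : ℕ) : ℤ) ∣ n
  · obtain ⟨m, rfl⟩ := h
    rw [ramify_coeff_mul, PowerSeries.coeff_coe]
    by_cases hm : m < 0
    · rw [if_pos hm, if_pos (mul_neg_of_pos_of_neg hq hm)]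
    · rw [if_neg hm, if_neg (by push Not at hm ⊢; positivity), PowerSeries.coeff_subst_X_pow q.ne_zero]
      rw [Int.natAbs_mul, Int.natAbs_natCast, if_pos (dvd_mul_right _ _),
        Nat.mul_div_cancel_left _ q.pos]
      simp
  · rw [ramify_coeff_of_not_dvd q _ _ h]
    split_ifs with hn
    · rfl
    · rw [PowerSeries.coeff_subst_X_pow q.ne_zero, if_neg]
      rwa [← Int.natCast_dvd]

theorem single_one_mul_derivative_coeff (f : LaurentSeries k) (n : ℤ) :
    (HahnSeries.single (1 : ℤ) (1 : k) * LaurentSeries.derivative k f).coeff n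
      = (n : k) * f.coeff n := by
  have := HahnSeries.coeff_single_mul_add (r := (1 : k)) (x := LaurentSeries.derivative k f)
    (a := n - 1) (b := (1 : ℤ))
  rw [sub_add_cancel] at this
  rw [this, LaurentSeries.derivative_apply, LaurentSeries.hasseDeriv_coeff]
  simp

theorem single_one_ne_zero : (HahnSeries.single (1 : ℤ) (1 : k)) ≠ 0 := by simp

theorem derivative_mul (f g : LaurentSeries k) :
    LaurentSeries.derivative k (f * g) =
      f * LaurentSeries.derivative k g + LaurentSeries.derivative k f * g := by
  have key : ∀ f : LaurentSeries k,
      (HahnSeries.single (1 : ℤ) (1 : k) * LaurentSeries.derivative k f).support ⊆ f.support := by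
    intro f n hn h0
    apply hn
    rw [single_one_mul_derivative_coeff, h0, mul_zero]
  apply mul_left_cancel₀ (single_one_ne_zero (k := k))
  rw [mul_add, mul_left_comm, ← mul_assoc _ (LaurentSeries.derivative k f)]
  ext n
  rw [single_one_mul_derivative_coeff, HahnSeries.coeff_add, HahnSeries.coeff_mul,
    HahnSeries.coeff_mul_right' g.isPWO_support (key g),
    HahnSeries.coeff_mul_left' f.isPWO_support (key f), Finset.mul_sum, ← Finset.sum_add_distrib]
  refine Finset.sum_congr rfl fun ij hij => ?_
  rw [single_one_mul_derivative_coeff, single_one_mul_derivative_coeff,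
    ← (Finset.mem_antidiagonal.1 hij).2.2]
  push_cast
  ring

theorem derivative_ramify (q : ℕ+) (f : LaurentSeries k) :
    LaurentSeries.derivative k (ramify k q f) =
      HahnSeries.single (((q : ℕ) : ℤ) - 1) ((q : ℕ) : k) *
        ramify k q (LaurentSeries.derivative k f) := by
  have h1 : ramify k q (HahnSeries.single (1 : ℤ) (1 : k)) =
      HahnSeries.single (((q : ℕ) : ℤ)) (1 : k) := by
    refine (HahnSeries.embDomain_single (f := ⟨⟨fun n : ℤ => ((q : ℕ) : ℤ) * n, ?_⟩, ?_⟩)).trans ?_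
    change HahnSeries.single (((q : ℕ) : ℤ) * 1) (1 : k) = _
    rw [mul_one]
  have h2 : ramify k q (HahnSeries.single (1 : ℤ) (1 : k) * LaurentSeries.derivative k f) =
      HahnSeries.single (((q : ℕ) : ℤ)) (1 : k) * ramify k q (LaurentSeries.derivative k f) := by
    rw [map_mul, h1]
  apply mul_left_cancel₀ (single_one_ne_zero (k := k))
  have h3 : HahnSeries.single (1 : ℤ) (1 : k) * (HahnSeries.single (((q : ℕ) : ℤ) - 1) ((q : ℕ) : k) *
        ramify k q (LaurentSeries.derivative k f)) = HahnSeries.C ((q : ℕ) : k) *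
        ramify k q (HahnSeries.single (1 : ℤ) (1 : k) * LaurentSeries.derivative k f) := by
    rw [h2, ← mul_assoc, ← mul_assoc, HahnSeries.C_apply, HahnSeries.single_mul_single,
      HahnSeries.single_mul_single]
    simp
  rw [h3]
  ext n
  rw [single_one_mul_derivative_coeff, HahnSeries.C_mul_eq_smul, HahnSeries.coeff_smul,
    smul_eq_mul]
  by_cases h : ((q : ℕ) : ℤ) ∣ n
  · obtain ⟨m, rfl⟩ := h
    rw [ramify_coeff_mul, ramify_coeff_mul, single_one_mul_derivative_coeff]
    push_cast
    ring
  · rw [ramify_coeff_of_not_dvd q _ _ h, ramify_coeff_of_not_dvd q _ _ h, mul_zero, mul_zero]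

theorem substHom_comp (s s' : PowerSeries k) (h0 : PowerSeries.constantCoeff s = 0) (hs : s ≠ 0)
    (h0' : PowerSeries.constantCoeff s' = 0) (hs' : s' ≠ 0) (h : s'.subst s = PowerSeries.X)
    (f : LaurentSeries k) : substHom s h0 hs (substHom s' h0' hs' f) = f := by
  have : (substHom s h0 hs).comp (substHom s' h0' hs') = RingHom.id _ := by
    apply ringHom_ext
    intro p
    rw [RingHom.comp_apply, substHom_coe, substHom_coe, PowerSeries.subst_comp_subst_apply
      (PowerSeries.HasSubst.of_constantCoeff_zero' h0')
      (PowerSeries.HasSubst.of_constantCoeff_zero' h0), h, PowerSeries.X_subst, RingHom.id_apply]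
  exact RingHom.congr_fun this f

theorem substHom_bijective (s : PowerSeries k) (h0 : PowerSeries.constantCoeff s = 0) (hs : s ≠ 0)
    (h1 : PowerSeries.coeff 1 s = 1) : Function.Bijective (substHom s h0 hs) := by
  refine ⟨RingHom.injective _, fun f => ?_⟩
  have hu : IsUnit (PowerSeries.coeff 1 s) := by rw [h1]; exact isUnit_one
  have h3 : (s.substInvOfIsUnit hu).subst s = PowerSeries.X :=
    PowerSeries.subst_substInvOfIsUnit_left s h0 hu
  have h4 : PowerSeries.constantCoeff (s.substInvOfIsUnit hu) = 0 :=
    PowerSeries.constantCoeff_substInvOfIsUnit s hu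
  have h5 : s.substInvOfIsUnit hu ≠ 0 := by
    intro h
    have := PowerSeries.coeff_one_substInvOfIsUnit s hu
    rw [h, map_zero] at this
    exact (hu.unit⁻¹).ne_zero this.symm
  exact ⟨_, substHom_comp s _ h0 hs h4 h5 h3 f⟩

/-- The power series `x / (1 + x)`. -/
def shiftSeries (k : Type u) [Field k] : PowerSeries k :=
  PowerSeries.X * (1 + PowerSeries.X)⁻¹

theorem shiftSeries_constantCoeff : PowerSeries.constantCoeff (shiftSeries k) = 0 := by
  simp [shiftSeries]

theorem shiftSeries_ne_zero : shiftSeries k ≠ 0 := by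
  refine mul_ne_zero PowerSeries.X_ne_zero ?_
  rw [Ne, PowerSeries.inv_eq_zero]
  simp

/-- The automorphism `φ` of `k((θ))`, `θ ↦ θ / (1 + θ)`. -/
def phi (k : Type u) [Field k] : LaurentSeries k →+* LaurentSeries k :=
  substHom (shiftSeries k) shiftSeries_constantCoeff shiftSeries_ne_zero

theorem substHom_C (s : PowerSeries k) (h0 : PowerSeries.constantCoeff s = 0) (hs : s ≠ 0)
    (c : k) : substHom s h0 hs (HahnSeries.C c) = HahnSeries.C c := by
  rw [← HahnSeries.ofPowerSeries_C, substHom_coe]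
  congr 1
  exact PowerSeries.subst_C c

/-- The series in `x` formed by the coefficients of `v` at `t ^ (q * n + j)`. -/
def part (q : ℕ+) (v : LaurentSeries k) (j : ℕ) : LaurentSeries k where
  coeff n := v.coeff (((q : ℕ) : ℤ) * n + j)
  isPWO_support' := by
    have hq : (0 : ℤ) < ((q : ℕ) : ℤ) := by exact_mod_cast q.pos
    refine (BddBelow.isWF ?_).isPWO
    refine ⟨-|v.order| - j, fun n hn => ?_⟩
    have h1 : v.order ≤ ((q : ℕ) : ℤ) * n + j := HahnSeries.order_le_of_coeff_ne_zero hn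
    by_contra h
    push Not at h
    have h2 : n < 0 := by have := abs_nonneg v.order; omega
    have h3 := neg_abs_le v.order
    nlinarith

theorem eq_sum_part (q : ℕ+) (v : LaurentSeries k) :
    v = ∑ j ∈ Finset.range (q : ℕ), ramify k q (part q v j) * HahnSeries.single (j : ℤ) (1 : k) := by
  have hq : (0 : ℤ) < ((q : ℕ) : ℤ) := by exact_mod_cast q.pos
  ext n
  have hterm : ∀ j : ℕ, (ramify k q (part q v j) *
      HahnSeries.single (j : ℤ) (1 : k)).coeff n =
      (ramify k q (part q v j)).coeff (n - j) := by
    intro j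
    have := HahnSeries.coeff_mul_single_add (r := (1 : k)) (x := ramify k q (part q v j))
      (a := n - j) (b := (j : ℤ))
    rwa [sub_add_cancel, mul_one] at this
  rw [HahnSeries.coeff_sum]
  simp only [hterm]
  have hr0 := Int.emod_nonneg n hq.ne'
  have hrq := Int.emod_lt_of_pos n hq
  have hdm := Int.mul_ediv_add_emod n ((q : ℕ) : ℤ)
  obtain ⟨r, hr⟩ := Int.eq_ofNat_of_zero_le hr0
  have hnr : n - (r : ℤ) = ((q : ℕ) : ℤ) * (n / ((q : ℕ) : ℤ)) := by omega
  rw [Finset.sum_eq_single r]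
  · rw [hnr, ramify_coeff_mul]
    change _ = v.coeff _
    congr 1
    omega
  · intro j hj hjr
    refine ramify_coeff_of_not_dvd q _ _ fun hd => hjr ?_
    have hj' : (j : ℤ) < ((q : ℕ) : ℤ) := by exact_mod_cast Finset.mem_range.1 hj
    have h1 : n % ((q : ℕ) : ℤ) = j % ((q : ℕ) : ℤ) :=
      ((Int.modEq_iff_dvd (a := (j : ℤ)) (b := n)).2 hd).symm
    rw [Int.emod_eq_of_lt (Int.natCast_nonneg j) hj', hr] at h1
    exact_mod_cast h1.symm
  · intro h
    exfalso
    apply h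
    rw [Finset.mem_range]
    omega

/-- `K_q = k((x^(1/q)))`, regarded as a vector space over `K = k((x))`; its elements are Laurent
series in `t = x^(1/q)`. -/
def RamExt (k : Type u) [Field k] (_q : ℕ+) : Type u := LaurentSeries k

instance (q : ℕ+) : AddCommGroup (RamExt k q) := inferInstanceAs (AddCommGroup (LaurentSeries k))

instance (q : ℕ+) : Module k (RamExt k q) := inferInstanceAs (Module k (LaurentSeries k))

instance (q : ℕ+) : Module (LaurentSeries k) (RamExt k q) :=
  Module.compHom (LaurentSeries k) (ramify k q)

theorem RamExt.smul_def (q : ℕ+) (c v : LaurentSeries k) :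
    (c • (show RamExt k q from v) : RamExt k q) = (ramify k q c * v : LaurentSeries k) := rfl

instance (q : ℕ+) : IsScalarTower k (LaurentSeries k) (RamExt k q) where
  smul_assoc c f v := by
    have h : ∀ v : LaurentSeries k, ramify k q (c • f) * v = c • (ramify k q f * v) := by
      intro v
      rw [← HahnSeries.C_mul_eq_smul, map_mul, ramify_C, mul_assoc, HahnSeries.C_mul_eq_smul]
    exact h v

instance (q : ℕ+) : FiniteDimensional (LaurentSeries k) (RamExt k q) := by
  classical
  let g : ℕ → RamExt k q := fun j => (HahnSeries.single (j : ℤ) (1 : k) : LaurentSeries k)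
  refine ⟨⟨(Finset.range q).image g, ?_⟩⟩
  rw [eq_top_iff]
  intro v _
  have hv : v = ∑ j ∈ Finset.range (q : ℕ), part q v j • g j := eq_sum_part q v
  rw [hv]
  refine Submodule.sum_mem _ fun j hj => Submodule.smul_mem _ _ (Submodule.subset_span ?_)
  exact Finset.mem_coe.2 (Finset.mem_image_of_mem g hj)

end Series

section Shift

variable {k : Type u} [Field k] [CharZero k]

/-- The power series `t * ∑ i, (-1/q choose i) * t ^ (q * i)`, that is `t * (1 + t ^ q) ^ (-1/q)`. -/
def shiftSeriesRam (k : Type u) [Field k] [CharZero k] (q : ℕ+) : PowerSeries k :=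
  PowerSeries.X * (PowerSeries.binomialSeries k (-(1 / (q : ℕ)) : ℚ)).subst
    (PowerSeries.X ^ (q : ℕ) : PowerSeries k)

theorem shiftSeriesRam_constantCoeff (q : ℕ+) :
    PowerSeries.constantCoeff (shiftSeriesRam k q) = 0 := by
  simp [shiftSeriesRam]

theorem shiftSeriesRam_coeff_one (q : ℕ+) :
    PowerSeries.coeff 1 (shiftSeriesRam k q) = 1 := by
  have := PowerSeries.coeff_succ_X_mul 0 ((PowerSeries.binomialSeries k (-(1 / (q : ℕ)) : ℚ)).subst
    (PowerSeries.X ^ (q : ℕ) : PowerSeries k))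
  rw [zero_add] at this
  rw [shiftSeriesRam, this, PowerSeries.coeff_subst_X_pow q.ne_zero]
  simp

theorem shiftSeriesRam_ne_zero (q : ℕ+) : shiftSeriesRam k q ≠ 0 := by
  intro h
  have := shiftSeriesRam_coeff_one (k := k) q
  rw [h, map_zero] at this
  exact zero_ne_one this

/-- The extension of `φ` to `k((θ^(1/q)))`: with `t = θ^(1/q)` it is
`t ↦ t * (1 + t ^ q) ^ (-1/q)`. -/
def phiRam (k : Type u) [Field k] [CharZero k] (q : ℕ+) : LaurentSeries k →+* LaurentSeries k :=
  substHom (shiftSeriesRam k q) (shiftSeriesRam_constantCoeff q) (shiftSeriesRam_ne_zero q)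

theorem phiRam_bijective (q : ℕ+) : Function.Bijective (phiRam k q) :=
  substHom_bijective _ _ _ (shiftSeriesRam_coeff_one q)

theorem binomialSeries_pow (r : ℚ) (n : ℕ) :
    PowerSeries.binomialSeries k r ^ n = PowerSeries.binomialSeries k ((n : ℚ) * r) := by
  induction n with
  | zero => simp
  | succ n ih =>
    rw [pow_succ, ih, ← PowerSeries.binomialSeries_add]
    congr 1
    push_cast
    ring

theorem binomialSeries_neg_one :
    PowerSeries.binomialSeries k (-1 : ℚ) = (1 + PowerSeries.X : PowerSeries k)⁻¹ := by
  rw [PowerSeries.eq_inv_iff_mul_eq_one (by simp)]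
  have h := PowerSeries.binomialSeries_nat (R := ℚ) (A := k) 1
  rw [pow_one] at h
  rw [← h, ← PowerSeries.binomialSeries_add]
  simp

theorem shiftSeriesRam_pow (q : ℕ+) :
    shiftSeriesRam k q ^ (q : ℕ) =
      (shiftSeries k).subst (PowerSeries.X ^ (q : ℕ) : PowerSeries k) := by
  have hX : PowerSeries.HasSubst (PowerSeries.X ^ (q : ℕ) : PowerSeries k) :=
    PowerSeries.HasSubst.X_pow q.ne_zero
  have hq : ((q : ℕ) : ℚ) ≠ 0 := by exact_mod_cast q.ne_zero
  rw [shiftSeriesRam, shiftSeries, mul_pow, ← PowerSeries.subst_pow hX, binomialSeries_pow,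
    PowerSeries.subst_mul hX, PowerSeries.subst_X hX, ← binomialSeries_neg_one]
  congr 3
  field_simp

theorem phiRam_ramify (q : ℕ+) (f : LaurentSeries k) :
    phiRam k q (ramify k q f) = ramify k q (phi k f) := by
  have hX : PowerSeries.HasSubst (PowerSeries.X ^ (q : ℕ) : PowerSeries k) :=
    PowerSeries.HasSubst.X_pow q.ne_zero
  have h1 := PowerSeries.HasSubst.of_constantCoeff_zero' (shiftSeriesRam_constantCoeff (k := k) q)
  have h2 := PowerSeries.HasSubst.of_constantCoeff_zero' (shiftSeries_constantCoeff (k := k))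
  have : (phiRam k q).comp (ramify k q) = (ramify k q).comp (phi k) := by
    apply ringHom_ext
    intro p
    rw [RingHom.comp_apply, RingHom.comp_apply, ramify_coe, phi, substHom_coe, ramify_coe, phiRam,
      substHom_coe, PowerSeries.subst_comp_subst_apply hX h1,
      PowerSeries.subst_comp_subst_apply h2 hX, PowerSeries.subst_pow h1, PowerSeries.subst_X h1,
      shiftSeriesRam_pow]
  exact RingHom.congr_fun this f

end Shift

/-! ### Connections -/

/-- A finite-dimensional vector space over `K = k((x))` with a connection `∇`, where `x` is the
local coordinate. -/
structure FormalConnection (k : Type u) [Field k] where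
  carrier : Type u
  [addCommGroup : AddCommGroup carrier]
  [moduleBase : Module k carrier]
  [module : Module (LaurentSeries k) carrier]
  [isScalarTower : IsScalarTower k (LaurentSeries k) carrier]
  [finiteDimensional : FiniteDimensional (LaurentSeries k) carrier]
  nabla : carrier →ₗ[k] carrier
  leibniz : ∀ (f : LaurentSeries k) (v : carrier),
    nabla (f • v) = f • nabla v + LaurentSeries.derivative k f • v

attribute [instance] FormalConnection.addCommGroup FormalConnection.moduleBase
  FormalConnection.module FormalConnection.isScalarTower FormalConnection.finiteDimensional

namespace FormalConnection

variable {k : Type u} [Field k]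

/-- Horizontal `K`-linear maps. -/
@[ext]
structure Hom (E E' : FormalConnection k) where
  toLinearMap : E.carrier →ₗ[LaurentSeries k] E'.carrier
  horizontal : ∀ v, toLinearMap (E.nabla v) = E'.nabla (toLinearMap v)

instance : Category (FormalConnection k) where
  Hom E E' := Hom E E'
  id E := ⟨LinearMap.id, fun _ => rfl⟩
  comp f g := ⟨g.toLinearMap.comp f.toLinearMap, fun v => by
    simp [f.horizontal, g.horizontal]⟩

/-- `E ≠ 0` and `E` has no `∇`-invariant subspaces other than `0` and `E`. -/
def IsIrreducible (E : FormalConnection k) : Prop :=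
  Nontrivial E.carrier ∧ ∀ W : Submodule (LaurentSeries k) E.carrier,
    (∀ w ∈ W, E.nabla w ∈ W) → W = ⊥ ∨ W = ⊤

/-- `S` is an irreducible component (Jordan–Hölder factor) of `E`: an irreducible quotient of a
subobject of `E`. -/
def IsIrreducibleComponent (S E : FormalConnection k) : Prop :=
  S.IsIrreducible ∧ ∃ (X : FormalConnection k) (i : X ⟶ E) (p : X ⟶ S),
    Function.Injective i.toLinearMap ∧ Function.Surjective p.toLinearMap

/-- The derivation `d/dx` of `k((x^(1/q)))`; in terms of `t = x^(1/q)` it is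
`(1/q) * t^(1-q) * d/dt`. -/
def derivRam (q : ℕ+) : LaurentSeries k →ₗ[k] LaurentSeries k :=
  mulOp (HahnSeries.single (1 - ((q : ℕ) : ℤ)) (((q : ℕ) : k)⁻¹)) ∘ₗ
    LaurentSeries.derivative k

theorem derivRam_apply (q : ℕ+) (v : LaurentSeries k) : derivRam q v =
    HahnSeries.single (1 - ((q : ℕ) : ℤ)) (((q : ℕ) : k)⁻¹) * LaurentSeries.derivative k v := rfl

theorem derivRam_ramify_mul [CharZero k] (q : ℕ+) (c v : LaurentSeries k) :
    derivRam q (ramify k q c * v) =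
      ramify k q c * derivRam q v + ramify k q (LaurentSeries.derivative k c) * v := by
  have hq : ((q : ℕ) : k) ≠ 0 := by exact_mod_cast q.ne_zero
  have h : HahnSeries.single (1 - ((q : ℕ) : ℤ)) (((q : ℕ) : k)⁻¹) *
      HahnSeries.single (((q : ℕ) : ℤ) - 1) ((q : ℕ) : k) = 1 := by
    rw [HahnSeries.single_mul_single, inv_mul_cancel₀ hq]
    simp
  rw [derivRam_apply, derivRam_apply, derivative_mul, derivative_ramify, mul_add, ← mul_assoc _ _ v,
    ← mul_assoc _ _ (ramify k q _), h, one_mul, mul_left_comm]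

/-- The operator `d/dx + x⁻¹ f` on `K_q`. -/
def nablaE (q : ℕ+) (f : LaurentSeries k) : LaurentSeries k →ₗ[k] LaurentSeries k :=
  derivRam q + mulOp (ramify k q (HahnSeries.single (-1) 1) * f)

theorem nablaE_ramify_mul [CharZero k] (q : ℕ+) (f c v : LaurentSeries k) :
    nablaE q f (ramify k q c * v) =
      ramify k q c * nablaE q f v + ramify k q (LaurentSeries.derivative k c) * v := by
  simp only [nablaE, LinearMap.add_apply, mulOp_apply, derivRam_ramify_mul]
  ring

/-- The connection `E_f = (K_q, d/dx + x⁻¹ f)` for `f ∈ K_q`. -/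
def E [CharZero k] (q : ℕ+) (f : LaurentSeries k) : FormalConnection k where
  carrier := RamExt k q
  nabla := (show RamExt k q →ₗ[k] RamExt k q from nablaE q f)
  leibniz := fun c v => nablaE_ramify_mul q f c v

/-- The irreducible connection `S` has slope `s`: it is isomorphic to some `E_f` with
`s = max (0, -ord f)`, where `ord` is normalized by `ord x = 1`. -/
def HasSlope [CharZero k] (S : FormalConnection k) (s : ℚ) : Prop :=
  ∃ (q : ℕ+) (f : LaurentSeries k), Nonempty (S ≅ E q f) ∧
    s = max 0 (-((f.order : ℚ) / ((q : ℕ) : ℚ)))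

/-- All irreducible components have positive slope. -/
def posSlope (k : Type u) [Field k] [CharZero k] : ObjectProperty (FormalConnection k) :=
  fun E => ∀ S : FormalConnection k, S.IsIrreducibleComponent E → ∃ s : ℚ, 0 < s ∧ S.HasSlope s

end FormalConnection

/-! ### Difference operators -/

/-- A finite-dimensional vector space over `K = k((θ))` with an invertible difference
operator `Φ`. -/
structure DifferenceModule (k : Type u) [Field k] where
  carrier : Type u
  [addCommGroup : AddCommGroup carrier]
  [moduleBase : Module k carrier]
  [module : Module (LaurentSeries k) carrier]
  [isScalarTower : IsScalarTower k (LaurentSeries k) carrier]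
  [finiteDimensional : FiniteDimensional (LaurentSeries k) carrier]
  Phi : carrier →ₗ[k] carrier
  Phi_smul : ∀ (f : LaurentSeries k) (v : carrier), Phi (f • v) = phi k f • Phi v
  bijective : Function.Bijective Phi

attribute [instance] DifferenceModule.addCommGroup DifferenceModule.moduleBase
  DifferenceModule.module DifferenceModule.isScalarTower DifferenceModule.finiteDimensional

namespace DifferenceModule

variable {k : Type u} [Field k]

/-- `K`-linear maps that commute with the difference operators. -/
@[ext]
structure Hom (D D' : DifferenceModule k) where
  toLinearMap : D.carrier →ₗ[LaurentSeries k] D'.carrier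
  comm : ∀ v, toLinearMap (D.Phi v) = D'.Phi (toLinearMap v)

instance : Category (DifferenceModule k) where
  Hom D D' := Hom D D'
  id D := ⟨LinearMap.id, fun _ => rfl⟩
  comp f g := ⟨g.toLinearMap.comp f.toLinearMap, fun v => by
    simp [f.comm, g.comm]⟩

/-- `D ≠ 0` and `D` has no `Φ`-invariant subspaces other than `0` and `D`. -/
def IsIrreducible (D : DifferenceModule k) : Prop :=
  Nontrivial D.carrier ∧ ∀ W : Submodule (LaurentSeries k) D.carrier,
    (∀ w ∈ W, D.Phi w ∈ W) → W = ⊥ ∨ W = ⊤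

/-- `S` is an irreducible component (Jordan–Hölder factor) of `D`: an irreducible quotient of a
subobject of `D`. -/
def IsIrreducibleComponent (S D : DifferenceModule k) : Prop :=
  S.IsIrreducible ∧ ∃ (X : DifferenceModule k) (i : X ⟶ D) (p : X ⟶ S),
    Function.Injective i.toLinearMap ∧ Function.Surjective p.toLinearMap

/-- The operator `g φ` on `K_q`. -/
def phiD [CharZero k] (q : ℕ+) (g : LaurentSeries k) : LaurentSeries k →ₗ[k] LaurentSeries k where
  toFun v := g * phiRam k q v
  map_add' v w := by rw [map_add, mul_add]
  map_smul' c v := by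
    rw [RingHom.id_apply, ← HahnSeries.C_mul_eq_smul, ← HahnSeries.C_mul_eq_smul, map_mul, phiRam,
      substHom_C, mul_left_comm]

theorem phiD_ramify_mul [CharZero k] (q : ℕ+) (g c v : LaurentSeries k) :
    phiD q g (ramify k q c * v) = ramify k q (phi k c) * phiD q g v := by
  change g * phiRam k q (ramify k q c * v) = ramify k q (phi k c) * (g * phiRam k q v)
  rw [map_mul, phiRam_ramify, mul_left_comm]

theorem phiD_bijective [CharZero k] (q : ℕ+) (g : LaurentSeries k) (hg : g ≠ 0) :
    Function.Bijective (phiD q g) :=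
  (mulLeft_bijective₀ g hg).comp (phiRam_bijective q)

/-- The difference module `D_g = (K_q, g φ)` for `0 ≠ g ∈ K_q`. -/
def D [CharZero k] (q : ℕ+) (g : LaurentSeries k) (hg : g ≠ 0) : DifferenceModule k where
  carrier := RamExt k q
  Phi := (show RamExt k q →ₗ[k] RamExt k q from phiD q g)
  Phi_smul := fun c v => phiD_ramify_mul q g c v
  bijective := phiD_bijective q g hg

/-- The irreducible difference module `S` has order `r`: it is isomorphic to some `D_g` with
`r = ord g`, where `ord` is normalized by `ord θ = 1`. -/
def HasOrder [CharZero k] (S : DifferenceModule k) (r : ℚ) : Prop :=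
  ∃ (q : ℕ+) (g : LaurentSeries k) (hg : g ≠ 0), Nonempty (S ≅ D q g hg) ∧
    r = (g.order : ℚ) / ((q : ℕ) : ℚ)

/-- All irreducible components have negative order. -/
def negOrder (k : Type u) [Field k] [CharZero k] : ObjectProperty (DifferenceModule k) :=
  fun D => ∀ S : DifferenceModule k, S.IsIrreducibleComponent D → ∃ r : ℚ, r < 0 ∧ S.HasOrder r

end DifferenceModule

/-! ### The local Mellin transform from infinity to infinity -/

/-- A lattice in a `k((x))`-vector space `V`: a subset `⊕ k[[x]] eᵢ` for a basis `eᵢ` of `V`. -/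
def IsLattice (k : Type u) [Field k] (V : Type u) [AddCommGroup V] [Module (LaurentSeries k) V]
    (L : Set V) : Prop :=
  ∃ (n : ℕ) (b : Module.Basis (Fin n) (LaurentSeries k) V),
    L = {v | ∀ i, b.repr v i ∈ Set.range (HahnSeries.ofPowerSeries ℤ k)}

/-- The `x`-adic topology on a `k((x))`-vector space, generated by the cosets of lattices. -/
@[reducible]
def adicTopology (k : Type u) [Field k] (V : Type u) [AddCommGroup V]
    [Module (LaurentSeries k) V] : TopologicalSpace V :=
  TopologicalSpace.generateFrom
    {U | ∃ (v : V) (L : Set V), IsLattice k V L ∧ U = (fun w => v + w) '' L}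

section Transform

variable {k : Type u} [Field k]

/-- Here the local coordinate of `E` is `ζ`, and `z = ζ⁻¹` acts on `E`. -/
def zAct (E : FormalConnection k) (v : E.carrier) : E.carrier :=
  (HahnSeries.single (-1 : ℤ) (1 : k) : LaurentSeries k) • v

/-- The connection written in terms of `z = ζ⁻¹`: `∇_z = -ζ² ∇_ζ`. -/
def nablaZ (E : FormalConnection k) (v : E.carrier) : E.carrier :=
  -((HahnSeries.single (2 : ℤ) (1 : k) : LaurentSeries k) • E.nabla v)

/-- `e` identifies the `k`-vector space underlying `E` with `D`, so that `D = (V_θ, Φ)`: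
* `θ` acts as `-(z ∇_z)⁻¹` (as `θ` is invertible on `D`, this contains the invertibility
  of `z ∇_z`);
* `Φ` acts as `z`;
* the action of `k((θ))` is the one extending that of `θ` by continuity: the `θ`-adic topology
  of `V_θ` coincides with the `ζ`-adic topology of `V`. -/
structure IsMellinTransform (E : FormalConnection k) (D : DifferenceModule k)
    (e : E.carrier ≃ₗ[k] D.carrier) : Prop where
  theta : ∀ v, (HahnSeries.single (1 : ℤ) (1 : k) : LaurentSeries k) •
    e (-(zAct E (nablaZ E v))) = e v
  Phi : ∀ v, D.Phi (e v) = e (zAct E v)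
  topology : (adicTopology k D.carrier).induced e = adicTopology k E.carrier

/-- The category `C_∞^{>0}`. -/
abbrev CInftyPos (k : Type u) [Field k] [CharZero k] :=
  (FormalConnection.posSlope k).FullSubcategory

/-- The category `N^{<0}`. -/
abbrev NNeg (k : Type u) [Field k] [CharZero k] :=
  (DifferenceModule.negOrder k).FullSubcategory

/-- The functor `M` is the local Mellin transform `(V, ∇) ↦ (V_θ, Φ)`, which does not change
the underlying maps of morphisms. -/
def IsLocalMellin [CharZero k] (M : CInftyPos k ⥤ NNeg k) : Prop :=
  ∃ e : ∀ E : CInftyPos k, E.obj.carrier ≃ₗ[k] (M.obj E).obj.carrier,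
    (∀ E, IsMellinTransform E.obj (M.obj E).obj (e E)) ∧
    ∀ (E E' : CInftyPos k) (f : E ⟶ E') (v : E.obj.carrier),
      (M.map f).hom.toLinearMap (e E v) = e E' (f.hom.toLinearMap v)

end Transform

end LocalMellin

end

/-! Put `δ = ζ ∇_ζ = -z ∇_z` (`FormalConnection.euler`). The transform asks for a `k((θ))`-structure
in which `θ⁻¹` acts as `δ`, with `Φ = ζ⁻¹`. The two sides match because `ζ⁻¹ δ = (δ + 1) ζ⁻¹` is the
relation `Φ θ⁻¹ = (θ⁻¹ + 1) Φ`, that is `φ(θ⁻¹) = θ⁻¹ + 1`. What has to be shown is that `δ` really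
is multiplication by `θ⁻¹` for a finite-dimensional `k((θ))`-structure with the given topology, and
conversely that `Φ` is multiplication by `ζ⁻¹` for a `k((ζ))`-structure.

Continuity reduces every identity to monomials (`AdicCont.eq_zero`): a continuous `k`-linear map
commuting with `x⁻¹` is `k((x))`-linear. Semilinearity of `Φ`, the Leibniz rule, full faithfulness
and uniqueness of the functor all come from this.

For `E_f` with `f` of order `-p` in `t = ζ^(1/q)`, `δ = f + ζ d/dζ` is conjugate to multiplication
by `τ^(-p)`, where `τ = θ^(1/p)`, through some `T : k((τ)) → k((t))` with `T(τ^n) = c^n t^n (1 + ∑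
q_m(n) t^m)` (`exists_conjugation`). The `q_m` are found recursively from difference equations
`q_m(n - p) - q_m(n) = known polynomial`. That they are polynomials in `n` is decisive: the operator
`t^(-q)`, carried to `k((τ))`, and `g φ` with `g = T⁻¹(t^(-q) T 1)` agree on the powers of `τ^(-p)`,
and polynomials agreeing infinitely often are equal (`IsPoly.ext`). Hence `E_f` goes to `D_g` with
`g` of order `-q` in `θ^(1/p)`: slope `p/q` becomes order `-q/p`. Exchanging the roles of `δ` and
`Φ` gives the inverse construction.

The general case is an induction along an irreducible quotient. In an extension the off-diagonal
block of the operator is a commutator with `x⁻¹` and is removed by a unipotent change of coordinates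
(`exists_commutator_eq`, `exists_equiv_of_exact`). To control the Jordan–Hölder factors,
irreducibility is carried across the transform in both directions
(`IsMellinTransform.isIrreducible`, `isIrreducible_E`). -/

noncomputable section

set_option linter.unusedSectionVars false

namespace LocalMellin

/-! ### The order filtration of `k((x))`. -/

section OrderFiltration

variable {k : Type u} [Field k]

/-- The monomial `x ^ n` of `k((x))`. -/
abbrev xpow (k : Type u) [Field k] (n : ℤ) : LaurentSeries k := HahnSeries.single n (1 : k)

theorem xpow_mul_xpow (m n : ℤ) : xpow k m * xpow k n = xpow k (m + n) := by
  rw [HahnSeries.single_mul_single, one_mul]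

theorem xpow_zero : xpow k 0 = 1 := rfl

theorem xpow_ne_zero (n : ℤ) : xpow k n ≠ 0 := by simp [xpow]

theorem coeff_xpow_mul (n : ℤ) (f : LaurentSeries k) (m : ℤ) :
    (xpow k n * f).coeff m = f.coeff (m - n) := by
  have := HahnSeries.coeff_single_mul_add (r := (1 : k)) (x := f) (a := m - n) (b := n)
  rwa [sub_add_cancel, one_mul] at this

/-- The series of order at least `n`. -/
def ordGE (k : Type u) [Field k] (n : ℤ) : Submodule k (LaurentSeries k) where
  carrier := {f | ∀ m < n, f.coeff m = 0}
  add_mem' hf hg m hm := by rw [HahnSeries.coeff_add, hf m hm, hg m hm, add_zero]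
  zero_mem' _ _ := HahnSeries.coeff_zero
  smul_mem' c f hf m hm := by rw [HahnSeries.coeff_smul, hf m hm, smul_zero]

theorem ordGE_anti {m n : ℤ} (h : m ≤ n) : ordGE k n ≤ ordGE k m :=
  fun _ hf j hj => hf j (hj.trans_le h)

theorem ordGE_mul {m n : ℤ} {f g : LaurentSeries k} (hf : f ∈ ordGE k m) (hg : g ∈ ordGE k n) :
    f * g ∈ ordGE k (m + n) := by
  intro j hj
  rw [HahnSeries.coeff_mul]
  refine Finset.sum_eq_zero fun ij hij => ?_
  have h := (Finset.mem_antidiagonal.1 hij).2.2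
  by_cases h1 : ij.1 < m
  · rw [hf _ h1, zero_mul]
  · rw [hg _ (by lia), mul_zero]

theorem mem_ordGE_order (f : LaurentSeries k) : f ∈ ordGE k f.order :=
  fun _ hm => HahnSeries.coeff_eq_zero_of_lt_order hm

theorem xpow_mem_ordGE (n : ℤ) : xpow k n ∈ ordGE k n :=
  fun _ hm => HahnSeries.coeff_single_of_ne hm.ne

theorem xpow_mul_mem_ordGE {m n : ℤ} {f : LaurentSeries k} :
    xpow k m * f ∈ ordGE k (m + n) ↔ f ∈ ordGE k n := by
  refine ⟨fun h => ?_, ordGE_mul (xpow_mem_ordGE m)⟩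
  have := ordGE_mul (xpow_mem_ordGE (-m)) h
  rwa [← mul_assoc, xpow_mul_xpow, neg_add_cancel, xpow_zero, one_mul, neg_add_cancel_left] at this

theorem mem_ordGE_zero_iff {f : LaurentSeries k} :
    f ∈ ordGE k 0 ↔ f ∈ Set.range (HahnSeries.ofPowerSeries ℤ k) := by
  constructor
  · intro h
    refine ⟨PowerSeries.mk fun i => f.coeff i, ?_⟩
    ext m
    rw [PowerSeries.coeff_coe]
    split_ifs with hm
    · exact (h m hm).symm
    · rw [PowerSeries.coeff_mk, Int.natAbs_of_nonneg (not_lt.1 hm)]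
  · rintro ⟨p, rfl⟩ m hm
    rw [PowerSeries.coeff_coe, if_pos hm]

theorem mem_ordGE_iff_exists {n : ℤ} {f : LaurentSeries k} :
    f ∈ ordGE k n ↔ ∃ p : PowerSeries k, f = xpow k n * HahnSeries.ofPowerSeries ℤ k p := by
  constructor
  · intro h
    have h1 := ordGE_mul (xpow_mem_ordGE (-n)) h
    rw [neg_add_cancel, mem_ordGE_zero_iff] at h1
    obtain ⟨p, hp⟩ := h1
    refine ⟨p, ?_⟩
    rw [hp, ← mul_assoc, xpow_mul_xpow, add_neg_cancel, xpow_zero, one_mul]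
  · rintro ⟨p, rfl⟩
    have := ordGE_mul (xpow_mem_ordGE n) (mem_ordGE_zero_iff.2 ⟨p, rfl⟩)
    rwa [add_zero] at this

theorem eq_zero_of_forall_mem_ordGE {f : LaurentSeries k} (h : ∀ n, f ∈ ordGE k n) : f = 0 := by
  ext m
  exact h (m + 1) m (lt_add_one m)

/-- A series is a Laurent polynomial up to series of high order. -/
theorem sub_sum_xpow_mem_ordGE {a : ℤ} {f : LaurentSeries k} (hf : f ∈ ordGE k a) (n : ℤ) :
    f - ∑ j ∈ Finset.Ico a n, f.coeff j • xpow k j ∈ ordGE k n := by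
  intro m hm
  rw [HahnSeries.coeff_sub, HahnSeries.coeff_sum]
  simp only [HahnSeries.coeff_smul, xpow, HahnSeries.coeff_single, smul_eq_mul, mul_ite, mul_one,
    mul_zero, Finset.sum_ite_eq, Finset.mem_Ico]
  split_ifs with h
  · exact sub_self _
  · rw [sub_zero]
    exact hf m (by lia)

theorem smul_eq_C_smul {V : Type u} [AddCommGroup V] [Module k V] [Module (LaurentSeries k) V]
    [IsScalarTower k (LaurentSeries k) V] (c : k) (v : V) :
    c • v = (HahnSeries.C c : LaurentSeries k) • v := by
  rw [← one_smul (LaurentSeries k) v, ← smul_assoc, smul_smul, ← HahnSeries.C_mul_eq_smul]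

instance : IsScalarTower k (LaurentSeries k) (LaurentSeries k) where
  smul_assoc c f g := by
    rw [smul_eq_mul, smul_eq_mul, ← HahnSeries.C_mul_eq_smul, ← HahnSeries.C_mul_eq_smul, mul_assoc]

end OrderFiltration

/-! ### Lattice filtrations of vector spaces over `k((x))`. -/

section BasisFiltration

variable {k : Type u} [Field k]
variable {V : Type u} [AddCommGroup V] [Module k V] [Module (LaurentSeries k) V]
  [IsScalarTower k (LaurentSeries k) V]
variable {W : Type u} [AddCommGroup W] [Module k W] [Module (LaurentSeries k) W]
  [IsScalarTower k (LaurentSeries k) W]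
variable {ι κ : Type*}

/-- The vectors whose coordinates in the basis `b` have order at least `n`. -/
def fil (b : Module.Basis ι (LaurentSeries k) V) (n : ℤ) : Submodule k V where
  carrier := {v | ∀ i, b.repr v i ∈ ordGE k n}
  add_mem' hv hw i := by
    rw [map_add, Finsupp.add_apply]
    exact add_mem (hv i) (hw i)
  zero_mem' i := by
    rw [map_zero, Finsupp.zero_apply]
    exact zero_mem _
  smul_mem' c v hv i := by
    rw [smul_eq_C_smul c v, map_smul, Finsupp.smul_apply, smul_eq_mul, HahnSeries.C_mul_eq_smul]
    exact Submodule.smul_mem _ c (hv i)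

theorem mem_fil {b : Module.Basis ι (LaurentSeries k) V} {n : ℤ} {v : V} :
    v ∈ fil b n ↔ ∀ i, b.repr v i ∈ ordGE k n := Iff.rfl

theorem fil_anti (b : Module.Basis ι (LaurentSeries k) V) {m n : ℤ} (h : m ≤ n) :
    fil b n ≤ fil b m := fun _ hv i => ordGE_anti h (hv i)

theorem smul_mem_fil {b : Module.Basis ι (LaurentSeries k) V} {m n : ℤ} {f : LaurentSeries k}
    {v : V} (hf : f ∈ ordGE k m) (hv : v ∈ fil b n) : f • v ∈ fil b (m + n) := by
  intro i
  rw [map_smul, Finsupp.smul_apply, smul_eq_mul]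
  exact ordGE_mul hf (hv i)

theorem exists_mem_fil [Finite ι] (b : Module.Basis ι (LaurentSeries k) V) (v : V) :
    ∃ n, v ∈ fil b n := by
  obtain ⟨n, hn⟩ := Finite.bddBelow_range fun i => (b.repr v i).order
  exact ⟨n, fun i => ordGE_anti (hn ⟨i, rfl⟩) (mem_ordGE_order _)⟩

theorem eq_zero_of_forall_mem_fil (b : Module.Basis ι (LaurentSeries k) V) {v : V}
    (h : ∀ n, v ∈ fil b n) : v = 0 := by
  refine b.ext_elem fun i => ?_
  rw [map_zero, Finsupp.zero_apply]
  exact eq_zero_of_forall_mem_ordGE fun n => h n i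

/-- The shift `d` is the least order among the images of the finitely many basis vectors.
Independence of the topology from the basis and continuity of linear maps both follow. -/
theorem exists_map_mem_fil [Finite ι] [Finite κ] (b : Module.Basis ι (LaurentSeries k) V)
    (b' : Module.Basis κ (LaurentSeries k) W) (A : V →ₗ[LaurentSeries k] W) :
    ∃ d : ℤ, ∀ n, ∀ v ∈ fil b n, A v ∈ fil b' (n + d) := by
  cases nonempty_fintype ι
  choose d hd using fun j => exists_mem_fil b' (A (b j))
  obtain ⟨e, he⟩ := Finite.bddBelow_range d
  refine ⟨e, fun n v hv => ?_⟩
  rw [← b.sum_repr v, map_sum]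
  refine Submodule.sum_mem _ fun j _ => ?_
  rw [map_smul]
  exact smul_mem_fil (hv j) (fil_anti b' (he ⟨j, rfl⟩) (hd j))

/-- The filtrations `F` and `G` define the same topology. -/
def Cofinal (F G : ℤ → Submodule k V) : Prop :=
  (∀ m, ∃ n, F n ≤ G m) ∧ ∀ m, ∃ n, G n ≤ F m

theorem cofinal_fil [Finite ι] [Finite κ] (b : Module.Basis ι (LaurentSeries k) V)
    (b' : Module.Basis κ (LaurentSeries k) V) : Cofinal (fil b) (fil b') := by
  constructor
  · intro m
    obtain ⟨d, hd⟩ := exists_map_mem_fil b b' LinearMap.id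
    exact ⟨m - d, fun v hv => by simpa using hd _ v hv⟩
  · intro m
    obtain ⟨d, hd⟩ := exists_map_mem_fil b' b LinearMap.id
    exact ⟨m - d, fun v hv => by simpa using hd _ v hv⟩

end BasisFiltration

/-! ### Continuous `k`-linear maps. -/

section AdicCont

variable {k : Type u} [Field k]
variable {V : Type u} [AddCommGroup V] [Module k V] [Module (LaurentSeries k) V]
  [IsScalarTower k (LaurentSeries k) V] [FiniteDimensional (LaurentSeries k) V]
variable {W : Type u} [AddCommGroup W] [Module k W] [Module (LaurentSeries k) W]
  [IsScalarTower k (LaurentSeries k) W] [FiniteDimensional (LaurentSeries k) W]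
variable {U : Type u} [AddCommGroup U] [Module k U] [Module (LaurentSeries k) U]
  [IsScalarTower k (LaurentSeries k) U] [FiniteDimensional (LaurentSeries k) U]
variable {ι κ : Type*}

/-- The filtration of a finite-dimensional space by the multiples of a fixed lattice. -/
def adicFil (k : Type u) [Field k] (V : Type u) [AddCommGroup V] [Module k V]
    [Module (LaurentSeries k) V] [IsScalarTower k (LaurentSeries k) V]
    [FiniteDimensional (LaurentSeries k) V] (n : ℤ) : Submodule k V :=
  fil (Module.finBasis (LaurentSeries k) V) n

/-- Continuity of a `k`-linear map for the adic topologies. -/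
def AdicCont (A : V →ₗ[k] W) : Prop :=
  ∀ m, ∃ n, ∀ v ∈ adicFil k V n, A v ∈ adicFil k W m

theorem cofinal_fil_adicFil [Finite ι] (b : Module.Basis ι (LaurentSeries k) V) :
    Cofinal (fil b) (adicFil k V) := cofinal_fil _ _

/-- Allows continuity to be tested on whichever filtration is convenient: the order on `k((x))`, or
the order in `x^(1/q)` on `K_q`. -/
theorem adicCont_iff {F : ℤ → Submodule k V} {G : ℤ → Submodule k W}
    (hF : Cofinal F (adicFil k V)) (hG : Cofinal G (adicFil k W)) {A : V →ₗ[k] W} :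
    AdicCont A ↔ ∀ m, ∃ n, ∀ v ∈ F n, A v ∈ G m := by
  constructor
  · intro h m
    obtain ⟨m', hm'⟩ := hG.2 m
    obtain ⟨n', hn'⟩ := h m'
    obtain ⟨n, hn⟩ := hF.1 n'
    exact ⟨n, fun v hv => hm' (hn' v (hn hv))⟩
  · intro h m
    obtain ⟨m', hm'⟩ := hG.1 m
    obtain ⟨n', hn'⟩ := h m'
    obtain ⟨n, hn⟩ := hF.2 n'
    exact ⟨n, fun v hv => hm' (hn' v (hn hv))⟩

theorem AdicCont.comp {B : W →ₗ[k] U} {A : V →ₗ[k] W} (hB : AdicCont B) (hA : AdicCont A) :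
    AdicCont (B ∘ₗ A) := by
  intro m
  obtain ⟨l, hl⟩ := hB m
  obtain ⟨n, hn⟩ := hA l
  exact ⟨n, fun v hv => hl _ (hn v hv)⟩

theorem AdicCont.add {A B : V →ₗ[k] W} (hA : AdicCont A) (hB : AdicCont B) :
    AdicCont (A + B) := by
  intro m
  obtain ⟨l, hl⟩ := hA m
  obtain ⟨n, hn⟩ := hB m
  exact ⟨max l n, fun v hv => add_mem (hl v (fil_anti _ (le_max_left l n) hv))
    (hn v (fil_anti _ (le_max_right l n) hv))⟩

theorem AdicCont.neg {A : V →ₗ[k] W} (hA : AdicCont A) : AdicCont (-A) := by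
  intro m
  obtain ⟨l, hl⟩ := hA m
  exact ⟨l, fun v hv => neg_mem (hl v hv)⟩

theorem AdicCont.sub {A B : V →ₗ[k] W} (hA : AdicCont A) (hB : AdicCont B) :
    AdicCont (A - B) := by
  rw [sub_eq_add_neg]
  exact hA.add hB.neg

theorem AdicCont.sum {α : Type*} (s : Finset α) {A : α → V →ₗ[k] W} (hA : ∀ a, AdicCont (A a)) :
    AdicCont (∑ a ∈ s, A a) := by
  classical
  induction s using Finset.induction_on with
  | empty => exact fun m => ⟨0, fun v _ => by simp⟩
  | insert a s ha ih =>
    rw [Finset.sum_insert ha]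
    exact (hA a).add ih

theorem adicCont_restrictScalars (A : V →ₗ[LaurentSeries k] W) :
    AdicCont (A.restrictScalars k) := by
  intro m
  obtain ⟨d, hd⟩ := exists_map_mem_fil (Module.finBasis (LaurentSeries k) V)
    (Module.finBasis (LaurentSeries k) W) A
  refine ⟨m - d, fun v hv => ?_⟩
  have := hd _ v hv
  rwa [sub_add_cancel] at this

theorem AdicCont.of_eq {A B : V →ₗ[k] W} (hA : AdicCont A) (h : ∀ v, A v = B v) : AdicCont B := by
  obtain rfl : A = B := LinearMap.ext h
  exact hA

theorem adicCont_id : AdicCont (LinearMap.id : V →ₗ[k] V) :=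
  (adicCont_restrictScalars (LinearMap.id : V →ₗ[LaurentSeries k] V)).of_eq fun _ => rfl

/-- Scalar multiplication by `f`, as a `k`-linear operator. -/
def smulOp (V : Type u) [AddCommGroup V] [Module k V] [Module (LaurentSeries k) V]
    [IsScalarTower k (LaurentSeries k) V] (f : LaurentSeries k) : V →ₗ[k] V :=
  (LinearMap.lsmul (LaurentSeries k) V f).restrictScalars k

@[simp]
theorem smulOp_apply (f : LaurentSeries k) (v : V) : smulOp V f v = f • v := rfl

theorem adicCont_smulOp (f : LaurentSeries k) : AdicCont (smulOp V f) :=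
  adicCont_restrictScalars _

/-- The map `f ↦ f • v`. -/
def smulVec (v : V) : LaurentSeries k →ₗ[k] V :=
  (LinearMap.toSpanSingleton (LaurentSeries k) V v).restrictScalars k

@[simp]
theorem smulVec_apply (f : LaurentSeries k) (v : V) : smulVec v f = f • v := rfl

theorem adicCont_smulVec (v : V) : AdicCont (smulVec (k := k) v) :=
  adicCont_restrictScalars _

theorem cofinal_ordGE : Cofinal (ordGE k) (adicFil k (LaurentSeries k)) := by
  have h : ordGE k = fil (Module.Basis.singleton Unit (LaurentSeries k)) := by
    funext n
    ext f
    simp [mem_fil]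
  rw [h]
  exact cofinal_fil_adicFil _

/-- A continuous `k`-linear map on `k((x))` is determined by its values at the monomials. -/
theorem AdicCont.eq_zero {A : LaurentSeries k →ₗ[k] W} (hA : AdicCont A)
    (h : ∀ n, A (xpow k n) = 0) : A = 0 := by
  ext1 f
  rw [LinearMap.zero_apply]
  refine eq_zero_of_forall_mem_fil (Module.finBasis (LaurentSeries k) W) fun m => ?_
  obtain ⟨n, hn⟩ := (adicCont_iff cofinal_ordGE ⟨fun m => ⟨m, le_rfl⟩, fun m => ⟨m, le_rfl⟩⟩).1 hA m
  -- `A` kills the Laurent polynomial truncation of `f`, so `A f` is the image of a remainder of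
  -- arbitrarily high order.
  have := hn _ (sub_sum_xpow_mem_ordGE (mem_ordGE_order f) n)
  rw [map_sub, map_sum] at this
  simp only [map_smul, h, smul_zero, Finset.sum_const_zero, sub_zero] at this
  exact this

/-- A continuous map compatible with the action of the monomials is compatible with scalars. -/
theorem AdicCont.map_smul_of_xpow {A : V →ₗ[k] W} (hA : AdicCont A)
    {σ : LaurentSeries k →ₗ[k] LaurentSeries k} (hσ : AdicCont σ) {v : V}
    (h : ∀ n, A (xpow k n • v) = σ (xpow k n) • A v) (f : LaurentSeries k) :
    A (f • v) = σ f • A v := by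
  have := ((hA.comp (adicCont_smulVec v)).sub ((adicCont_smulVec (A v)).comp hσ)).eq_zero
    fun n => by simp [h]
  simpa [sub_eq_zero] using LinearMap.congr_fun this f

/-- For a semilinear operator it suffices to consider `x⁻¹`. -/
theorem map_xpow_smul {A : V →ₗ[k] W} {σ : LaurentSeries k →+* LaurentSeries k}
    (h : ∀ v, A (xpow k (-1) • v) = σ (xpow k (-1)) • A v) (n : ℤ) (v : V) :
    A (xpow k n • v) = σ (xpow k n) • A v := by
  have hneg : ∀ (m : ℕ) (v : V), A (xpow k (-m) • v) = σ (xpow k (-m)) • A v := by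
    intro m
    induction m with
    | zero => intro v; simp
    | succ m ih =>
      intro v
      have : (-((m + 1 : ℕ) : ℤ)) = -m + -1 := by push_cast; ring
      rw [this, ← xpow_mul_xpow, mul_smul, ih, h, map_mul, mul_smul]
  obtain ⟨m, rfl | rfl⟩ := n.eq_nat_or_neg
  -- Positive powers follow by applying the negative case to `x^m v` and inverting `σ(x^(-m))`.
  · have h1 : σ (xpow k m) * σ (xpow k (-m)) = 1 := by
      rw [← map_mul, xpow_mul_xpow, add_neg_cancel, xpow_zero, map_one]
    have h2 := hneg m (xpow k m • v)
    rw [smul_smul, xpow_mul_xpow, neg_add_cancel, xpow_zero, one_smul] at h2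
    rw [h2, smul_smul, h1, one_smul]
  · exact hneg m v

/-- A continuous map commuting with `x⁻¹` is linear over `k((x))`. -/
theorem AdicCont.map_smul_of_commute {A : V →ₗ[k] W} (hA : AdicCont A)
    (h : ∀ v, A (xpow k (-1) • v) = xpow k (-1) • A v) (f : LaurentSeries k) (v : V) :
    A (f • v) = f • A v :=
  hA.map_smul_of_xpow (σ := LinearMap.id) adicCont_id
    (fun n => map_xpow_smul (σ := RingHom.id _) h n v) f

end AdicCont

/-! ### Continuous maps with prescribed values on monomials. -/

section StrongLinear

variable {k : Type u} [Field k]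

/-- The series `∑ n, f_n s_n`, where the sequence `s` tends to `0` at `+∞`. -/
def strongSum (s : ℤ → LaurentSeries k) (hs : ∀ m, ∃ N, ∀ n ≥ N, s n ∈ ordGE k m)
    (f : LaurentSeries k) : LaurentSeries k where
  coeff m := ∑ᶠ n, f.coeff n * (s n).coeff m
  isPWO_support' := by
    refine (BddBelow.isWF ?_).isPWO
    -- Terms with `n < f.order` vanish and those with `n ≥ N` have order at least `0`. Only the
    -- finitely many terms in between can push the order below `0`.
    obtain ⟨N, hN⟩ := hs 0
    obtain ⟨d, hd⟩ := ((Finset.Ico f.order N).image fun n => (s n).order).bddBelow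
    refine ⟨min 0 d, fun m hm => ?_⟩
    by_contra hlt
    apply hm
    refine finsum_eq_zero_of_forall_eq_zero fun n => ?_
    by_cases h1 : n < f.order
    · rw [mem_ordGE_order f n h1, zero_mul]
    · by_cases h2 : N ≤ n
      · rw [hN n h2 m (by lia), mul_zero]
      · have := hd (Finset.mem_coe.2 (Finset.mem_image_of_mem (fun n => (s n).order)
          (Finset.mem_Ico.2 ⟨not_lt.1 h1, not_le.1 h2⟩)))
        rw [mem_ordGE_order (s n) m (by lia), mul_zero]

theorem strongSum_finite {s : ℤ → LaurentSeries k} (hs : ∀ m, ∃ N, ∀ n ≥ N, s n ∈ ordGE k m)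
    (f : LaurentSeries k) (m : ℤ) :
    (Function.support fun n => f.coeff n * (s n).coeff m).Finite := by
  obtain ⟨N, hN⟩ := hs (m + 1)
  refine (Set.finite_Ico f.order N).subset fun n hn => ⟨?_, ?_⟩
  · by_contra h
    exact hn (by simp only [mem_ordGE_order f n (not_le.1 h), zero_mul])
  · by_contra h
    exact hn (by simp only [hN n (not_lt.1 h) m (lt_add_one m), mul_zero])

/-- The continuous `k`-linear map sending `x ^ n` to `s n`. -/
def strongLinear (s : ℤ → LaurentSeries k) (hs : ∀ m, ∃ N, ∀ n ≥ N, s n ∈ ordGE k m) :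
    LaurentSeries k →ₗ[k] LaurentSeries k where
  toFun := strongSum s hs
  map_add' f g := by
    ext m
    rw [HahnSeries.coeff_add]
    simp only [strongSum, HahnSeries.coeff_add, add_mul]
    exact finsum_add_distrib (strongSum_finite hs f m) (strongSum_finite hs g m)
  map_smul' c f := by
    ext m
    simp only [strongSum, HahnSeries.coeff_smul, smul_eq_mul, mul_assoc, RingHom.id_apply]
    exact (smul_finsum c _).symm

theorem strongLinear_coeff (s : ℤ → LaurentSeries k)
    (hs : ∀ m, ∃ N, ∀ n ≥ N, s n ∈ ordGE k m) (f : LaurentSeries k) (m : ℤ) :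
    (strongLinear s hs f).coeff m = ∑ᶠ n, f.coeff n * (s n).coeff m := rfl

theorem strongLinear_xpow (s : ℤ → LaurentSeries k)
    (hs : ∀ m, ∃ N, ∀ n ≥ N, s n ∈ ordGE k m) (n : ℤ) : strongLinear s hs (xpow k n) = s n := by
  ext m
  rw [strongLinear_coeff, finsum_eq_single _ n]
  · simp
  · intro j hj
    rw [xpow, HahnSeries.coeff_single_of_ne hj, zero_mul]

theorem strongLinear_mem_ordGE {s : ℤ → LaurentSeries k}
    (hs : ∀ m, ∃ N, ∀ n ≥ N, s n ∈ ordGE k m) {N m : ℤ} (hN : ∀ n ≥ N, s n ∈ ordGE k m)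
    {f : LaurentSeries k} (hf : f ∈ ordGE k N) : strongLinear s hs f ∈ ordGE k m := by
  intro j hj
  rw [strongLinear_coeff]
  refine finsum_eq_zero_of_forall_eq_zero fun n => ?_
  by_cases h : n < N
  · rw [hf n h, zero_mul]
  · rw [hN n (not_lt.1 h) j hj, mul_zero]

theorem adicCont_strongLinear (s : ℤ → LaurentSeries k)
    (hs : ∀ m, ∃ N, ∀ n ≥ N, s n ∈ ordGE k m) : AdicCont (strongLinear s hs) := by
  refine (adicCont_iff cofinal_ordGE cofinal_ordGE).2 fun m => ?_
  obtain ⟨N, hN⟩ := hs m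
  exact ⟨N, fun f hf => strongLinear_mem_ordGE hs hN hf⟩

variable {W : Type u} [AddCommGroup W] [Module k W] [Module (LaurentSeries k) W]
  [IsScalarTower k (LaurentSeries k) W] [FiniteDimensional (LaurentSeries k) W]

theorem exists_adicCont_xpow (s : ℤ → W) (hs : ∀ m, ∃ N, ∀ n ≥ N, s n ∈ adicFil k W m) :
    ∃ T : LaurentSeries k →ₗ[k] W, AdicCont T ∧ ∀ n, T (xpow k n) = s n := by
  let b := Module.finBasis (LaurentSeries k) W
  have hs' : ∀ i m, ∃ N, ∀ n ≥ N, b.repr (s n) i ∈ ordGE k m := by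
    intro i m
    obtain ⟨N, hN⟩ := hs m
    exact ⟨N, fun n hn => hN n hn i⟩
  refine ⟨∑ i, smulVec (b i) ∘ₗ strongLinear (fun n => b.repr (s n) i) (hs' i),
    AdicCont.sum _ fun i => (adicCont_smulVec _).comp (adicCont_strongLinear _ _), fun n => ?_⟩
  rw [LinearMap.sum_apply]
  simp only [LinearMap.comp_apply, strongLinear_xpow, smulVec_apply]
  exact b.sum_repr (s n)

end StrongLinear

/-! ### Comparison with the topology generated by cosets of lattices. -/

section Topology

variable {k : Type u} [Field k]
variable {V : Type u} [AddCommGroup V] [Module k V] [Module (LaurentSeries k) V]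
  [IsScalarTower k (LaurentSeries k) V] [FiniteDimensional (LaurentSeries k) V]
variable {W : Type u} [AddCommGroup W] [Module k W] [Module (LaurentSeries k) W]
  [IsScalarTower k (LaurentSeries k) W] [FiniteDimensional (LaurentSeries k) W]

theorem isLattice_iff {L : Set V} : IsLattice k V L ↔
    ∃ (n : ℕ) (b : Module.Basis (Fin n) (LaurentSeries k) V), L = (fil b 0 : Set V) := by
  simp only [IsLattice, ← mem_ordGE_zero_iff]
  rfl

theorem isLattice_fil {n : ℕ} (b : Module.Basis (Fin n) (LaurentSeries k) V) (m : ℤ) :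
    IsLattice k V (fil b m : Set V) := by
  have hu : ∀ _ : Fin n, IsUnit (xpow k m) := fun _ => (xpow_ne_zero m).isUnit
  refine isLattice_iff.2 ⟨n, b.isUnitSMul hu, ?_⟩
  ext v
  refine forall_congr' fun i => ?_
  have h : b.repr v i = xpow k m * (b.isUnitSMul hu).repr v i := by
    rw [Module.Basis.repr_isUnitSMul, Units.smul_def, smul_eq_mul, ← mul_assoc,
      IsUnit.mul_val_inv, one_mul]
  rw [h]
  have := xpow_mul_mem_ordGE (m := m) (n := 0) (f := (b.isUnitSMul hu).repr v i)
  rwa [add_zero] at this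

/-- The cosets of lattices are only a subbase in the definition. They behave as a base because any
lattice, hence any finite intersection of lattices, contains a step of the fixed filtration
`adicFil`, and these steps are themselves lattices. -/
theorem isOpen_adicTopology_iff {U : Set V} : @IsOpen V (adicTopology k V) U ↔
    ∀ u ∈ U, ∃ n, ∀ w ∈ adicFil k V n, u + w ∈ U := by
  constructor
  · intro h
    change TopologicalSpace.GenerateOpen _ U at h
    induction h with
    | basic U hU =>
      obtain ⟨v, L, hL, rfl⟩ := hU
      obtain ⟨m, b, rfl⟩ := isLattice_iff.1 hL
      rintro _ ⟨w, hw, rfl⟩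
      obtain ⟨n, hn⟩ := (cofinal_fil_adicFil b).2 0
      exact ⟨n, fun w' hw' => ⟨w + w', add_mem hw (hn hw'), (add_assoc v w w').symm⟩⟩
    | univ => exact fun _ _ => ⟨0, fun _ _ => trivial⟩
    | inter U U' _ _ ih ih' =>
      intro u hu
      obtain ⟨n, hn⟩ := ih u hu.1
      obtain ⟨n', hn'⟩ := ih' u hu.2
      exact ⟨max n n', fun w hw => ⟨hn w (fil_anti _ (le_max_left n n') hw),
        hn' w (fil_anti _ (le_max_right n n') hw)⟩⟩
    | sUnion S _ ih =>
      rintro u ⟨U, hU, hu⟩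
      obtain ⟨n, hn⟩ := ih U hU u hu
      exact ⟨n, fun w hw => ⟨U, hU, hn w hw⟩⟩
  · intro h
    let _ := adicTopology k V
    refine isOpen_iff_forall_mem_open.2 fun u hu => ?_
    obtain ⟨n, hn⟩ := h u hu
    refine ⟨(fun w => u + w) '' (adicFil k V n : Set V), ?_, ?_, ⟨0, zero_mem _, add_zero u⟩⟩
    · rintro _ ⟨w, hw, rfl⟩
      exact hn w hw
    · exact TopologicalSpace.isOpen_generateFrom_of_mem ⟨u, _, isLattice_fil _ n, rfl⟩

theorem adicCont_iff_continuous {A : V →ₗ[k] W} :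
    AdicCont A ↔ @Continuous V W (adicTopology k V) (adicTopology k W) A := by
  let _ := adicTopology k V
  let _ := adicTopology k W
  rw [continuous_def]
  constructor
  · intro h U hU
    refine isOpen_adicTopology_iff.2 fun u hu => ?_
    obtain ⟨m, hm⟩ := isOpen_adicTopology_iff.1 hU _ hu
    obtain ⟨n, hn⟩ := h m
    refine ⟨n, fun w hw => ?_⟩
    rw [Set.mem_preimage, map_add]
    exact hm _ (hn w hw)
  · intro h m
    have hU : @IsOpen W (adicTopology k W) (adicFil k W m : Set W) :=
      isOpen_adicTopology_iff.2 fun u hu => ⟨m, fun w hw => add_mem hu hw⟩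
    obtain ⟨n, hn⟩ := isOpen_adicTopology_iff.1 (h _ hU) 0 (by simp)
    exact ⟨n, fun v hv => by simpa using hn v hv⟩

/-- Turns the topological clause of `IsMellinTransform` into continuity of `e` and of its inverse,
the only form used below. -/
theorem induced_adicTopology_eq_iff {e : V ≃ₗ[k] W} :
    (adicTopology k W).induced e = adicTopology k V ↔
      AdicCont (e : V →ₗ[k] W) ∧ AdicCont (e.symm : W →ₗ[k] V) := by
  rw [adicCont_iff_continuous, adicCont_iff_continuous]
  let _ := adicTopology k V
  let _ := adicTopology k W
  constructor
  · intro h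
    have hi : Topology.IsInducing e := ⟨h.symm⟩
    refine ⟨hi.continuous, hi.continuous_iff.2 ?_⟩
    convert continuous_id (X := W) using 1
    funext w
    exact e.apply_symm_apply w
  · rintro ⟨h, h'⟩
    exact (Homeomorph.isInducing ⟨e.toEquiv, h, h'⟩).eq_induced.symm

end Topology

/-! ### Continuity and commutation relations of the basic operators. -/

section Operators

variable {k : Type u} [Field k]

theorem adicCont_derivative : AdicCont (LaurentSeries.derivative k (V := k)) := by
  refine (adicCont_iff cofinal_ordGE cofinal_ordGE).2 fun m => ⟨m + 1, fun f hf j hj => ?_⟩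
  rw [LaurentSeries.derivative_apply, LaurentSeries.hasseDeriv_coeff, hf _ (by push_cast; lia),
    smul_zero]

theorem derivative_xpow (n : ℤ) :
    LaurentSeries.derivative k (xpow k n) = HahnSeries.single (n - 1) (n : k) := by
  rw [LaurentSeries.derivative_apply, LaurentSeries.hasseDeriv_single]
  simp

/-- `substHom` as a `k`-linear map. -/
def substLin (s : PowerSeries k) (h0 : PowerSeries.constantCoeff s = 0) (hs : s ≠ 0) :
    LaurentSeries k →ₗ[k] LaurentSeries k where
  toFun := substHom s h0 hs
  map_add' := map_add _
  map_smul' c f := by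
    rw [RingHom.id_apply, ← HahnSeries.C_mul_eq_smul, ← HahnSeries.C_mul_eq_smul, map_mul,
      substHom_C]

/-- Writing `s = X * r`, the substitution sends `x^n p` with `n ≥ 0` to `x^n r^n p(s)`, so
nonnegative orders are not lowered. Passing to `m.toNat` keeps the argument among power series,
where substitution is explicit. -/
theorem adicCont_substLin (s : PowerSeries k) (h0 : PowerSeries.constantCoeff s = 0)
    (hs : s ≠ 0) : AdicCont (substLin s h0 hs) := by
  refine (adicCont_iff cofinal_ordGE cofinal_ordGE).2 fun m => ⟨m.toNat, fun f hf => ?_⟩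
  refine ordGE_anti (Int.self_le_toNat m) ?_
  obtain ⟨p, rfl⟩ := mem_ordGE_iff_exists.1 hf
  obtain ⟨r, hr⟩ := PowerSeries.X_dvd_iff.2 h0
  have hX : xpow k m.toNat = HahnSeries.ofPowerSeries ℤ k (PowerSeries.X ^ m.toNat) :=
    (HahnSeries.ofPowerSeries_X_pow _).symm
  have hsub := PowerSeries.HasSubst.of_constantCoeff_zero' h0
  refine mem_ordGE_iff_exists.2 ⟨r ^ m.toNat * p.subst s, ?_⟩
  change substHom s h0 hs _ = _
  rw [hX, ← map_mul, ← map_mul, substHom_coe, PowerSeries.subst_mul hsub,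
    PowerSeries.subst_pow hsub, PowerSeries.subst_X hsub, hr, mul_pow, mul_assoc]

/-- `φ` as a `k`-linear map. -/
def phiLin (k : Type u) [Field k] : LaurentSeries k →ₗ[k] LaurentSeries k :=
  substLin (shiftSeries k) shiftSeries_constantCoeff shiftSeries_ne_zero

theorem adicCont_phiLin : AdicCont (phiLin k) := adicCont_substLin _ _ _

/-- In the coordinate `θ⁻¹` the automorphism is the unit translation; `euler_xpow_neg_one` is the
same relation on the side of connections. -/
theorem phi_xpow_neg_one : phi k (xpow k (-1)) = xpow k (-1) + 1 := by
  have h1 : phi k (xpow k 1) * (1 + xpow k 1) = xpow k 1 := by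
    have hX : xpow k 1 = HahnSeries.ofPowerSeries ℤ k PowerSeries.X :=
      HahnSeries.ofPowerSeries_X.symm
    rw [hX, phi, substHom_coe, PowerSeries.subst_X
      (PowerSeries.HasSubst.of_constantCoeff_zero' shiftSeries_constantCoeff), ← map_one
      (HahnSeries.ofPowerSeries ℤ k), ← map_add, ← map_mul, shiftSeries, mul_assoc,
      PowerSeries.inv_mul_cancel _ (by simp), mul_one]
  have h2 : xpow k (-1) * xpow k 1 = 1 := by rw [xpow_mul_xpow]; rfl
  have h3 : phi k (xpow k (-1)) * phi k (xpow k 1) = 1 := by rw [← map_mul, h2, map_one]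
  calc phi k (xpow k (-1))
      = phi k (xpow k (-1)) * (xpow k (-1) * xpow k 1) := by rw [h2, mul_one]
    _ = phi k (xpow k (-1)) * (xpow k (-1) * (phi k (xpow k 1) * (1 + xpow k 1))) := by rw [h1]
    _ = (phi k (xpow k (-1)) * phi k (xpow k 1)) * (xpow k (-1) + xpow k (-1) * xpow k 1) := by
      ring
    _ = xpow k (-1) + 1 := by rw [h2, h3, one_mul]

/-- In a basis `∇` is a matrix plus the coordinatewise derivative, and the derivative lowers orders
by at most one. -/
theorem FormalConnection.adicCont_nabla (E : FormalConnection k) : AdicCont E.nabla := by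
  let b := Module.finBasis (LaurentSeries k) E.carrier
  refine AdicCont.of_eq (A := ∑ i, (smulVec (E.nabla (b i)) ∘ₗ (b.coord i).restrictScalars k +
    smulVec (b i) ∘ₗ LaurentSeries.derivative k ∘ₗ (b.coord i).restrictScalars k))
    (AdicCont.sum _ fun i => ((adicCont_smulVec _).comp (adicCont_restrictScalars _)).add
      ((adicCont_smulVec _).comp (adicCont_derivative.comp (adicCont_restrictScalars _)))) ?_
  intro v
  conv_rhs => rw [← b.sum_repr v, map_sum]
  rw [LinearMap.sum_apply]
  refine Finset.sum_congr rfl fun i _ => ?_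
  rw [E.leibniz]
  rfl

theorem DifferenceModule.adicCont_Phi (D : DifferenceModule k) : AdicCont D.Phi := by
  let b := Module.finBasis (LaurentSeries k) D.carrier
  refine AdicCont.of_eq
    (A := ∑ i, (smulVec (D.Phi (b i)) ∘ₗ phiLin k ∘ₗ (b.coord i).restrictScalars k))
    (AdicCont.sum _ fun i => ((adicCont_smulVec _).comp
      (adicCont_phiLin.comp (adicCont_restrictScalars _)))) ?_
  intro v
  conv_rhs => rw [← b.sum_repr v, map_sum]
  rw [LinearMap.sum_apply]
  refine Finset.sum_congr rfl fun i _ => ?_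
  rw [D.Phi_smul]
  rfl

/-- The operator `ζ ∇_ζ = -z ∇_z`. -/
def FormalConnection.euler (E : FormalConnection k) : E.carrier →ₗ[k] E.carrier :=
  smulOp E.carrier (xpow k 1) ∘ₗ E.nabla

theorem FormalConnection.euler_apply (E : FormalConnection k) (v : E.carrier) :
    E.euler v = xpow k 1 • E.nabla v := rfl

theorem FormalConnection.adicCont_euler (E : FormalConnection k) : AdicCont E.euler :=
  (adicCont_smulOp _).comp E.adicCont_nabla

theorem FormalConnection.nabla_eq (E : FormalConnection k) (v : E.carrier) :
    E.nabla v = xpow k (-1) • E.euler v := by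
  rw [E.euler_apply, smul_smul, xpow_mul_xpow, neg_add_cancel, xpow_zero, one_smul]

theorem neg_zAct_nablaZ (E : FormalConnection k) (v : E.carrier) :
    -(zAct E (nablaZ E v)) = E.euler v := by
  rw [zAct, nablaZ, smul_neg, neg_neg, smul_smul, xpow_mul_xpow]
  rfl

theorem FormalConnection.euler_xpow_neg_one (E : FormalConnection k) (v : E.carrier) :
    E.euler (xpow k (-1) • v) = xpow k (-1) • E.euler v - xpow k (-1) • v := by
  have h : xpow k 1 * LaurentSeries.derivative k (xpow k (-1)) = -xpow k (-1) := by
    rw [derivative_xpow, HahnSeries.single_mul_single, ← HahnSeries.single_neg]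
    simp
  rw [E.euler_apply, E.leibniz, smul_add, smul_smul, smul_smul, h, neg_smul, ← sub_eq_add_neg,
    mul_comm, mul_smul, E.euler_apply]

end Operators

/-! ### The transform as an exchange of the pairs `(ζ⁻¹, ζ ∇_ζ)` and `(Φ, θ⁻¹)`. -/

section Transform

variable {k : Type u} [Field k]

/-- The working form: `e` carries `ζ ∇_ζ` to `θ⁻¹` and `ζ⁻¹` to `Φ`, and is a homeomorphism. It is
symmetric in the two sides, which allows parallel arguments in both directions. -/
theorem isMellinTransform_iff {E : FormalConnection k} {D : DifferenceModule k}
    {e : E.carrier ≃ₗ[k] D.carrier} : IsMellinTransform E D e ↔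
      (∀ v, e (E.euler v) = xpow k (-1) • e v) ∧ (∀ v, D.Phi (e v) = e (xpow k (-1) • v)) ∧
      AdicCont (e : E.carrier →ₗ[k] D.carrier) ∧ AdicCont (e.symm : D.carrier →ₗ[k] E.carrier) := by
  have key : ∀ v, xpow k 1 • e (E.euler v) = e v ↔ e (E.euler v) = xpow k (-1) • e v := by
    intro v
    constructor
    · intro h
      rw [← h, smul_smul, xpow_mul_xpow, neg_add_cancel, xpow_zero, one_smul]
    · intro h
      rw [h, smul_smul, xpow_mul_xpow, add_neg_cancel, xpow_zero, one_smul]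
  constructor
  · rintro ⟨h1, h2, h3⟩
    refine ⟨fun v => ?_, h2, induced_adicTopology_eq_iff.1 h3⟩
    rw [← key, ← neg_zAct_nablaZ]
    exact h1 v
  · rintro ⟨h1, h2, h3⟩
    refine ⟨fun v => ?_, h2, induced_adicTopology_eq_iff.2 h3⟩
    rw [neg_zAct_nablaZ]
    exact (key v).2 (h1 v)

/-- The difference module on `M` defined by an identification of `E` with `M` that turns `ζ ∇_ζ`
into `θ⁻¹`. -/
def differenceModuleOf (E : FormalConnection k) (M : Type u) [AddCommGroup M] [Module k M]
    [Module (LaurentSeries k) M] [IsScalarTower k (LaurentSeries k) M]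
    [FiniteDimensional (LaurentSeries k) M] (e : E.carrier ≃ₗ[k] M)
    (h : ∀ v, e (E.euler v) = xpow k (-1) • e v)
    (he : AdicCont (e : E.carrier →ₗ[k] M)) (he' : AdicCont (e.symm : M →ₗ[k] E.carrier)) :
    DifferenceModule k where
  carrier := M
  Phi := (e : E.carrier →ₗ[k] M) ∘ₗ smulOp E.carrier (xpow k (-1)) ∘ₗ (e.symm : M →ₗ[k] E.carrier)
  Phi_smul := by
    intro f m
    -- Both sides are continuous in the scalar, so only `θ⁻¹` has to be checked; there semilinearity
    -- is the commutation of `ζ ∇_ζ` with `ζ⁻¹`.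
    refine AdicCont.map_smul_of_xpow (σ := phiLin k) (he.comp ((adicCont_smulOp _).comp he'))
      adicCont_phiLin (fun n => map_xpow_smul (σ := phi k) (fun v => ?_) n m) f
    obtain ⟨w, rfl⟩ := e.surjective v
    rw [phi_xpow_neg_one, ← h]
    simp only [LinearMap.comp_apply, LinearEquiv.coe_coe, LinearEquiv.symm_apply_apply,
      smulOp_apply, add_smul, one_smul, ← h, ← map_add, E.euler_xpow_neg_one]
    congr 1
    abel
  bijective := by
    have hz : Function.Bijective (smulOp E.carrier (xpow k (-1))) := by
      refine Function.bijective_iff_has_inverse.2 ⟨smulOp E.carrier (xpow k 1), fun v => ?_,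
        fun v => ?_⟩ <;> simp [smul_smul]
    exact e.bijective.comp (hz.comp e.symm.bijective)

theorem isMellinTransform_differenceModuleOf (E : FormalConnection k) (M : Type u)
    [AddCommGroup M] [Module k M] [Module (LaurentSeries k) M]
    [IsScalarTower k (LaurentSeries k) M] [FiniteDimensional (LaurentSeries k) M]
    (e : E.carrier ≃ₗ[k] M) (h : ∀ v, e (E.euler v) = xpow k (-1) • e v)
    (he : AdicCont (e : E.carrier →ₗ[k] M)) (he' : AdicCont (e.symm : M →ₗ[k] E.carrier)) :
    IsMellinTransform E (differenceModuleOf E M e h he he') e := by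
  refine isMellinTransform_iff.2 ⟨h, fun v => ?_, he, he'⟩
  change e (xpow k (-1) • e.symm (e v)) = _
  rw [e.symm_apply_apply]
  rfl

/-- The connection on `M` defined by an identification of `M` with `D` that turns `ζ⁻¹` into `Φ`. -/
def formalConnectionOf (D : DifferenceModule k) (M : Type u) [AddCommGroup M] [Module k M]
    [Module (LaurentSeries k) M] [IsScalarTower k (LaurentSeries k) M]
    [FiniteDimensional (LaurentSeries k) M] (e : M ≃ₗ[k] D.carrier)
    (h : ∀ v, D.Phi (e v) = e (xpow k (-1) • v))
    (he : AdicCont (e : M →ₗ[k] D.carrier)) (he' : AdicCont (e.symm : D.carrier →ₗ[k] M)) :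
    FormalConnection k where
  carrier := M
  nabla := smulOp M (xpow k (-1)) ∘ₗ (e.symm : D.carrier →ₗ[k] M) ∘ₗ
    smulOp D.carrier (xpow k (-1)) ∘ₗ (e : M →ₗ[k] D.carrier)
  leibniz := by
    intro f m
    let N : M →ₗ[k] M := (e.symm : D.carrier →ₗ[k] M) ∘ₗ
      smulOp D.carrier (xpow k (-1)) ∘ₗ (e : M →ₗ[k] D.carrier)
    have hN : AdicCont N := he'.comp ((adicCont_smulOp _).comp he)
    have eN : ∀ v, e (N v) = xpow k (-1) • e v := fun v => e.apply_symm_apply _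
    -- `N` is the future `ζ ∇_ζ`. Its commutation with `ζ⁻¹` is `φ(θ⁻¹) = θ⁻¹ + 1` read through `e`.
    have comm : ∀ v, N (xpow k (-1) • v) = xpow k (-1) • N v - xpow k (-1) • v := by
      intro v
      apply e.injective
      rw [eN, map_sub, ← h, ← h, eN, D.Phi_smul, phi_xpow_neg_one, add_smul, one_smul,
        add_sub_cancel_right]
    have hneg : ∀ (n : ℕ) (v : M), N (xpow k (-n) • v) =
        xpow k (-n) • N v - n • xpow k (-n) • v := by
      intro n
      induction n with
      | zero => intro v; simp
      | succ n ih =>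
        intro v
        have : (-((n + 1 : ℕ) : ℤ)) = -n + -1 := by push_cast; ring
        rw [this, ← xpow_mul_xpow, mul_smul, ih, comm, smul_sub, ← mul_smul, ← mul_smul, succ_nsmul']
        abel
    have hpow : ∀ (n : ℤ) (v : M), N (xpow k n • v) = xpow k n • N v + n • xpow k n • v := by
      intro n v
      obtain ⟨n, rfl | rfl⟩ := n.eq_nat_or_neg
      · have h1 := hneg n (xpow k n • v)
        rw [smul_smul, xpow_mul_xpow, neg_add_cancel, xpow_zero, one_smul] at h1
        rw [h1, smul_sub, smul_smul, xpow_mul_xpow, add_neg_cancel, xpow_zero, one_smul,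
          smul_comm (xpow k n) n, natCast_zsmul, sub_add_cancel]
      · rw [hneg, neg_smul, natCast_zsmul, sub_eq_add_neg]
    -- The defect of the Leibniz rule for `N` at the vector `m`. It is continuous in the scalar and
    -- vanishes on monomials by `hpow`.
    let R : LaurentSeries k →ₗ[k] M := N ∘ₗ smulVec m - smulVec (N m) -
      smulVec m ∘ₗ smulOp (LaurentSeries k) (xpow k 1) ∘ₗ LaurentSeries.derivative k
    have hR : R = 0 := by
      refine AdicCont.eq_zero (((hN.comp (adicCont_smulVec _)).sub (adicCont_smulVec _)).sub
        ((adicCont_smulVec _).comp ((adicCont_smulOp _).comp adicCont_derivative))) fun n => ?_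
      have h1 : xpow k 1 * LaurentSeries.derivative k (xpow k n) = n • xpow k n := by
        rw [derivative_xpow, HahnSeries.single_mul_single, add_sub_cancel, one_mul]
        ext j
        rw [HahnSeries.coeff_smul, HahnSeries.coeff_single, HahnSeries.coeff_single]
        split_ifs <;> simp
      simp only [R, LinearMap.sub_apply, LinearMap.comp_apply, smulVec_apply, smulOp_apply, hpow,
        smul_eq_mul, h1, smul_assoc]
      abel
    have hf := LinearMap.congr_fun hR f
    simp only [R, LinearMap.sub_apply, LinearMap.comp_apply, smulVec_apply, smulOp_apply,
      LinearMap.zero_apply, smul_eq_mul] at hf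
    rw [sub_sub, sub_eq_zero] at hf
    change xpow k (-1) • N (f • m) = f • xpow k (-1) • N m + _
    rw [hf, smul_add, smul_comm, smul_smul (xpow k (-1)) (_ * _), ← mul_assoc, xpow_mul_xpow,
      neg_add_cancel, xpow_zero, one_mul]

theorem isMellinTransform_formalConnectionOf (D : DifferenceModule k) (M : Type u)
    [AddCommGroup M] [Module k M] [Module (LaurentSeries k) M]
    [IsScalarTower k (LaurentSeries k) M] [FiniteDimensional (LaurentSeries k) M]
    (e : M ≃ₗ[k] D.carrier) (h : ∀ v, D.Phi (e v) = e (xpow k (-1) • v))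
    (he : AdicCont (e : M →ₗ[k] D.carrier)) (he' : AdicCont (e.symm : D.carrier →ₗ[k] M)) :
    IsMellinTransform (formalConnectionOf D M e h he he') D e := by
  refine isMellinTransform_iff.2 ⟨fun v => ?_, h, he, he'⟩
  change e (xpow k 1 • xpow k (-1) • e.symm (xpow k (-1) • e v)) = _
  rw [smul_smul, xpow_mul_xpow, add_neg_cancel, xpow_zero, one_smul, e.apply_symm_apply]
  rfl

/-- A horizontal map, transported to the Mellin transforms. -/
def IsMellinTransform.mapHom {E E' : FormalConnection k} {D D' : DifferenceModule k}
    {e : E.carrier ≃ₗ[k] D.carrier} {e' : E'.carrier ≃ₗ[k] D'.carrier}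
    (h : IsMellinTransform E D e) (h' : IsMellinTransform E' D' e') (f : E ⟶ E') : D ⟶ D' where
  toLinearMap :=
    { toFun := fun v => e' (f.toLinearMap (e.symm v))
      map_add' := fun v w => by simp
      map_smul' := by
        obtain ⟨h1, -, -, hc'⟩ := isMellinTransform_iff.1 h
        obtain ⟨h1', -, hc, -⟩ := isMellinTransform_iff.1 h'
        refine AdicCont.map_smul_of_commute
          -- Commutation with `θ⁻¹` is commutation with `ζ ∇_ζ`, which holds because `f` is
          -- horizontal and linear; continuity extends it to all of `k((θ))`.
          (A := (e' : E'.carrier →ₗ[k] D'.carrier) ∘ₗ f.toLinearMap.restrictScalars k ∘ₗ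
            (e.symm : D.carrier →ₗ[k] E.carrier))
          (hc.comp ((adicCont_restrictScalars _).comp hc')) fun v => ?_
        obtain ⟨w, rfl⟩ := e.surjective v
        simp only [LinearMap.comp_apply, LinearEquiv.coe_coe, LinearEquiv.symm_apply_apply,
          LinearMap.restrictScalars_apply]
        rw [← h1, e.symm_apply_apply, ← h1', E.euler_apply, map_smul, f.horizontal]
        rfl }
  comm := fun v => by
    obtain ⟨-, h2, -, -⟩ := isMellinTransform_iff.1 h
    obtain ⟨-, h2', -, -⟩ := isMellinTransform_iff.1 h'
    obtain ⟨w, rfl⟩ := e.surjective v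
    change e' (f.toLinearMap (e.symm (D.Phi (e w)))) =
      D'.Phi (e' (f.toLinearMap (e.symm (e w))))
    rw [h2, e.symm_apply_apply, e.symm_apply_apply, map_smul, h2']

/-- A morphism of Mellin transforms, transported to the connections. -/
def IsMellinTransform.comapHom {E E' : FormalConnection k} {D D' : DifferenceModule k}
    {e : E.carrier ≃ₗ[k] D.carrier} {e' : E'.carrier ≃ₗ[k] D'.carrier}
    (h : IsMellinTransform E D e) (h' : IsMellinTransform E' D' e') (g : D ⟶ D') : E ⟶ E' :=
  have hlin : ∀ (f : LaurentSeries k) (v : E.carrier),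
      e'.symm (g.toLinearMap (e (f • v))) = f • e'.symm (g.toLinearMap (e v)) := by
    obtain ⟨-, h2, hc, -⟩ := isMellinTransform_iff.1 h
    obtain ⟨-, h2', -, hc'⟩ := isMellinTransform_iff.1 h'
    refine AdicCont.map_smul_of_commute
      (A := (e'.symm : D'.carrier →ₗ[k] E'.carrier) ∘ₗ g.toLinearMap.restrictScalars k ∘ₗ
        (e : E.carrier →ₗ[k] D.carrier))
      (hc'.comp ((adicCont_restrictScalars _).comp hc)) fun v => ?_
    simp only [LinearMap.comp_apply, LinearEquiv.coe_coe, LinearMap.restrictScalars_apply]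
    rw [← h2, g.comm, LinearEquiv.symm_apply_eq, ← h2', e'.apply_symm_apply]
  { toLinearMap :=
      { toFun := fun v => e'.symm (g.toLinearMap (e v))
        map_add' := fun v w => by simp
        map_smul' := hlin }
    horizontal := fun v => by
      obtain ⟨h1, -, -, -⟩ := isMellinTransform_iff.1 h
      obtain ⟨h1', -, -, -⟩ := isMellinTransform_iff.1 h'
      change e'.symm (g.toLinearMap (e (E.nabla v))) =
        E'.nabla (e'.symm (g.toLinearMap (e v)))
      rw [E.nabla_eq, E'.nabla_eq, hlin, h1, map_smul]
      congr 1
      rw [LinearEquiv.symm_apply_eq, h1', e'.apply_symm_apply] }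

end Transform

/-! ### Extensions: removing the off-diagonal block. -/

section Extension

variable {k : Type u} [Field k]
variable {V₁ : Type u} [AddCommGroup V₁] [Module k V₁] [Module (LaurentSeries k) V₁]
  [IsScalarTower k (LaurentSeries k) V₁] [FiniteDimensional (LaurentSeries k) V₁]
variable {V : Type u} [AddCommGroup V] [Module k V] [Module (LaurentSeries k) V]
  [IsScalarTower k (LaurentSeries k) V] [FiniteDimensional (LaurentSeries k) V]
variable {V₂ : Type u} [AddCommGroup V₂] [Module k V₂] [Module (LaurentSeries k) V₂]
  [IsScalarTower k (LaurentSeries k) V₂] [FiniteDimensional (LaurentSeries k) V₂]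
variable {M₁ : Type u} [AddCommGroup M₁] [Module k M₁] [Module (LaurentSeries k) M₁]
  [IsScalarTower k (LaurentSeries k) M₁] [FiniteDimensional (LaurentSeries k) M₁]
variable {M₂ : Type u} [AddCommGroup M₂] [Module k M₂] [Module (LaurentSeries k) M₂]
  [IsScalarTower k (LaurentSeries k) M₂] [FiniteDimensional (LaurentSeries k) M₂]

theorem exists_seq_sub_eq {A : Type*} [AddCommGroup A] (d : ℤ → A) :
    ∃ σ : ℤ → A, ∀ n, σ (n + 1) = σ n + d n := by
  refine ⟨fun n => ∑ j ∈ Finset.Ico 0 n, d j - ∑ j ∈ Finset.Ico n 0, d j, fun n => ?_⟩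
  rcases le_or_gt 0 n with hn | hn
  · have h : Finset.Ico 0 (n + 1) = insert n (Finset.Ico 0 n) := by
      ext j
      simp only [Finset.mem_Ico, Finset.mem_insert]
      lia
    simp only [h, Finset.sum_insert (show n ∉ Finset.Ico 0 n by simp),
      Finset.Ico_eq_empty_of_le hn, Finset.Ico_eq_empty_of_le (show 0 ≤ n + 1 by lia),
      Finset.sum_empty]
    abel
  · have h : Finset.Ico n 0 = insert n (Finset.Ico (n + 1) 0) := by
      ext j
      simp only [Finset.mem_Ico, Finset.mem_insert]
      lia
    simp only [h, Finset.sum_insert (show n ∉ Finset.Ico (n + 1) 0 by simp),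
      Finset.Ico_eq_empty_of_le hn.le, Finset.Ico_eq_empty_of_le (show n + 1 ≤ 0 by lia),
      Finset.sum_empty]
    abel

/-- A sequence with `s (n + 1) = x s n + c n` tends to `0` if `c` does. -/
theorem eventually_mem_of_recursion {s c : ℤ → V}
    (hc : ∀ m, ∃ N, ∀ n ≥ N, c n ∈ adicFil k V m)
    (h : ∀ n, s (n + 1) = xpow k 1 • s n + c n) (m : ℤ) :
    ∃ N, ∀ n ≥ N, s n ∈ adicFil k V m := by
  obtain ⟨N, hN⟩ := hc m
  obtain ⟨d, hd⟩ := exists_mem_fil (Module.finBasis (LaurentSeries k) V) (s N)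
  -- Multiplication by `x` gains one order at each step, until the bound `m` coming from `c` caps
  -- the gain.
  have key : ∀ l : ℕ, s (N + l) ∈ adicFil k V (min m (d + l)) := by
    intro l
    induction l with
    | zero =>
      rw [Nat.cast_zero, add_zero, add_zero]
      exact fil_anti _ (min_le_right m d) hd
    | succ l ih =>
      rw [Nat.cast_succ, ← add_assoc N, h]
      refine add_mem (fil_anti _ ?_ (smul_mem_fil (xpow_mem_ordGE 1) ih))
        (fil_anti _ (min_le_left _ _) (hN _ (by lia)))
      lia
  refine ⟨N + (m - d).toNat, fun n hn => ?_⟩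
  have := key (n - N).toNat
  rw [show N + ((n - N).toNat : ℤ) = n by lia] at this
  exact fil_anti _ (by lia) this

/-- Every continuous `β` is a commutator with `x⁻¹`. On a basis vector `b` the equation reads
`τ(x^(n+1) b) = x τ(x^n b) + x β(x^(n+1) b)`, a first-order recursion over `ℤ`. Its solutions tend
to `0` as `n → +∞` because `β(x^n b)` does, so they define a continuous map. -/
theorem exists_commutator_eq {β : M₂ →ₗ[k] M₁} (hβ : AdicCont β) :
    ∃ τ : M₂ →ₗ[k] M₁, AdicCont τ ∧
      ∀ w, β w + τ (xpow k (-1) • w) = xpow k (-1) • τ w := by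
  let b := Module.finBasis (LaurentSeries k) M₂
  have step : ∀ i, ∃ T : LaurentSeries k →ₗ[k] M₁, AdicCont T ∧
      ∀ n, T (xpow k (n + 1)) = xpow k 1 • T (xpow k n) + xpow k 1 • β (xpow k (n + 1) • b i) := by
    intro i
    -- With `τ(x^n b) = x^n σ(n)` the recursion becomes `σ(n+1) - σ(n) = x^(-n) β(x^(n+1) b)`,
    -- solved by summation in both directions from `0`.
    obtain ⟨σ, hσ⟩ := exists_seq_sub_eq fun n => xpow k (-n) • β (xpow k (n + 1) • b i)
    have hrec : ∀ n, xpow k (n + 1) • σ (n + 1) =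
        xpow k 1 • xpow k n • σ n + xpow k 1 • β (xpow k (n + 1) • b i) := by
      intro n
      rw [hσ, smul_add, smul_smul, smul_smul, xpow_mul_xpow, xpow_mul_xpow, add_comm 1 n,
        add_neg_cancel_comm]
    have hc : AdicCont (smulOp M₁ (xpow k 1) ∘ₗ β ∘ₗ smulVec (b i)) :=
      (adicCont_smulOp _).comp (hβ.comp (adicCont_smulVec _))
    obtain ⟨T, hT, hT'⟩ := exists_adicCont_xpow (fun n => xpow k n • σ n) <| by
      refine eventually_mem_of_recursion (c := fun n => xpow k 1 • β (xpow k (n + 1) • b i))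
        (fun m => ?_) hrec
      obtain ⟨N, hN⟩ := (adicCont_iff cofinal_ordGE
        ⟨fun m => ⟨m, le_rfl⟩, fun m => ⟨m, le_rfl⟩⟩).1 hc m
      exact ⟨N, fun n hn => hN _ (ordGE_anti (by lia) (xpow_mem_ordGE (n + 1)))⟩
    exact ⟨T, hT, fun n => by rw [hT', hT', hrec]⟩
  choose T hT hT' using step
  let τ : M₂ →ₗ[k] M₁ := ∑ i, T i ∘ₗ (b.coord i).restrictScalars k
  have hτ : AdicCont τ := AdicCont.sum _ fun i => (hT i).comp (adicCont_restrictScalars _)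
  have τb : ∀ (f : LaurentSeries k) i, τ (f • b i) = T i f := by
    intro f i
    simp only [τ, LinearMap.sum_apply, LinearMap.comp_apply, LinearMap.restrictScalars_apply,
      map_smul, Module.Basis.coord_apply, Module.Basis.repr_self, smul_eq_mul]
    rw [Finset.sum_eq_single i]
    · simp
    · intro j _ hj
      rw [Finsupp.single_eq_of_ne hj, mul_zero, map_zero]
    · simp
  refine ⟨τ, hτ, fun w => ?_⟩
  let R : M₂ →ₗ[k] M₁ := β + τ ∘ₗ smulOp M₂ (xpow k (-1)) - smulOp M₁ (xpow k (-1)) ∘ₗ τ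
  have hR : AdicCont R := (hβ.add (hτ.comp (adicCont_smulOp _))).sub ((adicCont_smulOp _).comp hτ)
  have hRb : ∀ i, R ∘ₗ smulVec (b i) = 0 := by
    intro i
    refine (hR.comp (adicCont_smulVec _)).eq_zero fun n => ?_
    have h := hT' i (n - 1)
    rw [sub_add_cancel] at h
    simp only [R, LinearMap.comp_apply, LinearMap.sub_apply, LinearMap.add_apply, smulVec_apply,
      smulOp_apply, smul_smul, xpow_mul_xpow, τb, h, smul_add, neg_add_cancel, xpow_zero, one_smul,
      neg_add_eq_sub]
    abel
  have : R w = 0 := by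
    rw [← b.sum_repr w, map_sum]
    exact Finset.sum_eq_zero fun i _ => LinearMap.congr_fun (hRb i) _
  simpa [R, sub_eq_zero] using this

/-- If an operator `N` becomes multiplication by `x⁻¹` on a subspace and on the quotient by it, for
suitable structures of vector spaces over `k((x))`, then also on the whole space. -/
theorem exists_equiv_of_exact {i : V₁ →ₗ[LaurentSeries k] V} {π : V →ₗ[LaurentSeries k] V₂}
    (hi : Function.Injective i) (hπ : Function.Surjective π) (hex : Function.Exact i π)
    {N₁ : V₁ →ₗ[k] V₁} {N : V →ₗ[k] V} {N₂ : V₂ →ₗ[k] V₂} (hN : AdicCont N)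
    (hNi : ∀ v, N (i v) = i (N₁ v)) (hNπ : ∀ v, π (N v) = N₂ (π v))
    {e₁ : V₁ ≃ₗ[k] M₁} {e₂ : V₂ ≃ₗ[k] M₂}
    (h₁ : ∀ v, e₁ (N₁ v) = xpow k (-1) • e₁ v) (h₂ : ∀ v, e₂ (N₂ v) = xpow k (-1) • e₂ v)
    (c₁ : AdicCont (e₁ : V₁ →ₗ[k] M₁)) (c₁' : AdicCont (e₁.symm : M₁ →ₗ[k] V₁))
    (c₂ : AdicCont (e₂ : V₂ →ₗ[k] M₂)) (c₂' : AdicCont (e₂.symm : M₂ →ₗ[k] V₂)) :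
    ∃ e : V ≃ₗ[k] M₁ × M₂, (∀ v, e (N v) = xpow k (-1) • e v) ∧ (∀ v, e (i v) = (e₁ v, 0)) ∧
      (∀ v, (e v).2 = e₂ (π v)) ∧ AdicCont (e : V →ₗ[k] M₁ × M₂) ∧
      AdicCont (e.symm : M₁ × M₂ →ₗ[k] V) := by
  obtain ⟨l, hl⟩ := π.exists_rightInverse_of_surjective (LinearMap.range_eq_top.2 hπ)
  obtain ⟨E, hE, hE'⟩ := hex.splitSurjectiveEquiv hi ⟨l, hl⟩
  have Ei : ∀ v, E (i v) = (v, 0) := by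
    intro v
    have := LinearMap.congr_fun hE v
    simp only [LinearMap.comp_apply, LinearMap.inl_apply, LinearEquiv.coe_coe] at this
    rw [this, E.apply_symm_apply]
  have Eπ : ∀ v, (E v).2 = π v := fun v => (LinearMap.congr_fun hE' v).symm
  let s : V₂ →ₗ[LaurentSeries k] V := E.symm.toLinearMap ∘ₗ LinearMap.inr _ V₁ V₂
  let r : V →ₗ[LaurentSeries k] V₁ := LinearMap.fst _ V₁ V₂ ∘ₗ E.toLinearMap
  have hdec : ∀ v, v = i (r v) + s (π v) := by
    intro v
    apply E.injective
    rw [map_add, Ei]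
    simp only [s, r, LinearMap.comp_apply, LinearEquiv.coe_coe, E.apply_symm_apply,
      LinearMap.inr_apply, LinearMap.fst_apply, Prod.mk_add_mk, add_zero, zero_add]
    rw [← Eπ]
  have rs : ∀ u w, r (i u + s w) = u := by
    intro u w
    simp [r, s, Ei]
  have πs : ∀ u w, π (i u + s w) = w := by
    intro u w
    rw [← Eπ]
    simp [s, Ei]
  -- The off-diagonal block of `N` for a `k((x))`-linear splitting of the sequence, transported to a
  -- map `M₂ → M₁`.
  let β : M₂ →ₗ[k] M₁ := (e₁ : V₁ →ₗ[k] M₁) ∘ₗ r.restrictScalars k ∘ₗ N ∘ₗ s.restrictScalars k ∘ₗ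
    (e₂.symm : M₂ →ₗ[k] V₂)
  have hβ : AdicCont β := c₁.comp ((adicCont_restrictScalars r).comp
    (hN.comp ((adicCont_restrictScalars s).comp c₂')))
  have βe : ∀ w, β (e₂ w) = e₁ (r (N (s w))) := by
    intro w
    simp [β]
  obtain ⟨τ, hτ, hτ'⟩ := exists_commutator_eq hβ
  -- The split identification corrected by the unipotent map with off-diagonal entry `τ`, which
  -- absorbs `β`.
  let e : V ≃ₗ[k] M₁ × M₂ :=
    { toFun := fun v => (e₁ (r v) + τ (e₂ (π v)), e₂ (π v))
      map_add' := fun v w => by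
        ext
        · simp only [map_add, Prod.fst_add]
          abel
        · simp
      map_smul' := fun c v => by
        ext <;> simp [LinearMap.map_smul_of_tower]
      invFun := fun m => i (e₁.symm (m.1 - τ m.2)) + s (e₂.symm m.2)
      left_inv := fun v => by
        simp only [add_sub_cancel_right, LinearEquiv.symm_apply_apply]
        exact (hdec v).symm
      right_inv := fun m => by
        simp only [rs, πs, LinearEquiv.apply_symm_apply, sub_add_cancel] }
  refine ⟨e, fun v => ?_, fun v => ?_, fun v => rfl, ?_, ?_⟩
  · have hr : r (N v) = N₁ (r v) + r (N (s (π v))) := by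
      conv_lhs => rw [hdec v, map_add, map_add, hNi]
      congr 1
      simp [r, Ei]
    change (e₁ (r (N v)) + τ (e₂ (π (N v))), e₂ (π (N v))) =
      xpow k (-1) • (e₁ (r v) + τ (e₂ (π v)), e₂ (π v))
    rw [hNπ, h₂, hr, map_add, h₁, ← βe, Prod.smul_mk, smul_add, ← hτ', add_assoc]
  · change (e₁ (r (i v)) + τ (e₂ (π (i v))), e₂ (π (i v))) = _
    have h1 := rs v 0
    rw [map_zero, add_zero] at h1
    rw [hex.apply_apply_eq_zero, h1, map_zero, map_zero, add_zero]
  · refine AdicCont.of_eq (A := (LinearMap.inl (LaurentSeries k) M₁ M₂).restrictScalars k ∘ₗ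
      ((e₁ : V₁ →ₗ[k] M₁) ∘ₗ r.restrictScalars k +
        τ ∘ₗ (e₂ : V₂ →ₗ[k] M₂) ∘ₗ π.restrictScalars k) +
      (LinearMap.inr (LaurentSeries k) M₁ M₂).restrictScalars k ∘ₗ
        (e₂ : V₂ →ₗ[k] M₂) ∘ₗ π.restrictScalars k) ?_ fun v => ?_
    · exact ((adicCont_restrictScalars _).comp ((c₁.comp (adicCont_restrictScalars _)).add
        (hτ.comp (c₂.comp (adicCont_restrictScalars _))))).add
        ((adicCont_restrictScalars _).comp (c₂.comp (adicCont_restrictScalars _)))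
    · ext <;> simp [e]
  · refine AdicCont.of_eq (A := i.restrictScalars k ∘ₗ (e₁.symm : M₁ →ₗ[k] V₁) ∘ₗ
      ((LinearMap.fst (LaurentSeries k) M₁ M₂).restrictScalars k -
        τ ∘ₗ (LinearMap.snd (LaurentSeries k) M₁ M₂).restrictScalars k) +
      s.restrictScalars k ∘ₗ (e₂.symm : M₂ →ₗ[k] V₂) ∘ₗ
        (LinearMap.snd (LaurentSeries k) M₁ M₂).restrictScalars k) ?_ fun v => rfl
    exact ((adicCont_restrictScalars _).comp (c₁'.comp ((adicCont_restrictScalars _).sub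
      (hτ.comp (adicCont_restrictScalars _))))).add
      ((adicCont_restrictScalars _).comp (c₂'.comp (adicCont_restrictScalars _)))

end Extension

/-! ### Polynomial solutions of difference equations. -/

section DifferenceEquation

variable {k : Type u} [Field k] [CharZero k]

/-- For `R = a x^n` take `Q(x) = a h^n / (n + 1) * B_{n+1}(x / h)`, by the identity `B_{n+1}(1 + y)
- B_{n+1}(y) = (n + 1) y^n` for Bernoulli polynomials. -/
theorem exists_polynomial_eval_add (h : k) (hh : h ≠ 0) (R : Polynomial k) :
    ∃ Q : Polynomial k, ∀ x, Q.eval (x + h) = Q.eval x + R.eval x := by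
  induction R using Polynomial.induction_on' with
  | add p q hp hq =>
    obtain ⟨P, hP⟩ := hp
    obtain ⟨Q, hQ⟩ := hq
    refine ⟨P + Q, fun x => ?_⟩
    rw [Polynomial.eval_add, Polynomial.eval_add, Polynomial.eval_add, hP, hQ]
    ring
  | monomial n a =>
    let B : Polynomial k := (Polynomial.bernoulli (n + 1)).map (algebraMap ℚ k)
    have hB : ∀ y, B.eval (1 + y) = B.eval y + (n + 1) * y ^ n := by
      intro y
      have := congrArg (fun P => (P.map (algebraMap ℚ k)).eval y)
        (Polynomial.bernoulli_comp_one_add_X (n + 1))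
      simpa [B, Polynomial.map_comp] using this
    have hn : (n + 1 : k) ≠ 0 := by exact_mod_cast n.succ_ne_zero
    refine ⟨Polynomial.C (a * h ^ n / (n + 1)) *
      B.comp (Polynomial.C h⁻¹ * Polynomial.X), fun x => ?_⟩
    have hx : h⁻¹ * (x + h) = 1 + h⁻¹ * x := by field_simp; ring
    simp only [Polynomial.eval_mul, Polynomial.eval_C, Polynomial.eval_comp, Polynomial.eval_X, hx,
      hB, Polynomial.eval_monomial, mul_pow, inv_pow]
    field_simp

/-- A solution `Q` of the difference equation `Q(x + h) - Q(x) = R(x)`. -/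
def diffInv (h : k) (hh : h ≠ 0) (R : Polynomial k) : Polynomial k :=
  (exists_polynomial_eval_add h hh R).choose

theorem diffInv_eval (h : k) (hh : h ≠ 0) (R : Polynomial k) (x : k) :
    (diffInv h hh R).eval (x + h) = (diffInv h hh R).eval x + R.eval x :=
  (exists_polynomial_eval_add h hh R).choose_spec x

/-- Polynomials `q m` with `q 0 = 1` and
`b (q m (x + h) - q m (x)) = ∑ i < m, q i (x) a (m - i) (x + i)`. -/
def diffSeq (h : k) (hh : h ≠ 0) (b : k) (a : ℕ → Polynomial k) (m : ℕ) : Polynomial k :=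
  if m = 0 then 1 else diffInv h hh (Polynomial.C b⁻¹ *
    ∑ i : Fin m, diffSeq h hh b a i * (a (m - i)).comp (Polynomial.X + Polynomial.C ((i : ℕ) : k)))
termination_by m
decreasing_by exact i.2

theorem diffSeq_zero (h : k) (hh : h ≠ 0) (b : k) (a : ℕ → Polynomial k) :
    diffSeq h hh b a 0 = 1 := by
  rw [diffSeq, if_pos rfl]

/-- The term `i = m` on the right is `b q_m(x)`, since `a 0 = b`; moving it to the left leaves the
difference equation that defines `q_m`. For `m = 0` both sides are `b`. -/
theorem diffSeq_eval (h : k) (hh : h ≠ 0) {b : k} (hb : b ≠ 0) (a : ℕ → Polynomial k)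
    (ha : a 0 = Polynomial.C b) (m : ℕ) (x : k) :
    b * (diffSeq h hh b a m).eval (x + h) = ∑ i ∈ Finset.range (m + 1),
      (diffSeq h hh b a i).eval x * (a (m - i)).eval (x + i) := by
  rw [Finset.sum_range_succ, Nat.sub_self, ha, Polynomial.eval_C]
  by_cases hm : m = 0
  · subst hm
    simp [diffSeq_zero]
  · rw [diffSeq, if_neg hm, diffInv_eval]
    simp only [Polynomial.eval_mul, Polynomial.eval_C, Polynomial.eval_finsetSum,
      Polynomial.eval_comp, Polynomial.eval_add, Polynomial.eval_X]
    rw [Fin.sum_univ_eq_sum_range fun i => (diffSeq h hh b a i).eval x * (a (m - i)).eval (x + i)]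
    field_simp
    ring

end DifferenceEquation

/-! ### Operators whose coefficients depend polynomially on the exponent. -/

section Poly

variable {k : Type u} [Field k]

/-- The operator `A` on `k((x))` raises orders by at least `d`, and the coefficient of `x ^ (n + m)`
in `A (x ^ n)` is `c ^ n` times a polynomial in `n`, for every `m`. -/
structure IsPoly (c : k) (d : ℤ) (A : LaurentSeries k →ₗ[k] LaurentSeries k) : Prop where
  mem : ∀ n, ∀ f ∈ ordGE k n, A f ∈ ordGE k (n + d)
  poly : ∀ m : ℤ, ∃ P : Polynomial k, ∀ n : ℤ,
    (A (xpow k n)).coeff (n + m) = c ^ n * P.eval (n : k)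

theorem adicCont_of_ordGE {A : LaurentSeries k →ₗ[k] LaurentSeries k} {d : ℤ}
    (h : ∀ n, ∀ f ∈ ordGE k n, A f ∈ ordGE k (n + d)) : AdicCont A := by
  refine (adicCont_iff cofinal_ordGE cofinal_ordGE).2 fun m => ⟨m - d, fun f hf => ?_⟩
  have := h _ f hf
  rwa [sub_add_cancel] at this

/-- A monomial `x^i` with `i > j - d` is sent to order above `j`, so only finitely many monomials of
`f` are seen by the coefficient at `j`. -/
theorem coeff_apply_eq_sum {A : LaurentSeries k →ₗ[k] LaurentSeries k} {d : ℤ}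
    (h : ∀ n, ∀ f ∈ ordGE k n, A f ∈ ordGE k (n + d)) {a : ℤ} {f : LaurentSeries k}
    (hf : f ∈ ordGE k a) (j : ℤ) :
    (A f).coeff j = ∑ i ∈ Finset.Ico a (j - d + 1), f.coeff i * (A (xpow k i)).coeff j := by
  have h1 := h _ _ (sub_sum_xpow_mem_ordGE hf (j - d + 1)) j (by lia)
  rw [map_sub, HahnSeries.coeff_sub, sub_eq_zero, map_sum, HahnSeries.coeff_sum] at h1
  rw [h1]
  refine Finset.sum_congr rfl fun i _ => ?_
  rw [map_smul, HahnSeries.coeff_smul, smul_eq_mul]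

/-- The coefficient of `x^(n+m)` is the finite sum of `c'^n Q_i(n) * c^(n+i) P_{m-i}(n+i)`. The
factor `c^i` does not depend on `n` and goes into the polynomial, leaving `(c c')^n`. -/
theorem IsPoly.comp {c c' : k} (hc : c ≠ 0) {d d' : ℤ}
    {A B : LaurentSeries k →ₗ[k] LaurentSeries k} (hA : IsPoly c d A) (hB : IsPoly c' d' B) :
    IsPoly (c * c') (d + d') (A ∘ₗ B) where
  mem n f hf := by
    have := hA.mem _ _ (hB.mem n f hf)
    rwa [add_assoc, add_comm d'] at this
  poly m := by
    choose P hP using hA.poly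
    choose Q hQ using hB.poly
    refine ⟨∑ i ∈ Finset.Ico d' (m - d + 1),
      Polynomial.C (c ^ i) * Q i * (P (m - i)).comp (Polynomial.X + Polynomial.C (i : k)),
      fun n => ?_⟩
    rw [LinearMap.comp_apply, coeff_apply_eq_sum hA.mem (hB.mem n _ (xpow_mem_ordGE n)),
      Polynomial.eval_finsetSum, Finset.mul_sum,
      show n + m - d + 1 = n + (m - d + 1) by ring, ← Finset.map_add_left_Ico, Finset.sum_map]
    refine Finset.sum_congr rfl fun i _ => ?_
    simp only [addLeftEmbedding_apply, hQ, Polynomial.eval_mul, Polynomial.eval_C,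
      Polynomial.eval_comp, Polynomial.eval_add, Polynomial.eval_X]
    have h1 := hP (m - i) (n + i)
    rw [show n + i + (m - i) = n + m by ring] at h1
    rw [h1, mul_zpow, zpow_add₀ hc]
    push_cast
    ring

theorem IsPoly.add {c : k} {d : ℤ} {A B : LaurentSeries k →ₗ[k] LaurentSeries k}
    (hA : IsPoly c d A) (hB : IsPoly c d B) : IsPoly c d (A + B) where
  mem n f hf := add_mem (hA.mem n f hf) (hB.mem n f hf)
  poly m := by
    obtain ⟨P, hP⟩ := hA.poly m
    obtain ⟨Q, hQ⟩ := hB.poly m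
    refine ⟨P + Q, fun n => ?_⟩
    rw [LinearMap.add_apply, HahnSeries.coeff_add, hP, hQ, Polynomial.eval_add, mul_add]

theorem IsPoly.mono {c : k} {d d' : ℤ} {A : LaurentSeries k →ₗ[k] LaurentSeries k}
    (hA : IsPoly c d A) (h : d' ≤ d) : IsPoly c d' A where
  mem n f hf := ordGE_anti (by lia) (hA.mem n f hf)
  poly := hA.poly

theorem isPoly_mulOp {d : ℤ} {f : LaurentSeries k} (hf : f ∈ ordGE k d) :
    IsPoly 1 d (mulOp f) where
  mem n g hg := by
    rw [add_comm]
    exact ordGE_mul hf hg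
  poly m := ⟨Polynomial.C (f.coeff m), fun n => by
    rw [mulOp_apply, mul_comm, coeff_xpow_mul, one_zpow, one_mul, Polynomial.eval_C,
      add_sub_cancel_left]⟩

/-- For a fixed shift the coefficients of `A(x^n)` and `B(x^n)` are `c^n P(n)` and `c^n Q(n)`. In
characteristic zero the numbers `-p j` are infinitely many points at which `P` and `Q` agree, so `P
= Q`. This carries information from the powers of `x^(-p)` to the exponents not divisible by `p`. -/
theorem IsPoly.ext [CharZero k] {c : k} {d d' : ℤ}
    {A B : LaurentSeries k →ₗ[k] LaurentSeries k} (hc : c ≠ 0) (hA : IsPoly c d A)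
    (hB : IsPoly c d' B) {p : ℕ} (hp : p ≠ 0)
    (h : ∀ j : ℕ, A (xpow k (-((p : ℤ) * j))) = B (xpow k (-((p : ℤ) * j)))) : A = B := by
  have key : ∀ n, A (xpow k n) = B (xpow k n) := by
    intro n
    ext j
    obtain ⟨P, hP⟩ := hA.poly (j - n)
    obtain ⟨Q, hQ⟩ := hB.poly (j - n)
    have hPQ : P = Q := by
      refine Polynomial.eq_of_infinite_eval_eq P Q (Set.infinite_of_injective_forall_mem
        (f := fun j : ℕ => ((-((p : ℤ) * j) : ℤ) : k)) ?_ fun i => ?_)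
      · intro i i' hi
        have hi' : -((p : ℤ) * i) = -((p : ℤ) * i') := Int.cast_injective (α := k) hi
        have hp' : (p : ℤ) ≠ 0 := by exact_mod_cast hp
        exact_mod_cast mul_left_cancel₀ hp' (neg_injective hi')
      · have h1 := hP (-((p : ℤ) * i))
        rw [h, hQ] at h1
        exact (mul_left_cancel₀ (zpow_ne_zero _ hc) h1).symm
    have h1 := hP n
    have h2 := hQ n
    rw [add_sub_cancel] at h1 h2
    rw [h1, h2, hPQ]
  have := ((adicCont_of_ordGE hA.mem).sub (adicCont_of_ordGE hB.mem)).eq_zero fun n => by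
    rw [LinearMap.sub_apply, key, sub_self]
  exact sub_eq_zero.1 this

end Poly

/-! ### Triangular operators on `k((x))`. -/

section Triangular

variable {k : Type u} [Field k]

/-- Solution of a triangular system of linear equations. -/
def triangularSolution (y : ℕ → k) (a : ℕ → ℕ → k) (m : ℕ) : k :=
  (a m m)⁻¹ * (y m - ∑ i : Fin m, triangularSolution y a i * a i m)
termination_by m
decreasing_by exact i.2

theorem triangularSolution_spec (y : ℕ → k) (a : ℕ → ℕ → k) (ha : ∀ m, a m m ≠ 0) (m : ℕ) :
    ∑ i ∈ Finset.range (m + 1), triangularSolution y a i * a i m = y m := by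
  rw [Finset.sum_range_succ]
  conv_lhs =>
    arg 2
    rw [triangularSolution]
  rw [Fin.sum_univ_eq_sum_range fun i => triangularSolution y a i * a i m]
  field_simp [ha m]
  ring

variable {T : LaurentSeries k →ₗ[k] LaurentSeries k}

/-- `T` multiplies the leading coefficient by a nonzero diagonal entry, hence preserves orders
exactly. -/
theorem mem_ordGE_of_apply (hT : ∀ n, ∀ f ∈ ordGE k n, T f ∈ ordGE k (n + 0))
    (h : ∀ n, (T (xpow k n)).coeff n ≠ 0) {f : LaurentSeries k} {n : ℤ}
    (hf : T f ∈ ordGE k n) : f ∈ ordGE k n := by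
  by_cases h0 : f = 0
  · rw [h0]
    exact zero_mem _
  · refine ordGE_anti ?_ (mem_ordGE_order f)
    by_contra hlt
    have h1 := coeff_apply_eq_sum hT (mem_ordGE_order f) f.order
    rw [hf _ (not_le.1 hlt), sub_zero, Finset.Ico_add_one_right_eq_Icc, Finset.Icc_self,
      Finset.sum_singleton] at h1
    exact mul_ne_zero (HahnSeries.coeff_order_eq_zero.not.2 h0) (h _) h1.symm

/-- Injectivity is exact preservation of orders. For surjectivity the coefficients of a preimage,
starting at the order of `y`, are determined one after another by division by the diagonal entries.
-/
theorem bijective_of_triangular (hT : ∀ n, ∀ f ∈ ordGE k n, T f ∈ ordGE k (n + 0))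
    (h : ∀ n, (T (xpow k n)).coeff n ≠ 0) : Function.Bijective T := by
  refine ⟨(injective_iff_map_eq_zero T).2 fun f hf => eq_zero_of_forall_mem_ordGE fun n =>
    mem_ordGE_of_apply hT h (by rw [hf]; exact zero_mem _), fun y => ?_⟩
  let z := triangularSolution (fun m : ℕ => y.coeff (y.order + m))
    fun i m : ℕ => (T (xpow k (y.order + i))).coeff (y.order + m)
  let f : LaurentSeries k :=
    xpow k y.order * HahnSeries.ofPowerSeries ℤ k (PowerSeries.mk z)
  have hf : f ∈ ordGE k y.order := mem_ordGE_iff_exists.2 ⟨_, rfl⟩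
  have hfz : ∀ i : ℕ, f.coeff (y.order + i) = z i := by
    intro i
    rw [coeff_xpow_mul, add_sub_cancel_left, HahnSeries.ofPowerSeries_apply_coeff,
      PowerSeries.coeff_mk]
  refine ⟨f, ?_⟩
  ext j
  by_cases hj : j < y.order
  · rw [hT _ f hf j (by lia), mem_ordGE_order y j hj]
  · obtain ⟨m, rfl⟩ : ∃ m : ℕ, j = y.order + m := ⟨(j - y.order).toNat, by lia⟩
    rw [coeff_apply_eq_sum hT hf, ← triangularSolution_spec
      (fun m : ℕ => y.coeff (y.order + m))
      (fun i m : ℕ => (T (xpow k (y.order + i))).coeff (y.order + m)) (fun m => h _) m]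
    symm
    refine Finset.sum_bij (fun i _ => y.order + (i : ℤ)) ?_ ?_ ?_ ?_
    · intro i hi
      rw [Finset.mem_range] at hi
      rw [Finset.mem_Ico]
      lia
    · intro i _ i' _ hii
      lia
    · intro i hi
      rw [Finset.mem_Ico] at hi
      exact ⟨(i - y.order).toNat, Finset.mem_range.2 (by lia), by lia⟩
    · intro i _
      rw [hfz]

end Triangular

/-! ### Conjugation to multiplication by `x^(-p)`. -/

section Conjugation

variable {k : Type u} [Field k] [CharZero k]

/-- A polynomial operator of degree `-p` with constant leading coefficient is conjugate to
multiplication by `x ^ (-p)`. -/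
theorem exists_conjugation {B : LaurentSeries k →ₗ[k] LaurentSeries k} {p : ℕ} (hp : p ≠ 0)
    {c : k} (hc : c ≠ 0) (hB : IsPoly 1 (-p) B)
    (hlead : ∀ n, (B (xpow k n)).coeff (n - p) = c ^ (-(p : ℤ))) :
    ∃ T : LaurentSeries k →ₗ[k] LaurentSeries k, IsPoly c 0 T ∧ Function.Bijective T ∧
      (∀ n f, T f ∈ ordGE k n ↔ f ∈ ordGE k n) ∧ ∀ f, T (xpow k (-p) * f) = B (T f) := by
  have hp' : (-(p : k)) ≠ 0 := neg_ne_zero.2 (by exact_mod_cast hp)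
  have hb : c ^ (-(p : ℤ)) ≠ 0 := zpow_ne_zero _ hc
  have hBp : ∀ m : ℕ, ∃ P : Polynomial k, ∀ n : ℤ,
      (B (xpow k n)).coeff (n - p + m) = P.eval (n : k) := by
    intro m
    obtain ⟨P, hP⟩ := hB.poly (-p + m)
    refine ⟨P, fun n => ?_⟩
    have := hP n
    rwa [one_zpow, one_mul, ← add_assoc, ← sub_eq_add_neg] at this
  choose a' ha' using hBp
  -- The leading polynomial is replaced by the literal constant `c^(-p)`, which has the same values
  -- at integers and is what `diffSeq_eval` requires.
  let a : ℕ → Polynomial k := fun m => if m = 0 then Polynomial.C (c ^ (-(p : ℤ))) else a' m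
  have ha : ∀ (m : ℕ) (n : ℤ), (B (xpow k n)).coeff (n - p + m) = (a m).eval (n : k) := by
    intro m n
    by_cases hm : m = 0
    · simp only [hm, a, if_pos, Nat.cast_zero, add_zero, hlead, Polynomial.eval_C]
    · simp only [a, if_neg hm, ha']
  -- Comparing coefficients of `x^(n-p+m)` in `T(x^(n-p)) = B(T(x^n))` and dividing by `c^n` gives
  -- `c^(-p) q_m(n-p) = ∑ q_i(n) a_{m-i}(n+i)`: the recursion with step `-p`.
  let q := diffSeq (-(p : k)) hp' (c ^ (-(p : ℤ))) a
  have hq := diffSeq_eval (-(p : k)) hp' hb a (if_pos rfl)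
  let s : ℤ → LaurentSeries k := fun n => xpow k n *
    HahnSeries.ofPowerSeries ℤ k (PowerSeries.mk fun m => c ^ n * (q m).eval (n : k))
  have hs : ∀ n, s n ∈ ordGE k n := fun n => mem_ordGE_iff_exists.2 ⟨_, rfl⟩
  have hsc : ∀ n (m : ℕ), (s n).coeff (n + m) = c ^ n * (q m).eval (n : k) := by
    intro n m
    rw [coeff_xpow_mul, add_sub_cancel_left, HahnSeries.ofPowerSeries_apply_coeff,
      PowerSeries.coeff_mk]
  have hs' : ∀ m, ∃ N, ∀ n ≥ N, s n ∈ ordGE k m := fun m => ⟨m, fun n hn => ordGE_anti hn (hs n)⟩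
  let T := strongLinear s hs'
  have hTx : ∀ n, T (xpow k n) = s n := strongLinear_xpow s hs'
  have hT : ∀ n, ∀ f ∈ ordGE k n, T f ∈ ordGE k (n + 0) := fun n f hf => by
    rw [add_zero]
    exact strongLinear_mem_ordGE hs' (fun j hj => ordGE_anti hj (hs j)) hf
  have hdiag : ∀ n, (T (xpow k n)).coeff n ≠ 0 := by
    intro n
    have := hsc n 0
    rw [Nat.cast_zero, add_zero] at this
    rw [hTx, this, show q 0 = 1 from diffSeq_zero _ _ _ _, Polynomial.eval_one, mul_one]
    exact zpow_ne_zero _ hc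
  refine ⟨T, ⟨hT, fun m => ?_⟩, bijective_of_triangular hT hdiag, fun n f =>
    ⟨mem_ordGE_of_apply hT hdiag, fun hf => by simpa using hT n f hf⟩, fun f => ?_⟩
  · by_cases hm : m < 0
    · exact ⟨0, fun n => by
        rw [hTx, hs n _ (by lia), Polynomial.eval_zero, mul_zero]⟩
    · obtain ⟨m, rfl⟩ := Int.eq_ofNat_of_zero_le (not_lt.1 hm)
      exact ⟨q m, fun n => by rw [hTx]; exact hsc n m⟩
  · have hx := (isPoly_mulOp (xpow_mem_ordGE (k := k) (-(p : ℤ)))).mem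
    have hzero := AdicCont.eq_zero (A := T ∘ₗ mulOp (xpow k (-p)) - B ∘ₗ T)
      (((adicCont_of_ordGE hT).comp (adicCont_of_ordGE hx)).sub
        ((adicCont_of_ordGE hB.mem).comp (adicCont_of_ordGE hT))) fun n => ?_
    · have := LinearMap.congr_fun hzero f
      rwa [LinearMap.sub_apply, LinearMap.zero_apply, sub_eq_zero] at this
    · rw [LinearMap.sub_apply, sub_eq_zero, LinearMap.comp_apply, LinearMap.comp_apply, mulOp_apply,
        xpow_mul_xpow, hTx, hTx]
      ext j
      by_cases hj : j < -p + n
      · rw [hs _ j hj, hB.mem _ _ (hs n) j (by lia)]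
      · obtain ⟨m, rfl⟩ : ∃ m : ℕ, j = -p + n + m := ⟨(j - (-p + n)).toNat, by lia⟩
        rw [hsc, coeff_apply_eq_sum hB.mem (hs n), zpow_add₀ hc, mul_right_comm]
        have h1 := hq m (n : k)
        rw [show ((-(p : ℤ) + n : ℤ) : k) = (n : k) + -(p : k) by push_cast; ring, h1,
          Finset.sum_mul]
        refine Finset.sum_bij (fun i _ => n + (i : ℤ)) ?_ ?_ ?_ ?_
        · intro i hi
          rw [Finset.mem_range] at hi
          rw [Finset.mem_Ico]
          lia
        · intro i _ i' _ hii
          lia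
        · intro i hi
          rw [Finset.mem_Ico] at hi
          exact ⟨(i - n).toNat, Finset.mem_range.2 (by lia), by lia⟩
        · intro i hi
          rw [Finset.mem_range] at hi
          have h2 := ha (m - i) (n + i)
          rw [show n + (i : ℤ) - p + ((m - i : ℕ) : ℤ) = -p + n + m by lia] at h2
          rw [h2, hsc]
          push_cast
          ring

end Conjugation

/-! ### The space `K_q`: basis and topology. -/

section Ramified

variable {k : Type u} [Field k]

/-- The filtration of `K_q` by the order in `x ^ (1/q)`. -/
def ramFil (q : ℕ+) (n : ℤ) : Submodule k (RamExt k q) := ordGE k n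

/-- The vector of `K_q` with the given coordinates in the basis `x ^ (j/q)`, `j < q`. -/
def ramCombination (q : ℕ+) : (Fin q → LaurentSeries k) →ₗ[LaurentSeries k] RamExt k q :=
  Fintype.linearCombination (LaurentSeries k) fun j : Fin q => (xpow k (j : ℕ) : RamExt k q)

theorem ramCombination_apply (q : ℕ+) (c : Fin q → LaurentSeries k) :
    ramCombination q c = (∑ j, ramify k q (c j) * xpow k (j : ℕ) : LaurentSeries k) := rfl

theorem ramCombination_coeff (q : ℕ+) (c : Fin q → LaurentSeries k) (n : ℤ) (j : Fin q) :
    HahnSeries.coeff (show LaurentSeries k from ramCombination q c) (((q : ℕ) : ℤ) * n + (j : ℕ)) =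
      (c j).coeff n := by
  change HahnSeries.coeff (∑ j, ramify k q (c j) * xpow k (j : ℕ)) _ = _
  rw [HahnSeries.coeff_sum, Finset.sum_eq_single j]
  · rw [mul_comm, coeff_xpow_mul, add_sub_cancel_right, ramify_coeff_mul]
  · intro i _ hi
    rw [mul_comm, coeff_xpow_mul]
    refine ramify_coeff_of_not_dvd q _ _ fun h => hi ?_
    rw [add_sub_assoc, dvd_add_right (dvd_mul_right _ _)] at h
    have h1 := i.2
    have h2 := j.2
    have h3 := Int.eq_zero_of_abs_lt_dvd h (by rw [abs_lt]; omega)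
    exact Fin.ext (by omega)
  · simp

theorem exists_eq_mul_add (q : ℕ+) (m : ℤ) :
    ∃ (n : ℤ) (j : Fin q), m = ((q : ℕ) : ℤ) * n + (j : ℕ) := by
  have hq : (0 : ℤ) < ((q : ℕ) : ℤ) := by exact_mod_cast q.pos
  have h0 := Int.emod_nonneg m hq.ne'
  have h1 := Int.emod_lt_of_pos m hq
  have h2 := Int.mul_ediv_add_emod m ((q : ℕ) : ℤ)
  exact ⟨m / ((q : ℕ) : ℤ), ⟨(m % ((q : ℕ) : ℤ)).toNat, by lia⟩, by simp only; lia⟩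

theorem ramCombination_bijective (q : ℕ+) :
    Function.Bijective (ramCombination (k := k) q) := by
  constructor
  · intro c c' h
    funext j
    ext n
    rw [← ramCombination_coeff q c, ← ramCombination_coeff q c', h]
  · intro v
    refine ⟨fun j => part q v j, ?_⟩
    have hv := eq_sum_part q v
    rw [ramCombination_apply]
    conv_rhs => rw [hv]
    exact Fin.sum_univ_eq_sum_range
      (fun j => ramify k q (part q v j) * HahnSeries.single (j : ℤ) (1 : k)) q

/-- The basis `x ^ (j/q)`, `j < q`, of `K_q`. -/
def ramBasis (k : Type u) [Field k] (q : ℕ+) :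
    Module.Basis (Fin q) (LaurentSeries k) (RamExt k q) :=
  Module.Basis.ofEquivFun (LinearEquiv.ofBijective _ (ramCombination_bijective q)).symm

theorem mem_fil_ramBasis {q : ℕ+} {n : ℤ} {v : RamExt k q} :
    v ∈ fil (ramBasis k q) n ↔ v ∈ ramFil q (((q : ℕ) : ℤ) * n) := by
  have hq : (0 : ℤ) < ((q : ℕ) : ℤ) := by exact_mod_cast q.pos
  obtain ⟨c, rfl⟩ := (ramCombination_bijective q).2 v
  have hr : ∀ j, (ramBasis k q).repr (ramCombination q c) j = c j := by
    intro j
    have : (LinearEquiv.ofBijective _ (ramCombination_bijective q)).symm (ramCombination q c) = c :=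
      (LinearEquiv.ofBijective _ (ramCombination_bijective q)).symm_apply_apply c
    rw [ramBasis, Module.Basis.ofEquivFun_repr_apply, this]
  constructor
  · intro h m hm
    obtain ⟨a, j, rfl⟩ := exists_eq_mul_add q m
    have ha := ramCombination_coeff q c a j
    refine ha.trans ?_
    have h1 := h j
    rw [hr] at h1
    refine h1 a ?_
    by_contra hlt
    have := mul_le_mul_of_nonneg_left (not_lt.1 hlt) hq.le
    lia
  · intro h j
    rw [hr]
    intro a ha
    rw [← ramCombination_coeff q c]
    refine h _ ?_
    have := mul_le_mul_of_nonneg_left (Int.add_one_le_iff.2 ha) hq.le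
    have hj := j.2
    rw [mul_add, mul_one] at this
    lia

theorem cofinal_ramFil (q : ℕ+) : Cofinal (ramFil (k := k) q) (adicFil k (RamExt k q)) := by
  have hq : (1 : ℤ) ≤ ((q : ℕ) : ℤ) := by exact_mod_cast q.pos
  obtain ⟨h1, h2⟩ := cofinal_fil_adicFil (ramBasis k q)
  constructor
  · intro m
    obtain ⟨n, hn⟩ := h1 m
    exact ⟨_, fun v hv => hn (mem_fil_ramBasis.2 hv)⟩
  · intro m
    -- The absolute value ensures `q * |m| ≥ m` also for negative `m`.
    obtain ⟨n, hn⟩ := h2 |m|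
    refine ⟨n, fun v hv => ?_⟩
    refine ordGE_anti ?_ (mem_fil_ramBasis.1 (hn hv))
    exact (le_abs_self m).trans (le_mul_of_one_le_left (abs_nonneg m) hq)

theorem adicCont_ramExt {q p : ℕ+} {A : RamExt k q →ₗ[k] RamExt k p}
    (h : ∀ n, ∀ v ∈ ramFil q n, A v ∈ ramFil p n) : AdicCont A :=
  (adicCont_iff (cofinal_ramFil q) (cofinal_ramFil p)).2 fun m => ⟨m, h m⟩

theorem ramify_xpow (q : ℕ+) (n : ℤ) : ramify k q (xpow k n) = xpow k (((q : ℕ) : ℤ) * n) := by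
  ext m
  by_cases h : ((q : ℕ) : ℤ) ∣ m
  · obtain ⟨a, rfl⟩ := h
    rw [ramify_coeff_mul, xpow, xpow, HahnSeries.coeff_single, HahnSeries.coeff_single]
    simp
  · rw [ramify_coeff_of_not_dvd q _ _ h, xpow, HahnSeries.coeff_single_of_ne]
    rintro rfl
    exact h (dvd_mul_right _ _)

theorem ramExt_xpow_smul (q : ℕ+) (n : ℤ) (v : LaurentSeries k) :
    (xpow k n • (show RamExt k q from v) : RamExt k q) =
      (xpow k (((q : ℕ) : ℤ) * n) * v : LaurentSeries k) := by
  rw [RamExt.smul_def, ramify_xpow]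

theorem order_eq_of_mem_ordGE_iff {f : LaurentSeries k} {a : ℤ}
    (h : ∀ n, f ∈ ordGE k n ↔ n ≤ a) : f ≠ 0 ∧ f.order = a := by
  have h0 : f ≠ 0 := by
    rintro rfl
    have := (h (a + 1)).1 (zero_mem _)
    lia
  refine ⟨h0, le_antisymm ((h _).1 (mem_ordGE_order f)) ?_⟩
  by_contra hlt
  exact HahnSeries.coeff_order_eq_zero.not.2 h0 ((h a).2 le_rfl _ (not_le.1 hlt))

theorem one_mem_ordGE_iff {n : ℤ} : (1 : LaurentSeries k) ∈ ordGE k n ↔ n ≤ 0 := by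
  constructor
  · intro h
    by_contra hlt
    have := h 0 (not_le.1 hlt)
    simp at this
  · intro h
    exact ordGE_anti h (xpow_mem_ordGE 0)

end Ramified

/-! ### The operators `φ` and `x d/dx` on `K_q`. -/

section PhiRam

variable {k : Type u} [Field k] [CharZero k]

/-- The series `(1 + t ^ q) ^ r`. -/
def binomialRam (k : Type u) [Field k] [CharZero k] (q : ℕ+) (r : ℚ) : LaurentSeries k :=
  HahnSeries.ofPowerSeries ℤ k ((PowerSeries.binomialSeries k r).subst
    (PowerSeries.X ^ (q : ℕ) : PowerSeries k))

theorem binomialRam_add (q : ℕ+) (r s : ℚ) :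
    binomialRam k q (r + s) = binomialRam k q r * binomialRam k q s := by
  rw [binomialRam, PowerSeries.binomialSeries_add,
    PowerSeries.subst_mul (PowerSeries.HasSubst.X_pow q.ne_zero), map_mul]
  rfl

theorem binomialRam_zero (q : ℕ+) : binomialRam k q 0 = 1 := by
  rw [binomialRam, PowerSeries.binomialSeries_zero, ← map_one PowerSeries.C, PowerSeries.subst_C]
  simp

/-- The formula `φ(t^n) = t^n (1 + t^q)^(-n/q)` exhibits the dependence on `n`; negative exponents
follow from positive ones by cancelling `φ(t^m)`. -/
theorem phiRam_xpow (q : ℕ+) (n : ℤ) :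
    phiRam k q (xpow k n) = xpow k n * binomialRam k q (-(n / (q : ℕ))) := by
  have h1 : phiRam k q (xpow k 1) = xpow k 1 * binomialRam k q (-(1 / (q : ℕ))) := by
    have hX : xpow k 1 = HahnSeries.ofPowerSeries ℤ k PowerSeries.X :=
      HahnSeries.ofPowerSeries_X.symm
    rw [hX, phiRam, substHom_coe, PowerSeries.subst_X
      (PowerSeries.HasSubst.of_constantCoeff_zero' (shiftSeriesRam_constantCoeff q)),
      shiftSeriesRam, map_mul]
    rfl
  have hnat : ∀ n : ℕ, phiRam k q (xpow k n) = xpow k n * binomialRam k q (-(n / (q : ℕ))) := by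
    intro n
    induction n with
    | zero => simp [binomialRam_zero]
    | succ n ih =>
      have : -(((n + 1 : ℕ) : ℚ) / (q : ℕ)) = -(n / (q : ℕ)) + -(1 / (q : ℕ)) := by
        push_cast
        ring
      rw [this, binomialRam_add, Nat.cast_succ, ← xpow_mul_xpow, map_mul, ih, h1]
      ring
  obtain ⟨m, rfl | rfl⟩ := n.eq_nat_or_neg
  · rw [Int.cast_natCast]
    exact hnat m
  · have h2 : phiRam k q (xpow k (-m)) * phiRam k q (xpow k m) = 1 := by
      rw [← map_mul, xpow_mul_xpow, neg_add_cancel, xpow_zero, map_one]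
    refine mul_right_cancel₀ (b := phiRam k q (xpow k m))
      (right_ne_zero_of_mul (h2.symm ▸ one_ne_zero)) ?_
    rw [h2, hnat, mul_mul_mul_comm, xpow_mul_xpow, ← binomialRam_add, neg_add_cancel, xpow_zero]
    rw [show -(((-(m : ℤ) : ℤ) : ℚ) / (q : ℕ)) + -((m : ℚ) / (q : ℕ)) = 0 by push_cast; ring,
      binomialRam_zero, one_mul]

/-- A generalized binomial coefficient is a falling factorial divided by `j!`, hence a polynomial in
its upper argument. -/
theorem exists_polynomial_choose (r : ℚ) (j : ℕ) :
    ∃ P : Polynomial k, ∀ n : ℤ, ((Ring.choose (r * n) j : ℚ) : k) = P.eval (n : k) := by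
  refine ⟨Polynomial.C (((j.factorial : ℚ)⁻¹ : ℚ) : k) *
    (((descPochhammer ℤ j).map (Int.castRingHom ℚ)).comp
      (Polynomial.C r * Polynomial.X)).map (algebraMap ℚ k), fun n => ?_⟩
  have h := Ring.descPochhammer_eq_factorial_smul_choose (r * n) j
  have hj : (j.factorial : ℚ) ≠ 0 := by exact_mod_cast j.factorial_ne_zero
  rw [nsmul_eq_mul] at h
  have h2 : Ring.choose (r * n) j = (j.factorial : ℚ)⁻¹ *
      (((descPochhammer ℤ j).map (Int.castRingHom ℚ)).comp
        (Polynomial.C r * Polynomial.X)).eval (n : ℚ) := by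
    rw [eq_inv_mul_iff_mul_eq₀ hj, ← h, Polynomial.eval_comp, Polynomial.eval_map,
      ← Polynomial.aeval_eq_smeval]
    simp [Polynomial.aeval_def]
  rw [h2, Polynomial.eval_mul, Polynomial.eval_C, Polynomial.eval_map]
  have h3 := Polynomial.eval₂_at_apply (p := ((descPochhammer ℤ j).map (Int.castRingHom ℚ)).comp
        (Polynomial.C r * Polynomial.X)) (algebraMap ℚ k) (n : ℚ)
  have h4 : algebraMap ℚ k n = (n : k) := by simp
  rw [h4] at h3
  rw [h3]
  simp

/-- `φ` on `K_q` as a `k`-linear map. -/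
def phiRamLin (k : Type u) [Field k] [CharZero k] (q : ℕ+) :
    LaurentSeries k →ₗ[k] LaurentSeries k :=
  substLin (shiftSeriesRam k q) (shiftSeriesRam_constantCoeff q) (shiftSeriesRam_ne_zero q)

theorem phiRamLin_apply (q : ℕ+) (f : LaurentSeries k) : phiRamLin k q f = phiRam k q f := rfl

theorem isPoly_phiRamLin (q : ℕ+) : IsPoly 1 0 (phiRamLin k q) where
  mem n f hf := by
    obtain ⟨p, rfl⟩ := mem_ordGE_iff_exists.1 hf
    rw [phiRamLin_apply, map_mul, phiRam_xpow, add_zero, phiRam, substHom_coe, mul_assoc,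
      binomialRam, ← map_mul]
    exact mem_ordGE_iff_exists.2 ⟨_, rfl⟩
  poly m := by
    simp only [phiRamLin_apply, phiRam_xpow, coeff_xpow_mul, add_sub_cancel_left, one_zpow, one_mul,
      binomialRam, PowerSeries.coeff_coe, PowerSeries.coeff_subst_X_pow q.ne_zero]
    split_ifs with h1 h2
    · exact ⟨0, fun n => by simp⟩
    · obtain ⟨P, hP⟩ := exists_polynomial_choose (k := k) (-(1 / (q : ℕ))) (m.natAbs / q)
      refine ⟨P, fun n => ?_⟩
      rw [← hP, Algebra.algebraMap_self_apply, PowerSeries.binomialSeries_coeff, Rat.smul_one_eq_cast]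
      congr 3
      ring
    · exact ⟨0, fun n => by simp⟩

theorem phiRamLin_xpow_coeff_self (q : ℕ+) (n : ℤ) : (phiRamLin k q (xpow k n)).coeff n = 1 := by
  rw [phiRamLin_apply, phiRam_xpow, coeff_xpow_mul, sub_self, binomialRam, PowerSeries.coeff_coe]
  simp [PowerSeries.coeff_subst_X_pow q.ne_zero]

/-- The operator `x d/dx` on `K_q`. -/
def eulerRam (k : Type u) [Field k] [CharZero k] (q : ℕ+) :
    LaurentSeries k →ₗ[k] LaurentSeries k :=
  ((q : ℕ) : k)⁻¹ • (mulOp (xpow k 1) ∘ₗ LaurentSeries.derivative k)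

theorem eulerRam_coeff (q : ℕ+) (f : LaurentSeries k) (n : ℤ) :
    (eulerRam k q f).coeff n = ((q : ℕ) : k)⁻¹ * (n * f.coeff n) := by
  rw [eulerRam, LinearMap.smul_apply, HahnSeries.coeff_smul, LinearMap.comp_apply, mulOp_apply,
    single_one_mul_derivative_coeff, smul_eq_mul]

theorem isPoly_eulerRam (q : ℕ+) : IsPoly 1 0 (eulerRam k q) where
  mem n f hf m hm := by
    rw [eulerRam_coeff, hf m (by lia), mul_zero, mul_zero]
  poly m := by
    by_cases hm : m = 0
    · refine ⟨Polynomial.C ((q : ℕ) : k)⁻¹ * Polynomial.X, fun n => ?_⟩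
      simp [eulerRam_coeff, hm]
    · refine ⟨0, fun n => ?_⟩
      rw [eulerRam_coeff, xpow, HahnSeries.coeff_single_of_ne (by lia)]
      simp

theorem xpow_mul_nablaE (q : ℕ+) (f v : LaurentSeries k) :
    xpow k ((q : ℕ) : ℤ) * FormalConnection.nablaE q f v = (mulOp f + eulerRam k q) v := by
  rw [FormalConnection.nablaE, LinearMap.add_apply, LinearMap.add_apply, mulOp_apply, mulOp_apply,
    FormalConnection.derivRam_apply, ramify_xpow, mul_add, ← mul_assoc, ← mul_assoc, ← mul_assoc,
    xpow_mul_xpow, HahnSeries.single_mul_single, add_comm]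
  congr 1
  · rw [show ((q : ℕ) : ℤ) + ((q : ℕ) : ℤ) * -1 = 0 by ring, xpow_zero, one_mul]
  · rw [eulerRam, LinearMap.smul_apply, LinearMap.comp_apply, mulOp_apply,
      ← HahnSeries.C_mul_eq_smul, ← mul_assoc, HahnSeries.C_apply, HahnSeries.single_mul_single]
    congr 2 <;> simp

theorem euler_E (q : ℕ+) (f v : LaurentSeries k) :
    (FormalConnection.E q f).euler v = (mulOp f + eulerRam k q) v := by
  have h := ramExt_xpow_smul (k := k) q 1 (FormalConnection.nablaE q f v)
  rw [mul_one] at h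
  exact h.trans (xpow_mul_nablaE q f v)

end PhiRam

/-! ### The transform between `E_f` and `D_g`. -/

section RankOne

variable {k : Type u} [Field k] [CharZero k]

theorem isPoly_nabla {p : ℕ} (q : ℕ+) {f : LaurentSeries k} (hf : f ∈ ordGE k (-p)) :
    IsPoly 1 (-p) (mulOp f + eulerRam k q) :=
  (isPoly_mulOp hf).add ((isPoly_eulerRam q).mono (by lia))

/-- Since `p ≠ 0`, the derivation acts in degree `n`, above the leading degree `n - p`. The leading
coefficient is therefore independent of `n`, as `exists_conjugation` requires. -/
theorem nabla_xpow_coeff {p : ℕ} (hp : p ≠ 0) (q : ℕ+) (f : LaurentSeries k) (n : ℤ) :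
    ((mulOp f + eulerRam k q) (xpow k n)).coeff (n - p) = f.coeff (-p) := by
  rw [LinearMap.add_apply, HahnSeries.coeff_add, mulOp_apply, mul_comm, coeff_xpow_mul,
    eulerRam_coeff, xpow, HahnSeries.coeff_single_of_ne (by lia), mul_zero, mul_zero, add_zero,
    show n - p - n = -(p : ℤ) by ring]

theorem isPoly_shift {d : ℤ} (q : ℕ+) {g : LaurentSeries k} (hg : g ∈ ordGE k d) :
    IsPoly 1 d (mulOp g ∘ₗ phiRamLin k q) := by
  have := (isPoly_mulOp hg).comp one_ne_zero (isPoly_phiRamLin q)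
  rwa [mul_one, add_zero] at this

theorem shift_xpow_coeff {d : ℤ} (q : ℕ+) {g : LaurentSeries k} (hg : g ∈ ordGE k d) (n : ℤ) :
    ((mulOp g ∘ₗ phiRamLin k q) (xpow k n)).coeff (n + d) = g.coeff d := by
  have hm := (isPoly_phiRamLin (k := k) q).mem n _ (xpow_mem_ordGE n)
  rw [LinearMap.comp_apply, coeff_apply_eq_sum (isPoly_mulOp hg).mem hm, add_zero,
    add_sub_cancel_right, Finset.Ico_add_one_right_eq_Icc, Finset.Icc_self, Finset.sum_singleton,
    phiRamLin_xpow_coeff_self, one_mul, mulOp_apply, mul_comm, coeff_xpow_mul,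
    add_sub_cancel_left]

theorem phiRam_xpow_neg (p : ℕ+) :
    phiRam k p (xpow k (-((p : ℕ) : ℤ))) = xpow k (-((p : ℕ) : ℤ)) + 1 := by
  have h := phiRam_ramify (k := k) p (xpow k (-1))
  rwa [phi_xpow_neg_one, map_add, map_one, ramify_xpow, mul_neg_one] at h

theorem exists_zpow_eq [IsAlgClosed k] {b : k} (hb : b ≠ 0) (p : ℕ+) :
    ∃ c : k, c ≠ 0 ∧ b = c ^ (-((p : ℕ) : ℤ)) := by
  obtain ⟨c, hc⟩ := IsAlgClosed.exists_pow_nat_eq b⁻¹ p.pos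
  refine ⟨c, ?_, ?_⟩
  · rintro rfl
    rw [zero_pow p.ne_zero] at hc
    exact inv_ne_zero hb hc.symm
  · rw [zpow_neg, zpow_natCast, hc, inv_inv]

/-- `T` preserves orders, so `g` has the order of `x^(-q)`. This is how numerator and denominator of
the slope change places. -/
theorem order_eq_of_apply_eq {T : LaurentSeries k →ₗ[k] LaurentSeries k}
    (hT : ∀ n f, T f ∈ ordGE k n ↔ f ∈ ordGE k n) {g : LaurentSeries k} {q : ℕ}
    (hg : T g = xpow k (-(q : ℤ)) * T 1) : g ≠ 0 ∧ g.order = -(q : ℤ) := by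
  refine order_eq_of_mem_ordGE_iff fun n => ?_
  have h := xpow_mul_mem_ordGE (m := -(q : ℤ)) (n := n + q) (f := T 1)
  rw [neg_add_cancel_comm_assoc] at h
  rw [← hT, hg, h, hT, one_mem_ordGE_iff]
  lia

theorem eulerRam_xpow_neg_mul (q : ℕ+) (v : LaurentSeries k) :
    eulerRam k q (xpow k (-((q : ℕ) : ℤ)) * v) =
      xpow k (-((q : ℕ) : ℤ)) * eulerRam k q v - xpow k (-((q : ℕ) : ℤ)) * v := by
  have hq : ((q : ℕ) : k) ≠ 0 := by exact_mod_cast q.ne_zero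
  ext m
  rw [HahnSeries.coeff_sub, eulerRam_coeff, coeff_xpow_mul, coeff_xpow_mul, eulerRam_coeff]
  push_cast
  field_simp
  ring

/-- Reduces the transform to identities between Laurent series in `ζ^(1/q)` and `θ^(1/p)`, where
`ζ⁻¹` and `θ⁻¹` are the powers of exponents `-q` and `-p`. Continuity both ways is preservation of
orders. -/
theorem isMellinTransform_E_D (q p : ℕ+) (f g : LaurentSeries k) (hg : g ≠ 0)
    (S : LaurentSeries k ≃ₗ[k] LaurentSeries k)
    (hS : ∀ n v, S v ∈ ordGE k n ↔ v ∈ ordGE k n)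
    (h1 : ∀ v, S ((mulOp f + eulerRam k q) v) = xpow k (-((p : ℕ) : ℤ)) * S v)
    (h2 : ∀ v, g * phiRam k p (S v) = S (xpow k (-((q : ℕ) : ℤ)) * v)) :
    IsMellinTransform (FormalConnection.E q f) (DifferenceModule.D p g hg)
      (show RamExt k q ≃ₗ[k] RamExt k p from S) := by
  have hx : ∀ (r : ℕ+) (w : LaurentSeries k), xpow k (-1) • (show RamExt k r from w) =
      (xpow k (-((r : ℕ) : ℤ)) * w : LaurentSeries k) := by
    intro r w
    rw [ramExt_xpow_smul, mul_neg_one]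
  refine isMellinTransform_iff.2 ⟨fun v => ?_, fun v => ?_, ?_, ?_⟩
  · exact (congrArg S (euler_E q f v)).trans ((h1 v).trans (hx p (S v)).symm)
  · exact (h2 v).trans (congrArg S (hx q v).symm)
  · exact adicCont_ramExt fun n v hv => (hS n v).2 hv
  · refine adicCont_ramExt fun n v hv => ?_
    have h3 : S (S.symm v) = v := S.apply_symm_apply v
    exact (hS n _).1 (h3.symm ▸ hv)

/-- The local Mellin transform of `E_f`. -/
theorem exists_isMellinTransform_E [IsAlgClosed k] (q p : ℕ+) (f : LaurentSeries k)
    (hf : f.order = -((p : ℕ) : ℤ)) :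
    ∃ (g : LaurentSeries k) (hg : g ≠ 0)
      (e : (FormalConnection.E q f).carrier ≃ₗ[k] (DifferenceModule.D p g hg).carrier),
      g.order = -((q : ℕ) : ℤ) ∧
      IsMellinTransform (FormalConnection.E q f) (DifferenceModule.D p g hg) e := by
  -- The zero series has order `0` by convention, which differs from `-p`.
  have hf0 : f ≠ 0 := by
    rintro rfl
    rw [HahnSeries.order_zero] at hf
    have := p.pos
    lia
  have hmem : f ∈ ordGE k (-((p : ℕ) : ℤ)) := hf ▸ mem_ordGE_order f
  have hlead : f.coeff (-((p : ℕ) : ℤ)) ≠ 0 := hf ▸ HahnSeries.coeff_order_eq_zero.not.2 hf0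
  obtain ⟨c, hc, hc'⟩ := exists_zpow_eq hlead p
  have hB := isPoly_nabla q hmem
  obtain ⟨T, hT, hTb, hTord, hTB⟩ := exists_conjugation p.ne_zero hc hB
    fun n => (nabla_xpow_coeff p.ne_zero q f n).trans hc'
  -- The choice of `g` is forced by `(g φ)(1) = g`.
  obtain ⟨g, hg⟩ := hTb.2 (xpow k (-((q : ℕ) : ℤ)) * T 1)
  obtain ⟨hg0, hgord⟩ := order_eq_of_apply_eq hTord hg
  have hcomm : ∀ v, xpow k (-((q : ℕ) : ℤ)) * (mulOp f + eulerRam k q) v =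
      (mulOp f + eulerRam k q) (xpow k (-((q : ℕ) : ℤ)) * v) + xpow k (-((q : ℕ) : ℤ)) * v := by
    intro v
    rw [LinearMap.add_apply, LinearMap.add_apply, eulerRam_xpow_neg_mul, mulOp_apply, mulOp_apply]
    ring
  have hkey : mulOp (xpow k (-((q : ℕ) : ℤ))) ∘ₗ T = T ∘ₗ mulOp g ∘ₗ phiRamLin k p := by
    have h1 := (isPoly_mulOp (xpow_mem_ordGE (k := k) (-((q : ℕ) : ℤ)))).comp one_ne_zero hT
    have h2 := hT.comp hc (isPoly_shift p (mem_ordGE_order g))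
    rw [one_mul] at h1
    rw [mul_one] at h2
    -- Only powers of `τ^(-p) = θ⁻¹` remain. The induction multiplies by `θ⁻¹`: `hcomm` on one side
    -- matches `φ(θ⁻¹) = θ⁻¹ + 1` on the other.
    refine h1.ext hc h2 p.ne_zero fun j => ?_
    induction j with
    | zero =>
      have h0 : xpow k (-(((p : ℕ) : ℤ) * (0 : ℕ))) = 1 := by simp
      rw [h0]
      simp only [LinearMap.comp_apply, mulOp_apply, phiRamLin_apply, map_one, mul_one, hg]
    | succ j ih =>
      have hj : xpow k (-(((p : ℕ) : ℤ) * (j + 1 : ℕ))) =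
          xpow k (-((p : ℕ) : ℤ)) * xpow k (-(((p : ℕ) : ℤ) * j)) := by
        rw [xpow_mul_xpow]
        congr 1
        push_cast
        ring
      simp only [LinearMap.comp_apply, mulOp_apply, phiRamLin_apply] at ih ⊢
      rw [hj, hTB, hcomm, ih, map_mul (phiRam k p), phiRam_xpow_neg, add_mul, one_mul, mul_add, map_add,
        mul_left_comm, hTB]
  let S : LaurentSeries k ≃ₗ[k] LaurentSeries k := (LinearEquiv.ofBijective T hTb).symm
  have hS : ∀ v, T (S v) = v := fun v => (LinearEquiv.ofBijective T hTb).apply_symm_apply v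
  refine ⟨g, hg0, _, hgord, isMellinTransform_E_D q p f g hg0 S (fun n v => ?_) (fun v => ?_)
    fun v => ?_⟩
  · rw [← hTord, hS]
  · apply hTb.1
    rw [hTB, hS, hS]
  · apply hTb.1
    rw [hS]
    have := LinearMap.congr_fun hkey (S v)
    simp only [LinearMap.comp_apply, mulOp_apply, phiRamLin_apply, hS] at this
    exact this.symm

/-- The connection whose local Mellin transform is `D_g`. -/
theorem exists_isMellinTransform_D [IsAlgClosed k] (q p : ℕ+) (g : LaurentSeries k) (hg : g ≠ 0)
    (hgp : g.order = -((p : ℕ) : ℤ)) :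
    ∃ (f : LaurentSeries k)
      (e : (FormalConnection.E p f).carrier ≃ₗ[k] (DifferenceModule.D q g hg).carrier),
      f.order = -((q : ℕ) : ℤ) ∧
      IsMellinTransform (FormalConnection.E p f) (DifferenceModule.D q g hg) e := by
  have hmem : g ∈ ordGE k (-((p : ℕ) : ℤ)) := hgp ▸ mem_ordGE_order g
  have hlead : g.coeff (-((p : ℕ) : ℤ)) ≠ 0 := hgp ▸ HahnSeries.coeff_order_eq_zero.not.2 hg
  obtain ⟨c, hc, hc'⟩ := exists_zpow_eq hlead p
  have hB := isPoly_shift q hmem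
  obtain ⟨T, hT, hTb, hTord, hTB⟩ := exists_conjugation p.ne_zero hc hB
    fun n => (shift_xpow_coeff q hmem n).trans hc'
  -- The choice of `f` is forced by `(f + ζ d/dζ)(1) = f`.
  obtain ⟨f, hf⟩ := hTb.2 (xpow k (-((q : ℕ) : ℤ)) * T 1)
  obtain ⟨-, hford⟩ := order_eq_of_apply_eq hTord hf
  have hcomm : ∀ v, xpow k (-((q : ℕ) : ℤ)) * (mulOp g ∘ₗ phiRamLin k q) v =
      (mulOp g ∘ₗ phiRamLin k q) (xpow k (-((q : ℕ) : ℤ)) * v) -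
        (mulOp g ∘ₗ phiRamLin k q) v := by
    intro v
    simp only [LinearMap.comp_apply, mulOp_apply, phiRamLin_apply]
    rw [map_mul, phiRam_xpow_neg]
    ring
  have hkey : mulOp (xpow k (-((q : ℕ) : ℤ))) ∘ₗ T = T ∘ₗ (mulOp f + eulerRam k p) := by
    have h1 := (isPoly_mulOp (xpow_mem_ordGE (k := k) (-((q : ℕ) : ℤ)))).comp one_ne_zero hT
    have hfm : f ∈ ordGE k (-((q : ℕ) : ℤ)) := hford ▸ mem_ordGE_order f
    have h2 := hT.comp hc (isPoly_nabla p hfm)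
    rw [one_mul] at h1
    rw [mul_one] at h2
    -- It remains to compare on the powers `ζ^(-j)`, where `ζ d/dζ` acts by `-j`; each
    -- multiplication by `ζ⁻¹` lowers this eigenvalue by one, in accordance with `hcomm`.
    refine h1.ext hc h2 p.ne_zero fun j => ?_
    have heul : ∀ j : ℕ, eulerRam k p (xpow k (-(((p : ℕ) : ℤ) * j))) =
        -((j : k) • xpow k (-(((p : ℕ) : ℤ) * j))) := by
      intro j
      have hp : ((p : ℕ) : k) ≠ 0 := by exact_mod_cast p.ne_zero
      ext m
      rw [eulerRam_coeff, HahnSeries.coeff_neg, HahnSeries.coeff_smul, xpow,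
        HahnSeries.coeff_single]
      split_ifs with h
      · rw [h, smul_eq_mul]
        push_cast
        field_simp
      · simp
    induction j with
    | zero =>
      have h0 : xpow k (-(((p : ℕ) : ℤ) * (0 : ℕ))) = 1 := by simp
      have h1 := heul 0
      rw [h0] at h1 ⊢
      simp only [LinearMap.comp_apply, mulOp_apply, LinearMap.add_apply, h1, mul_one]
      simp [hf]
    | succ j ih =>
      have hj : xpow k (-(((p : ℕ) : ℤ) * (j + 1 : ℕ))) =
          xpow k (-((p : ℕ) : ℤ)) * xpow k (-(((p : ℕ) : ℤ) * j)) := by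
        rw [xpow_mul_xpow]
        congr 1
        push_cast
        ring
      have ih' : xpow k (-((q : ℕ) : ℤ)) * T (xpow k (-(((p : ℕ) : ℤ) * j))) =
          T (f * xpow k (-(((p : ℕ) : ℤ) * j)) - (j : k) • xpow k (-(((p : ℕ) : ℤ) * j))) := by
        have := ih
        simp only [LinearMap.comp_apply, mulOp_apply, LinearMap.add_apply, heul] at this
        rw [this, sub_eq_add_neg]
      rw [LinearMap.comp_apply, LinearMap.comp_apply, LinearMap.add_apply, mulOp_apply, mulOp_apply,
        heul, hj, hTB, hcomm, ih', ← hTB, ← hTB, ← map_sub]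
      congr 1
      rw [mul_sub, mul_smul_comm]
      push_cast
      rw [add_smul, one_smul]
      ring
  -- Here `T` itself goes from the connection to the difference module; in the previous theorem its
  -- inverse did.
  refine ⟨f, _, hford, isMellinTransform_E_D p q f g hg (LinearEquiv.ofBijective T hTb) hTord
    (fun v => ?_) fun v => (hTB v).symm⟩
  exact (LinearMap.congr_fun hkey v).symm

end RankOne

/-! ### Subobjects, quotients and irreducible components of connections. -/

namespace FormalConnection

variable {k : Type u} [Field k]

/-- The subobject on an invariant subspace. -/
def sub (E : FormalConnection k) (W : Submodule (LaurentSeries k) E.carrier)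
    (hW : ∀ w ∈ W, E.nabla w ∈ W) : FormalConnection k where
  carrier := W
  nabla :=
    { toFun := fun w => ⟨E.nabla w, hW w w.2⟩
      map_add' := fun v w => Subtype.ext (by simp)
      map_smul' := fun c v => Subtype.ext (by simp) }
  leibniz f v := Subtype.ext (E.leibniz f v)

/-- The inclusion of a subobject. -/
def subι (E : FormalConnection k) (W : Submodule (LaurentSeries k) E.carrier)
    (hW : ∀ w ∈ W, E.nabla w ∈ W) : E.sub W hW ⟶ E :=
  (⟨W.subtype, fun _ => rfl⟩ : Hom (E.sub W hW) E)

/-- The quotient by an invariant subspace. -/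
def quot (E : FormalConnection k) (W : Submodule (LaurentSeries k) E.carrier)
    (hW : ∀ w ∈ W, E.nabla w ∈ W) : FormalConnection k where
  carrier := E.carrier ⧸ W
  nabla :=
    (Submodule.Quotient.restrictScalarsEquiv k W).toLinearMap ∘ₗ
      (W.restrictScalars k).mapQ (W.restrictScalars k) E.nabla hW ∘ₗ
      (Submodule.Quotient.restrictScalarsEquiv k W).symm.toLinearMap
  leibniz f v := by
    obtain ⟨v, rfl⟩ := W.mkQ_surjective v
    exact congrArg W.mkQ (E.leibniz f v)

/-- The projection to a quotient. -/
def quotπ (E : FormalConnection k) (W : Submodule (LaurentSeries k) E.carrier)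
    (hW : ∀ w ∈ W, E.nabla w ∈ W) : E ⟶ E.quot W hW :=
  (⟨W.mkQ, fun _ => rfl⟩ : Hom E (E.quot W hW))

/-- A bijective morphism is an isomorphism. -/
def isoOfBijective {E E' : FormalConnection k} (f : E ⟶ E')
    (hf : Function.Bijective f.toLinearMap) : E ≅ E' where
  hom := f
  inv := (⟨(LinearEquiv.ofBijective f.toLinearMap hf).symm.toLinearMap, fun v => by
    apply hf.1
    rw [f.horizontal]
    exact ((LinearEquiv.ofBijective f.toLinearMap hf).apply_symm_apply _).trans
      (congrArg _ ((LinearEquiv.ofBijective f.toLinearMap hf).apply_symm_apply v).symm)⟩ :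
    Hom E' E)
  hom_inv_id := Hom.ext (LinearMap.ext fun v =>
    (LinearEquiv.ofBijective f.toLinearMap hf).symm_apply_apply v)
  inv_hom_id := Hom.ext (LinearMap.ext fun v =>
    (LinearEquiv.ofBijective f.toLinearMap hf).apply_symm_apply v)

theorem bijective_of_iso {E E' : FormalConnection k} (f : E ≅ E') :
    Function.Bijective f.hom.toLinearMap := by
  refine Function.bijective_iff_has_inverse.2 ⟨f.inv.toLinearMap, fun v => ?_, fun v => ?_⟩
  · exact LinearMap.congr_fun (congrArg Hom.toLinearMap f.hom_inv_id) v
  · exact LinearMap.congr_fun (congrArg Hom.toLinearMap f.inv_hom_id) v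

theorem IsIrreducibleComponent.of_injective {S E E' : FormalConnection k}
    (h : S.IsIrreducibleComponent E) (i : E ⟶ E') (hi : Function.Injective i.toLinearMap) :
    S.IsIrreducibleComponent E' := by
  obtain ⟨hS, X, j, p, hj, hp⟩ := h
  exact ⟨hS, X, j ≫ i, p, hi.comp hj, hp⟩

theorem IsIrreducible.isIrreducibleComponent {S E : FormalConnection k} (h : S.IsIrreducible)
    (p : E ⟶ S) (hp : Function.Surjective p.toLinearMap) : S.IsIrreducibleComponent E :=
  ⟨h, E, 𝟙 E, p, Function.injective_id, hp⟩

/-- A surjection from an irreducible object onto a nonzero one is bijective. -/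
theorem IsIrreducible.bijective {E S : FormalConnection k} (hE : E.IsIrreducible)
    [Nontrivial S.carrier] (u : E ⟶ S) (hu : Function.Surjective u.toLinearMap) :
    Function.Bijective u.toLinearMap := by
  refine ⟨LinearMap.ker_eq_bot.1 ?_, hu⟩
  refine (hE.2 (LinearMap.ker u.toLinearMap) fun w hw => ?_).resolve_right fun h => ?_
  · rw [LinearMap.mem_ker] at hw ⊢
    rw [u.horizontal, hw, map_zero]
  · obtain ⟨s, hs⟩ := exists_ne (0 : S.carrier)
    obtain ⟨v, rfl⟩ := hu s
    exact hs (LinearMap.mem_ker.1 (h ▸ Submodule.mem_top))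

/-- The irreducible components of an extension of an irreducible object. -/
theorem IsIrreducibleComponent.of_exact {E₁ E E₂ S : FormalConnection k} (i : E₁ ⟶ E) (π : E ⟶ E₂)
    (hi : Function.Injective i.toLinearMap) (hex : Function.Exact i.toLinearMap π.toLinearMap)
    (h₂ : E₂.IsIrreducible) (h : S.IsIrreducibleComponent E) :
    S.IsIrreducibleComponent E₁ ∨ Nonempty (S ≅ E₂) := by
  obtain ⟨hS, X, j, p, hj, hp⟩ := h
  let ρ : X ⟶ E₂ := j ≫ π
  let X₁ := LinearMap.ker ρ.toLinearMap
  have hX₁ : ∀ x ∈ X₁, X.nabla x ∈ X₁ := by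
    intro x hx
    rw [LinearMap.mem_ker] at hx ⊢
    rw [ρ.horizontal, hx, map_zero]
  have := hS.1
  -- The image in `S` of `ker (X → E₂)` is `0` or `S`. In the first case `p` factors through `E₂`
  -- and makes `S` a quotient of it; in the second `S` is a quotient of the kernel, which embeds in
  -- `E₁`.
  rcases hS.2 (X₁.map p.toLinearMap) (by
    rintro _ ⟨x, hx, rfl⟩
    exact ⟨_, hX₁ x hx, p.horizontal x⟩) with h0 | h0
  · right
    have hker : ∀ x, ρ.toLinearMap x = 0 → p.toLinearMap x = 0 := by
      intro x hx
      have : p.toLinearMap x ∈ X₁.map p.toLinearMap := ⟨x, LinearMap.mem_ker.2 hx, rfl⟩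
      rwa [h0, Submodule.mem_bot] at this
    have hρ : Function.Surjective ρ.toLinearMap := by
      rw [← LinearMap.range_eq_top]
      refine (h₂.2 _ ?_).resolve_left fun hb => ?_
      · rintro _ ⟨x, rfl⟩
        exact ⟨_, ρ.horizontal x⟩
      · obtain ⟨s, hs⟩ := exists_ne (0 : S.carrier)
        obtain ⟨x, rfl⟩ := hp s
        refine hs (hker x ?_)
        have : ρ.toLinearMap x ∈ LinearMap.range ρ.toLinearMap := ⟨x, rfl⟩
        rwa [hb, Submodule.mem_bot] at this
    obtain ⟨s, hs⟩ := ρ.toLinearMap.exists_rightInverse_of_surjective (LinearMap.range_eq_top.2 hρ)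
    have hu : ∀ x, p.toLinearMap (s (ρ.toLinearMap x)) = p.toLinearMap x := by
      intro x
      rw [← sub_eq_zero, ← map_sub]
      apply hker
      rw [map_sub, sub_eq_zero]
      exact LinearMap.congr_fun hs _
    let u : E₂ ⟶ S := (⟨p.toLinearMap.comp s, fun v => by
      obtain ⟨x, rfl⟩ := hρ v
      rw [← ρ.horizontal, LinearMap.comp_apply, LinearMap.comp_apply, hu, hu, p.horizontal]⟩ :
      Hom E₂ S)
    refine ⟨(isoOfBijective u (h₂.bijective u fun t => ?_)).symm⟩
    obtain ⟨x, rfl⟩ := hp t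
    exact ⟨_, hu x⟩
  · left
    have hlift : ∀ x : X₁, j.toLinearMap x ∈ LinearMap.range i.toLinearMap := fun x =>
      (hex _).1 (LinearMap.mem_ker.1 x.2)
    let j₁ : X₁ →ₗ[LaurentSeries k] E₁.carrier :=
      (LinearEquiv.ofInjective i.toLinearMap hi).symm.toLinearMap ∘ₗ
        (j.toLinearMap ∘ₗ X₁.subtype).codRestrict _ hlift
    have hj₁ : ∀ x, i.toLinearMap (j₁ x) = j.toLinearMap x := fun x =>
      congrArg Subtype.val ((LinearEquiv.ofInjective i.toLinearMap hi).apply_symm_apply _)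
    refine ⟨hS, X.sub X₁ hX₁, (⟨j₁, fun v => hi ?_⟩ : Hom (X.sub X₁ hX₁) E₁),
      X.subι X₁ hX₁ ≫ p, fun x y hxy => ?_, fun t => ?_⟩
    · exact (hj₁ ⟨_, hX₁ _ (show X₁ from v).2⟩).trans (((j.horizontal _).trans
        (congrArg E.nabla (hj₁ v).symm)).trans (i.horizontal _).symm)
    · apply Subtype.ext
      apply hj
      exact (hj₁ x).symm.trans ((congrArg i.toLinearMap hxy).trans (hj₁ y))
    · obtain ⟨x, hx, rfl⟩ : t ∈ X₁.map p.toLinearMap := h0 ▸ Submodule.mem_top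
      exact ⟨⟨x, hx⟩, rfl⟩

/-- A nonzero object has an irreducible quotient. -/
theorem exists_isIrreducible_quot (E : FormalConnection k) [Nontrivial E.carrier] :
    ∃ (W : Submodule (LaurentSeries k) E.carrier) (hW : ∀ w ∈ W, E.nabla w ∈ W),
      W ≠ ⊤ ∧ (E.quot W hW).IsIrreducible := by
  obtain ⟨W, ⟨hW, hne⟩, hmax⟩ := set_has_maximal_iff_noetherian.2
    (inferInstance : IsNoetherian (LaurentSeries k) E.carrier)
    {W | (∀ w ∈ W, E.nabla w ∈ W) ∧ W ≠ ⊤} ⟨⊥, by simp, bot_ne_top⟩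
  refine ⟨W, hW, hne, Submodule.Quotient.nontrivial_iff.2 hne, fun U hU => ?_⟩
  let U₀ : Submodule (LaurentSeries k) (E.carrier ⧸ W) := U
  let U' : Submodule (LaurentSeries k) E.carrier := U₀.comap W.mkQ
  have hWU : W ≤ U' := by
    intro w hw
    rw [Submodule.mem_comap, Submodule.mkQ_apply, (Submodule.Quotient.mk_eq_zero W).2 hw]
    exact zero_mem U₀
  have hU' : ∀ w ∈ U', E.nabla w ∈ U' := fun w hw => hU _ hw
  by_cases h : U' = ⊤
  · right
    refine eq_top_iff.2 fun v _ => ?_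
    obtain ⟨v, rfl⟩ := W.mkQ_surjective v
    exact (h ▸ Submodule.mem_top : v ∈ U')
  · left
    have hEq : W = U' := eq_of_le_of_not_lt hWU (hmax U' ⟨hU', h⟩)
    refine eq_bot_iff.2 fun v hv => ?_
    obtain ⟨v, rfl⟩ := W.mkQ_surjective v
    have : v ∈ W := hEq ▸ hv
    exact (Submodule.mem_bot _).2 ((Submodule.Quotient.mk_eq_zero W).2 this)

end FormalConnection

/-! ### Subobjects, quotients and irreducible components of difference modules. -/

namespace DifferenceModule

variable {k : Type u} [Field k]

/-- A subspace invariant under `Φ` is invariant under `Φ⁻¹`. -/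
theorem mem_of_Phi_mem (D : DifferenceModule k) {W : Submodule (LaurentSeries k) D.carrier}
    (hW : ∀ w ∈ W, D.Phi w ∈ W) {v : D.carrier} (hv : D.Phi v ∈ W) : v ∈ W := by
  -- `C U = Φ⁻¹(U)` is again a subspace by semilinearity.
  let C : Submodule (LaurentSeries k) D.carrier → Submodule (LaurentSeries k) D.carrier := fun U =>
    { carrier := {v | D.Phi v ∈ U}
      add_mem' := fun {a b} ha hb => by
        rw [Set.mem_ofPred_eq, map_add]
        exact add_mem ha hb
      zero_mem' := by
        rw [Set.mem_ofPred_eq, map_zero]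
        exact zero_mem U
      smul_mem' := fun f a ha => by
        rw [Set.mem_ofPred_eq, D.Phi_smul]
        exact U.smul_mem _ ha }
  have hmem : ∀ (n : ℕ) w, w ∈ C^[n] W ↔ D.Phi^[n] w ∈ W := by
    intro n
    induction n with
    | zero => exact fun w => Iff.rfl
    | succ n ih =>
      intro w
      rw [Function.iterate_succ_apply', Function.iterate_succ_apply]
      exact ih (D.Phi w)
  have hmono : Monotone fun n => C^[n] W := monotone_nat_of_le_succ fun n w hw => by
    rw [hmem] at hw ⊢
    rw [Function.iterate_succ_apply']
    exact hW _ hw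
  obtain ⟨n, hn⟩ := monotone_stabilizes_iff_noetherian.2
    (inferInstance : IsNoetherian (LaurentSeries k) D.carrier) ⟨_, hmono⟩
  -- The chain `W ≤ C W ≤ C² W ≤ …` is stationary from `n` on. For `v = Φ^n w`, `Φ v ∈ W` means `w ∈
  -- C^(n+1) W = C^n W`, that is `v ∈ W`.
  obtain ⟨w, rfl⟩ := (D.bijective.iterate n).2 v
  have h1 : w ∈ C^[n + 1] W := by
    rw [hmem, Function.iterate_succ_apply']
    exact hv
  have h2 : C^[n] W = C^[n + 1] W := hn (n + 1) (Nat.le_succ n)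
  rw [← h2, hmem] at h1
  exact h1

/-- The subobject on an invariant subspace. -/
def sub (D : DifferenceModule k) (W : Submodule (LaurentSeries k) D.carrier)
    (hW : ∀ w ∈ W, D.Phi w ∈ W) : DifferenceModule k where
  carrier := W
  Phi :=
    { toFun := fun w => ⟨D.Phi w, hW w w.2⟩
      map_add' := fun v w => Subtype.ext (by simp)
      map_smul' := fun c v => Subtype.ext (by simp) }
  Phi_smul f v := Subtype.ext (D.Phi_smul f v)
  bijective := by
    refine ⟨fun v w h => Subtype.ext (D.bijective.1 (congrArg Subtype.val h)), fun w => ?_⟩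
    obtain ⟨v, hv⟩ := D.bijective.2 w
    exact ⟨⟨v, D.mem_of_Phi_mem hW (hv.symm ▸ w.2)⟩, Subtype.ext hv⟩

/-- The inclusion of a subobject. -/
def subι (D : DifferenceModule k) (W : Submodule (LaurentSeries k) D.carrier)
    (hW : ∀ w ∈ W, D.Phi w ∈ W) : D.sub W hW ⟶ D :=
  (⟨W.subtype, fun _ => rfl⟩ : Hom (D.sub W hW) D)

/-- The quotient by an invariant subspace. -/
def quot (D : DifferenceModule k) (W : Submodule (LaurentSeries k) D.carrier)
    (hW : ∀ w ∈ W, D.Phi w ∈ W) : DifferenceModule k where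
  carrier := D.carrier ⧸ W
  Phi :=
    (Submodule.Quotient.restrictScalarsEquiv k W).toLinearMap ∘ₗ
      (W.restrictScalars k).mapQ (W.restrictScalars k) D.Phi hW ∘ₗ
      (Submodule.Quotient.restrictScalarsEquiv k W).symm.toLinearMap
  Phi_smul f v := by
    obtain ⟨v, rfl⟩ := W.mkQ_surjective v
    exact congrArg W.mkQ (D.Phi_smul f v)
  bijective := by
    constructor
    · refine (injective_iff_map_eq_zero _).2 fun v hv => ?_
      obtain ⟨v, rfl⟩ := W.mkQ_surjective v
      have h1 : D.Phi v ∈ W := (Submodule.Quotient.mk_eq_zero W).1 hv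
      exact (Submodule.Quotient.mk_eq_zero W).2 (D.mem_of_Phi_mem hW h1)
    · intro v
      obtain ⟨v, rfl⟩ := W.mkQ_surjective v
      obtain ⟨w, rfl⟩ := D.bijective.2 v
      exact ⟨W.mkQ w, rfl⟩

/-- The projection to a quotient. -/
def quotπ (D : DifferenceModule k) (W : Submodule (LaurentSeries k) D.carrier)
    (hW : ∀ w ∈ W, D.Phi w ∈ W) : D ⟶ D.quot W hW :=
  (⟨W.mkQ, fun _ => rfl⟩ : Hom D (D.quot W hW))

/-- A bijective morphism is an isomorphism. -/
def isoOfBijective {D D' : DifferenceModule k} (f : D ⟶ D')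
    (hf : Function.Bijective f.toLinearMap) : D ≅ D' where
  hom := f
  inv := (⟨(LinearEquiv.ofBijective f.toLinearMap hf).symm.toLinearMap, fun v => by
    apply hf.1
    rw [f.comm]
    exact ((LinearEquiv.ofBijective f.toLinearMap hf).apply_symm_apply _).trans
      (congrArg _ ((LinearEquiv.ofBijective f.toLinearMap hf).apply_symm_apply v).symm)⟩ :
    Hom D' D)
  hom_inv_id := Hom.ext (LinearMap.ext fun v =>
    (LinearEquiv.ofBijective f.toLinearMap hf).symm_apply_apply v)
  inv_hom_id := Hom.ext (LinearMap.ext fun v =>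
    (LinearEquiv.ofBijective f.toLinearMap hf).apply_symm_apply v)

theorem bijective_of_iso {D D' : DifferenceModule k} (f : D ≅ D') :
    Function.Bijective f.hom.toLinearMap := by
  refine Function.bijective_iff_has_inverse.2 ⟨f.inv.toLinearMap, fun v => ?_, fun v => ?_⟩
  · exact LinearMap.congr_fun (congrArg Hom.toLinearMap f.hom_inv_id) v
  · exact LinearMap.congr_fun (congrArg Hom.toLinearMap f.inv_hom_id) v

theorem IsIrreducibleComponent.of_injective {S D D' : DifferenceModule k}
    (h : S.IsIrreducibleComponent D) (i : D ⟶ D') (hi : Function.Injective i.toLinearMap) :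
    S.IsIrreducibleComponent D' := by
  obtain ⟨hS, X, j, p, hj, hp⟩ := h
  exact ⟨hS, X, j ≫ i, p, hi.comp hj, hp⟩

theorem IsIrreducible.isIrreducibleComponent {S D : DifferenceModule k} (h : S.IsIrreducible)
    (p : D ⟶ S) (hp : Function.Surjective p.toLinearMap) : S.IsIrreducibleComponent D :=
  ⟨h, D, 𝟙 D, p, Function.injective_id, hp⟩

/-- A surjection from an irreducible object onto a nonzero one is bijective. -/
theorem IsIrreducible.bijective {D S : DifferenceModule k} (hD : D.IsIrreducible)
    [Nontrivial S.carrier] (u : D ⟶ S) (hu : Function.Surjective u.toLinearMap) :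
    Function.Bijective u.toLinearMap := by
  refine ⟨LinearMap.ker_eq_bot.1 ?_, hu⟩
  refine (hD.2 (LinearMap.ker u.toLinearMap) fun w hw => ?_).resolve_right fun h => ?_
  · rw [LinearMap.mem_ker] at hw ⊢
    rw [u.comm, hw, map_zero]
  · obtain ⟨s, hs⟩ := exists_ne (0 : S.carrier)
    obtain ⟨v, rfl⟩ := hu s
    exact hs (LinearMap.mem_ker.1 (h ▸ Submodule.mem_top))

/-- The irreducible components of an extension of an irreducible object. -/
theorem IsIrreducibleComponent.of_exact {D₁ D D₂ S : DifferenceModule k} (i : D₁ ⟶ D) (π : D ⟶ D₂)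
    (hi : Function.Injective i.toLinearMap) (hex : Function.Exact i.toLinearMap π.toLinearMap)
    (h₂ : D₂.IsIrreducible) (h : S.IsIrreducibleComponent D) :
    S.IsIrreducibleComponent D₁ ∨ Nonempty (S ≅ D₂) := by
  obtain ⟨hS, X, j, p, hj, hp⟩ := h
  let ρ : X ⟶ D₂ := j ≫ π
  let X₁ := LinearMap.ker ρ.toLinearMap
  have hX₁ : ∀ x ∈ X₁, X.Phi x ∈ X₁ := by
    intro x hx
    rw [LinearMap.mem_ker] at hx ⊢
    rw [ρ.comm, hx, map_zero]
  have := hS.1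
  -- The same dichotomy as for connections: the kernel of `X → D₂` dies in `S` or maps onto `S`.
  rcases hS.2 (X₁.map p.toLinearMap) (by
    rintro _ ⟨x, hx, rfl⟩
    exact ⟨_, hX₁ x hx, p.comm x⟩) with h0 | h0
  · right
    have hker : ∀ x, ρ.toLinearMap x = 0 → p.toLinearMap x = 0 := by
      intro x hx
      have : p.toLinearMap x ∈ X₁.map p.toLinearMap := ⟨x, LinearMap.mem_ker.2 hx, rfl⟩
      rwa [h0, Submodule.mem_bot] at this
    have hρ : Function.Surjective ρ.toLinearMap := by
      rw [← LinearMap.range_eq_top]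
      refine (h₂.2 _ ?_).resolve_left fun hb => ?_
      · rintro _ ⟨x, rfl⟩
        exact ⟨_, ρ.comm x⟩
      · obtain ⟨s, hs⟩ := exists_ne (0 : S.carrier)
        obtain ⟨x, rfl⟩ := hp s
        refine hs (hker x ?_)
        have : ρ.toLinearMap x ∈ LinearMap.range ρ.toLinearMap := ⟨x, rfl⟩
        rwa [hb, Submodule.mem_bot] at this
    obtain ⟨s, hs⟩ := ρ.toLinearMap.exists_rightInverse_of_surjective (LinearMap.range_eq_top.2 hρ)
    have hu : ∀ x, p.toLinearMap (s (ρ.toLinearMap x)) = p.toLinearMap x := by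
      intro x
      rw [← sub_eq_zero, ← map_sub]
      apply hker
      rw [map_sub, sub_eq_zero]
      exact LinearMap.congr_fun hs _
    let u : D₂ ⟶ S := (⟨p.toLinearMap.comp s, fun v => by
      obtain ⟨x, rfl⟩ := hρ v
      rw [← ρ.comm, LinearMap.comp_apply, LinearMap.comp_apply, hu, hu, p.comm]⟩ : Hom D₂ S)
    refine ⟨(isoOfBijective u (h₂.bijective u fun t => ?_)).symm⟩
    obtain ⟨x, rfl⟩ := hp t
    exact ⟨_, hu x⟩
  · left
    have hlift : ∀ x : X₁, j.toLinearMap x ∈ LinearMap.range i.toLinearMap := fun x =>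
      (hex _).1 (LinearMap.mem_ker.1 x.2)
    let j₁ : X₁ →ₗ[LaurentSeries k] D₁.carrier :=
      (LinearEquiv.ofInjective i.toLinearMap hi).symm.toLinearMap ∘ₗ
        (j.toLinearMap ∘ₗ X₁.subtype).codRestrict _ hlift
    have hj₁ : ∀ x, i.toLinearMap (j₁ x) = j.toLinearMap x := fun x =>
      congrArg Subtype.val ((LinearEquiv.ofInjective i.toLinearMap hi).apply_symm_apply _)
    refine ⟨hS, X.sub X₁ hX₁, (⟨j₁, fun v => hi ?_⟩ : Hom (X.sub X₁ hX₁) D₁),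
      X.subι X₁ hX₁ ≫ p, fun x y hxy => ?_, fun t => ?_⟩
    · exact (hj₁ ⟨_, hX₁ _ (show X₁ from v).2⟩).trans (((j.comm _).trans
        (congrArg D.Phi (hj₁ v).symm)).trans (i.comm _).symm)
    · apply Subtype.ext
      apply hj
      exact (hj₁ x).symm.trans ((congrArg i.toLinearMap hxy).trans (hj₁ y))
    · obtain ⟨x, hx, rfl⟩ : t ∈ X₁.map p.toLinearMap := h0 ▸ Submodule.mem_top
      exact ⟨⟨x, hx⟩, rfl⟩

/-- A nonzero object has an irreducible quotient. -/
theorem exists_isIrreducible_quot (D : DifferenceModule k) [Nontrivial D.carrier] :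
    ∃ (W : Submodule (LaurentSeries k) D.carrier) (hW : ∀ w ∈ W, D.Phi w ∈ W),
      W ≠ ⊤ ∧ (D.quot W hW).IsIrreducible := by
  obtain ⟨W, ⟨hW, hne⟩, hmax⟩ := set_has_maximal_iff_noetherian.2
    (inferInstance : IsNoetherian (LaurentSeries k) D.carrier)
    {W | (∀ w ∈ W, D.Phi w ∈ W) ∧ W ≠ ⊤} ⟨⊥, by simp, bot_ne_top⟩
  refine ⟨W, hW, hne, Submodule.Quotient.nontrivial_iff.2 hne, fun U hU => ?_⟩
  let U₀ : Submodule (LaurentSeries k) (D.carrier ⧸ W) := U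
  let U' : Submodule (LaurentSeries k) D.carrier := U₀.comap W.mkQ
  have hWU : W ≤ U' := by
    intro w hw
    rw [Submodule.mem_comap, Submodule.mkQ_apply, (Submodule.Quotient.mk_eq_zero W).2 hw]
    exact zero_mem U₀
  have hU' : ∀ w ∈ U', D.Phi w ∈ U' := fun w hw => hU _ hw
  by_cases h : U' = ⊤
  · right
    refine eq_top_iff.2 fun v _ => ?_
    obtain ⟨v, rfl⟩ := W.mkQ_surjective v
    exact (h ▸ Submodule.mem_top : v ∈ U')
  · left
    have hEq : W = U' := eq_of_le_of_not_lt hWU (hmax U' ⟨hU', h⟩)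
    refine eq_bot_iff.2 fun v hv => ?_
    obtain ⟨v, rfl⟩ := W.mkQ_surjective v
    have : v ∈ W := hEq ▸ hv
    exact (Submodule.mem_bot _).2 ((Submodule.Quotient.mk_eq_zero W).2 this)

end DifferenceModule

/-! ### Irreducibility passes from a connection to its transform. -/

section Irreducible

variable {k : Type u} [Field k]
variable {V : Type u} [AddCommGroup V] [Module k V] [Module (LaurentSeries k) V]
  [IsScalarTower k (LaurentSeries k) V] [FiniteDimensional (LaurentSeries k) V]
variable {V' : Type u} [AddCommGroup V'] [Module k V'] [Module (LaurentSeries k) V']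
  [IsScalarTower k (LaurentSeries k) V'] [FiniteDimensional (LaurentSeries k) V']

/-- The preimage of a subspace under a continuous map is a subspace if it is invariant
under `x` and `x⁻¹`. -/
theorem smul_mem_of_adicCont {e : V →ₗ[k] V'} (he : AdicCont e)
    {Y : Submodule (LaurentSeries k) V'} (h1 : ∀ v, e v ∈ Y → e (xpow k 1 • v) ∈ Y)
    (h2 : ∀ v, e v ∈ Y → e (xpow k (-1) • v) ∈ Y) (f : LaurentSeries k) {v : V} (hv : e v ∈ Y) :
    e (f • v) ∈ Y := by
  have hn : ∀ n : ℤ, e (xpow k n • v) ∈ Y := by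
    intro n
    induction n using Int.induction_on with
    | zero => simpa using hv
    | succ n ih =>
      have := h1 _ ih
      rwa [smul_smul, xpow_mul_xpow, add_comm] at this
    | pred n ih =>
      have := h2 _ ih
      rwa [smul_smul, xpow_mul_xpow, neg_add_eq_sub] at this
  have hz := ((adicCont_restrictScalars Y.mkQ).comp (he.comp (adicCont_smulVec v))).eq_zero
    fun n => (Submodule.Quotient.mk_eq_zero Y).2 (hn n)
  exact (Submodule.Quotient.mk_eq_zero Y).1 (LinearMap.congr_fun hz f)

/-- A `Φ`-stable subspace is also `Φ⁻¹`-stable, so its preimage is stable under `ζ` and `ζ⁻¹`. Being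
closed, this preimage is a `k((ζ))`-subspace, and it is stable under `∇ = ζ⁻¹ (ζ ∇)` because `ζ ∇`
is multiplication by `θ⁻¹`. -/
theorem IsMellinTransform.isIrreducible {E : FormalConnection k} {D : DifferenceModule k}
    {e : E.carrier ≃ₗ[k] D.carrier} (h : IsMellinTransform E D e) (hE : E.IsIrreducible) :
    D.IsIrreducible := by
  obtain ⟨h1, h2, hc, -⟩ := isMellinTransform_iff.1 h
  have := hE.1
  refine ⟨e.symm.toEquiv.nontrivial, fun Y hY => ?_⟩
  let X : Submodule (LaurentSeries k) E.carrier :=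
    { carrier := {v | e v ∈ Y}
      add_mem' := fun {a b} ha hb => by
        rw [Set.mem_ofPred_eq, map_add]
        exact add_mem ha hb
      zero_mem' := by
        rw [Set.mem_ofPred_eq, map_zero]
        exact zero_mem Y
      smul_mem' := fun f v hv => by
        refine smul_mem_of_adicCont hc (fun w hw => D.mem_of_Phi_mem hY ?_) (fun w hw => ?_) f hv
        · rw [LinearEquiv.coe_coe, h2, smul_smul, xpow_mul_xpow, neg_add_cancel, xpow_zero,
            one_smul]
          exact hw
        · rw [LinearEquiv.coe_coe, ← h2]
          exact hY _ hw }
  have hX : ∀ v, v ∈ X ↔ e v ∈ Y := fun _ => Iff.rfl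
  have hnabla : ∀ v ∈ X, E.nabla v ∈ X := by
    intro v hv
    rw [E.nabla_eq]
    refine X.smul_mem _ ?_
    rw [hX, h1]
    exact Y.smul_mem _ hv
  rcases hE.2 X hnabla with h0 | h0
  · left
    refine eq_bot_iff.2 fun d hd => ?_
    obtain ⟨v, rfl⟩ := e.surjective d
    have : v ∈ X := hd
    rw [h0, Submodule.mem_bot] at this
    rw [this, map_zero]
    exact zero_mem _
  · right
    refine eq_top_iff.2 fun d _ => ?_
    obtain ⟨v, rfl⟩ := e.surjective d
    exact (hX v).1 (h0 ▸ Submodule.mem_top)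

end Irreducible

/-! ### Irreducibility of `E_f` from that of its transform. -/

section IrreducibleRankOne

variable {k : Type u} [Field k] [CharZero k]

/-- The preimage under `x d/dx + f` of an invariant closed subspace of `K_q` is contained in this
subspace if `f` has a pole. -/
theorem mem_of_nabla_mem {p : ℕ} (hp : p ≠ 0) (q : ℕ+) {f : LaurentSeries k}
    (hf : f ∈ ordGE k (-p)) (hlead : f.coeff (-p) ≠ 0) {X : Submodule k (LaurentSeries k)}
    (hX : ∀ x ∈ X, ∀ n : ℤ, xpow k (((q : ℕ) : ℤ) * n) * x ∈ X)
    (hδ : ∀ x ∈ X, (mulOp f + eulerRam k q) x ∈ X)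
    (hclosed : ∀ v ∉ X, ∃ N, ∀ x ∈ X, v + x ∉ ordGE k N) {v : LaurentSeries k}
    (hv : (mulOp f + eulerRam k q) v ∈ X) : v ∈ X := by
  by_contra hvX
  obtain ⟨N, hN⟩ := hclosed v hvX
  -- Choose `v + x` of the greatest order `m` in the coset `v + X`; closedness of `X` bounds these
  -- orders.
  obtain ⟨m, ⟨x, hx, hm⟩, hmax⟩ := Int.exists_greatest_of_bdd
    (P := fun m => ∃ x ∈ X, v + x ∈ ordGE k m)
    ⟨N, fun m ⟨x, hx, hm⟩ => by
      by_contra hlt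
      exact hN x hx (ordGE_anti (not_le.1 hlt).le hm)⟩
    ⟨v.order, 0, zero_mem X, by rw [add_zero]; exact mem_ordGE_order v⟩
  have hstep : ∀ (n : ℤ) (w : LaurentSeries k), w ∈ ordGE k n → w.coeff n ≠ 0 →
      (mulOp f + eulerRam k q) w ∈ ordGE k (n - p) ∧
        ((mulOp f + eulerRam k q) w).coeff (n - p) ≠ 0 := by
    intro n w hw hw0
    have hP := isPoly_nabla q hf
    refine ⟨hP.mem n w hw, ?_⟩
    rw [coeff_apply_eq_sum hP.mem hw, sub_neg_eq_add, sub_add_cancel,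
      Finset.Ico_add_one_right_eq_Icc, Finset.Icc_self, Finset.sum_singleton,
      nabla_xpow_coeff hp q f n]
    exact mul_ne_zero hw0 hlead
  have hcm : (v + x).coeff m ≠ 0 := by
    intro h0
    have := hmax (m + 1) ⟨x, hx, fun j hj => by
      rcases (Int.lt_add_one_iff.1 hj).lt_or_eq with h | h
      · exact hm j h
      · rw [h, h0]⟩
    lia
  -- Each application of the operator lowers the order by exactly `p`, and the first one already
  -- lands in `X`.
  have hiter : ∀ j : ℕ, ∃ y ∈ X, y ∈ ordGE k (m - (j + 1) * p) ∧
      y.coeff (m - (j + 1) * p) ≠ 0 := by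
    intro j
    induction j with
    | zero =>
      refine ⟨(mulOp f + eulerRam k q) (v + x), ?_, ?_⟩
      · rw [map_add]
        exact add_mem hv (hδ x hx)
      · rw [show m - (((0 : ℕ) : ℤ) + 1) * p = m - p by push_cast; ring]
        exact hstep m (v + x) hm hcm
    | succ j ih =>
      obtain ⟨y, hy, h1, h2⟩ := ih
      have := hstep _ y h1 h2
      rw [show m - ((j : ℤ) + 1) * p - p = m - (((j + 1 : ℕ) : ℤ) + 1) * p by push_cast; ring]
        at this
      exact ⟨_, hδ y hy, this⟩
  -- After `q` applications the drop is `q p`, which the scalar `x^p = t^(q p)` compensates. This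
  -- gives an element of `X` of order exactly `m`; subtracting a multiple of it contradicts
  -- maximality.
  obtain ⟨y, hy, h1, h2⟩ := hiter (q.natPred)
  have hq : (q.natPred : ℤ) + 1 = ((q : ℕ) : ℤ) := by exact_mod_cast q.natPred_add_one
  rw [hq] at h1 h2
  let y' := xpow k (((q : ℕ) : ℤ) * p) * y
  have hy' : y' ∈ X := hX y hy p
  have h1' : y' ∈ ordGE k m := by
    have := ordGE_mul (xpow_mem_ordGE (k := k) (((q : ℕ) : ℤ) * p)) h1
    rwa [add_sub_cancel] at this
  have h2' : y'.coeff m ≠ 0 := by rwa [coeff_xpow_mul]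
  have := hmax (m + 1) ⟨x - ((v + x).coeff m / y'.coeff m) • y',
    sub_mem hx (X.smul_mem _ hy'), fun j hj => ?_⟩
  · lia
  · rw [← add_sub_assoc, HahnSeries.coeff_sub, HahnSeries.coeff_smul, smul_eq_mul]
    rcases (Int.lt_add_one_iff.1 hj).lt_or_eq with h | h
    · rw [hm j h, h1' j h, mul_zero, sub_zero]
    · rw [h, div_mul_cancel₀ _ h2', sub_self]

/-- A `∇`-stable subspace has to be stable under `θ`, the inverse of `ζ ∇`. The chain argument used
for `Φ` is unavailable, since the preimage of a subspace under `ζ ∇` need not be a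
`k((ζ))`-subspace; the leading-term argument of `mem_of_nabla_mem` replaces it. -/
theorem isIrreducible_E {q p : ℕ+} {f : LaurentSeries k} (hf : f.order = -((p : ℕ) : ℤ))
    {D : DifferenceModule k} {e : (FormalConnection.E q f).carrier ≃ₗ[k] D.carrier}
    (h : IsMellinTransform (FormalConnection.E q f) D e) (hD : D.IsIrreducible) :
    (FormalConnection.E q f).IsIrreducible := by
  have hf0 : f ≠ 0 := by
    rintro rfl
    rw [HahnSeries.order_zero] at hf
    have := p.pos
    lia
  have hmem : f ∈ ordGE k (-((p : ℕ) : ℤ)) := hf ▸ mem_ordGE_order f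
  have hlead : f.coeff (-((p : ℕ) : ℤ)) ≠ 0 := hf ▸ HahnSeries.coeff_order_eq_zero.not.2 hf0
  obtain ⟨h1, h2, -, hc⟩ := isMellinTransform_iff.1 h
  have := hD.1
  refine ⟨e.toEquiv.nontrivial, fun X hX => ?_⟩
  have heuler : ∀ v ∈ X, (FormalConnection.E q f).euler v ∈ X := fun v hv =>
    X.smul_mem _ (hX v hv)
  have hinv : ∀ v, (FormalConnection.E q f).euler v ∈ X → v ∈ X := by
    intro v hv
    let X₀ : Submodule (LaurentSeries k) (RamExt k q) := X
    refine mem_of_nabla_mem (X := X₀.restrictScalars k) p.ne_zero q hmem hlead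
      (fun x hx n => ?_) (fun x hx => ?_) (fun w hw => ?_) (v := v) ?_
    · have := X₀.smul_mem (xpow k n) hx
      have hs := ramExt_xpow_smul (k := k) q n x
      exact hs ▸ this
    · have := heuler x hx
      exact (euler_E q f x) ▸ this
    -- A subspace is closed because its quotient is finite-dimensional, hence separated, and the
    -- projection is continuous.
    · let π : RamExt k q →ₗ[k] RamExt k q ⧸ X₀ := X₀.mkQ.restrictScalars k
      have hπ : π w ≠ 0 := fun h0 => hw ((Submodule.Quotient.mk_eq_zero X₀).1 h0)
      obtain ⟨m, hm⟩ : ∃ m, π w ∉ adicFil k (RamExt k q ⧸ X₀) m := by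
        by_contra hcon
        push Not at hcon
        exact hπ (eq_zero_of_forall_mem_fil _ hcon)
      obtain ⟨N, hN⟩ := (adicCont_iff (cofinal_ramFil q)
        ⟨fun m => ⟨m, le_rfl⟩, fun m => ⟨m, le_rfl⟩⟩).1 (adicCont_restrictScalars X₀.mkQ) m
      refine ⟨N, fun x hx hmem => hm ?_⟩
      have h3 := hN _ hmem
      have h4 : π x = 0 := (Submodule.Quotient.mk_eq_zero X₀).2 hx
      have h5 : π (w + x) = π w :=
        (map_add π w x).trans ((congrArg (π w + ·) h4).trans (add_zero _))
      exact h5 ▸ h3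
    · exact (euler_E q f v) ▸ hv
  let Y : Submodule (LaurentSeries k) D.carrier :=
    { carrier := {d | e.symm d ∈ X}
      add_mem' := fun {a b} ha hb => by
        rw [Set.mem_ofPred_eq, map_add]
        exact add_mem ha hb
      zero_mem' := by
        rw [Set.mem_ofPred_eq, map_zero]
        exact zero_mem X
      smul_mem' := fun g d hd => by
        refine smul_mem_of_adicCont hc (fun w hw => hinv _ ?_) (fun w hw => ?_) g hd
        · have : (FormalConnection.E q f).euler (e.symm (xpow k 1 • w)) = e.symm w := by
            rw [LinearEquiv.eq_symm_apply, h1, e.apply_symm_apply, smul_smul, xpow_mul_xpow,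
              neg_add_cancel, xpow_zero, one_smul]
          exact this.symm ▸ hw
        · have : e.symm (xpow k (-1) • w) = (FormalConnection.E q f).euler (e.symm w) := by
            rw [LinearEquiv.symm_apply_eq, h1, e.apply_symm_apply]
          exact this.symm ▸ heuler _ hw }
  have hYX : ∀ d, d ∈ Y ↔ e.symm d ∈ X := fun _ => Iff.rfl
  have hPhi : ∀ d ∈ Y, D.Phi d ∈ Y := by
    intro d hd
    have : e.symm (D.Phi d) = xpow k (-1) • e.symm d := by
      rw [LinearEquiv.symm_apply_eq, ← h2, e.apply_symm_apply]
    rw [hYX, this]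
    exact X.smul_mem _ hd
  rcases hD.2 Y hPhi with h0 | h0
  · left
    refine eq_bot_iff.2 fun v hv => ?_
    have : e v ∈ Y := by rwa [hYX, e.symm_apply_apply]
    rw [h0, Submodule.mem_bot, e.map_eq_zero_iff] at this
    rw [this]
    exact zero_mem _
  · right
    refine eq_top_iff.2 fun v _ => ?_
    have : e v ∈ Y := h0 ▸ Submodule.mem_top
    rwa [hYX, e.symm_apply_apply] at this

end IrreducibleRankOne

/-! ### Existence of the transform in both directions by dévissage. -/

section Existence

variable {k : Type u} [Field k]

theorem IsMellinTransform.of_connection_iso {E E' : FormalConnection k} {D : DifferenceModule k}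
    {e : E'.carrier ≃ₗ[k] D.carrier} (h : IsMellinTransform E' D e) (i : E ≅ E') :
    ∃ e' : E.carrier ≃ₗ[k] D.carrier, IsMellinTransform E D e' := by
  let l := LinearEquiv.ofBijective i.hom.toLinearMap (FormalConnection.bijective_of_iso i)
  obtain ⟨h1, h2, hc, hc'⟩ := isMellinTransform_iff.1 h
  let e' : E.carrier ≃ₗ[k] D.carrier := (l.restrictScalars k).trans e
  have he' : ∀ v, e' v = e (i.hom.toLinearMap v) := fun _ => rfl
  refine ⟨e', isMellinTransform_iff.2 ⟨fun v => ?_, fun v => ?_, ?_, ?_⟩⟩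
  · rw [he', he', ← h1, E.euler_apply, map_smul, i.hom.horizontal, ← E'.euler_apply]
  · rw [he', he', h2, i.hom.toLinearMap.map_smul]
  · exact (hc.comp (adicCont_restrictScalars l.toLinearMap)).of_eq fun _ => rfl
  · exact ((adicCont_restrictScalars l.symm.toLinearMap).comp hc').of_eq fun _ => rfl

theorem IsMellinTransform.of_difference_iso {E : FormalConnection k} {D D' : DifferenceModule k}
    {e : E.carrier ≃ₗ[k] D.carrier} (h : IsMellinTransform E D e) (i : D ≅ D') :
    ∃ e' : E.carrier ≃ₗ[k] D'.carrier, IsMellinTransform E D' e' := by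
  let l := LinearEquiv.ofBijective i.hom.toLinearMap (DifferenceModule.bijective_of_iso i)
  obtain ⟨h1, h2, hc, hc'⟩ := isMellinTransform_iff.1 h
  refine ⟨e.trans (l.restrictScalars k), isMellinTransform_iff.2 ⟨fun v => ?_, fun v => ?_,
    (adicCont_restrictScalars l.toLinearMap).comp hc,
    hc'.comp (adicCont_restrictScalars l.symm.toLinearMap)⟩⟩
  · change i.hom.toLinearMap (e (E.euler v)) = xpow k (-1) • i.hom.toLinearMap (e v)
    rw [h1, map_smul]
  · change D'.Phi (i.hom.toLinearMap (e v)) = i.hom.toLinearMap (e (xpow k (-1) • v))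
    rw [← h2, i.hom.comm]

variable [CharZero k]

theorem FormalConnection.posSlope_of_subsingleton (E : FormalConnection k)
    [Subsingleton E.carrier] : FormalConnection.posSlope k E := by
  rintro S ⟨hS, X, i, p, hi, hp⟩
  have := hi.subsingleton
  have := hp.subsingleton
  exact (not_nontrivial S.carrier hS.1).elim

theorem DifferenceModule.negOrder_of_subsingleton (D : DifferenceModule k)
    [Subsingleton D.carrier] : DifferenceModule.negOrder k D := by
  rintro S ⟨hS, X, i, p, hi, hp⟩
  have := hi.subsingleton
  have := hp.subsingleton
  exact (not_nontrivial S.carrier hS.1).elim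

/-- Induction on the dimension along `0 → W → E → E / W → 0` with `E / W` irreducible, so isomorphic
to some `E_f` with `f` of negative order. The components of the resulting module are those of the
transform of `W` together with `D_g`. -/
theorem exists_isMellinTransform_of_posSlope [IsAlgClosed k] (E : FormalConnection k)
    (hE : FormalConnection.posSlope k E) :
    ∃ (D : DifferenceModule k) (e : E.carrier ≃ₗ[k] D.carrier),
      DifferenceModule.negOrder k D ∧ IsMellinTransform E D e := by
  induction hn : Module.finrank (LaurentSeries k) E.carrier using Nat.strong_induction_on
    generalizing E with
  | _ n ih =>
  subst hn
  rcases subsingleton_or_nontrivial E.carrier with hsub | hnt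
  · let D := differenceModuleOf E E.carrier (LinearEquiv.refl k _)
      (fun _ => Subsingleton.elim _ _) adicCont_id adicCont_id
    have : Subsingleton D.carrier := hsub
    exact ⟨D, _, D.negOrder_of_subsingleton, isMellinTransform_differenceModuleOf _ _ _ _ _ _⟩
  obtain ⟨W, hW, hne, hirr⟩ := E.exists_isIrreducible_quot
  obtain ⟨D₁, e₁, hD₁, hM₁⟩ := ih _ (Submodule.finrank_lt hne) (E.sub W hW)
    (fun S hS => hE S (hS.of_injective (E.subι W hW) Subtype.val_injective)) rfl
  obtain ⟨s, hs, q, f, ⟨j⟩, rfl⟩ := hE _ (hirr.isIrreducibleComponent (E.quotπ W hW)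
    W.mkQ_surjective)
  have hq : (0 : ℚ) < ((q : ℕ) : ℚ) := by exact_mod_cast q.pos
  have hf : f.order < 0 := by
    by_contra hlt
    have h0 : (0 : ℚ) ≤ (f.order : ℚ) := by exact_mod_cast not_lt.1 hlt
    have := div_nonneg h0 hq.le
    rw [max_eq_left (by linarith)] at hs
    exact lt_irrefl _ hs
  obtain ⟨p, hp⟩ : ∃ p : ℕ+, f.order = -((p : ℕ) : ℤ) :=
    ⟨⟨(-f.order).toNat, by lia⟩, by simp only [PNat.mk_coe]; lia⟩
  obtain ⟨g, hg, e, hgord, hM⟩ := exists_isMellinTransform_E q p f hp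
  obtain ⟨e₂, hM₂⟩ := hM.of_connection_iso j
  have hD₂ := hM₂.isIrreducible hirr
  obtain ⟨a₁, b₁, c₁, c₁'⟩ := isMellinTransform_iff.1 hM₁
  obtain ⟨a₂, b₂, c₂, c₂'⟩ := isMellinTransform_iff.1 hM₂
  have hex : Function.Exact (E.subι W hW).toLinearMap (E.quotπ W hW).toLinearMap := fun v =>
    (Submodule.Quotient.mk_eq_zero W).trans ⟨fun h => ⟨⟨v, h⟩, rfl⟩, by rintro ⟨w, rfl⟩; exact w.2⟩
  -- The operator `ζ ∇` becomes `θ⁻¹` on `D₁ × D_g`; in particular the invertibility of `z ∇_z`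
  -- needs no separate argument.
  obtain ⟨ε, hε, hεi, hεπ, hc, hc'⟩ := exists_equiv_of_exact (i := (E.subι W hW).toLinearMap)
    (π := (E.quotπ W hW).toLinearMap) Subtype.val_injective W.mkQ_surjective hex
    (N₁ := (E.sub W hW).euler) (N := E.euler) (N₂ := (E.quot W hW).euler) E.adicCont_euler
    (fun _ => rfl) (fun _ => rfl) a₁ a₂ c₁ c₁' c₂ c₂'
  let D := differenceModuleOf E _ ε hε hc hc'
  have hPhi : ∀ v, D.Phi (ε v) = ε (xpow k (-1) • v) :=
    (isMellinTransform_iff.1 (isMellinTransform_differenceModuleOf E _ ε hε hc hc')).2.1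
  let ι : D₁ ⟶ D := (⟨LinearMap.inl (LaurentSeries k) D₁.carrier _, fun d => by
    obtain ⟨v, rfl⟩ := e₁.surjective d
    have h1 := hεi (xpow k (-1) • v)
    rw [← b₁] at h1
    refine h1.symm.trans (Eq.trans ?_ (congrArg D.Phi (hεi v)))
    rw [hPhi, map_smul]⟩ : DifferenceModule.Hom D₁ D)
  let π : D ⟶ DifferenceModule.D p g hg := (⟨LinearMap.snd (LaurentSeries k) _ _, fun d => by
    obtain ⟨v, rfl⟩ := ε.surjective d
    refine (congrArg Prod.snd (hPhi v)).trans ((hεπ _).trans ?_)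
    rw [map_smul, ← b₂]
    exact congrArg (DifferenceModule.D p g hg).Phi (hεπ v).symm⟩ : DifferenceModule.Hom D _)
  refine ⟨D, ε, fun S hS => ?_, isMellinTransform_differenceModuleOf E _ ε hε hc hc'⟩
  rcases hS.of_exact ι π LinearMap.inl_injective Function.Exact.inl_snd hD₂ with h | ⟨⟨i⟩⟩
  · exact hD₁ S h
  · refine ⟨_, ?_, p, g, hg, ⟨i⟩, rfl⟩
    have hp0 : (0 : ℚ) < ((p : ℕ) : ℚ) := by exact_mod_cast p.pos
    rw [hgord]
    push_cast
    exact div_neg_of_neg_of_pos (neg_neg_of_pos hq) hp0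

/-- The mirror image, with `Φ` becoming multiplication by `ζ⁻¹`. It uses the harder direction
`isIrreducible_E` to know that the new quotient `E_f` is a single component. -/
theorem exists_isMellinTransform_of_negOrder [IsAlgClosed k] (D : DifferenceModule k)
    (hD : DifferenceModule.negOrder k D) :
    ∃ (E : FormalConnection k) (e : E.carrier ≃ₗ[k] D.carrier),
      FormalConnection.posSlope k E ∧ IsMellinTransform E D e := by
  induction hn : Module.finrank (LaurentSeries k) D.carrier using Nat.strong_induction_on
    generalizing D with
  | _ n ih =>
  subst hn
  rcases subsingleton_or_nontrivial D.carrier with hsub | hnt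
  · let E := formalConnectionOf D D.carrier (LinearEquiv.refl k _)
      (fun _ => Subsingleton.elim _ _) adicCont_id adicCont_id
    have : Subsingleton E.carrier := hsub
    exact ⟨E, _, E.posSlope_of_subsingleton, isMellinTransform_formalConnectionOf _ _ _ _ _ _⟩
  obtain ⟨W, hW, hne, hirr⟩ := D.exists_isIrreducible_quot
  obtain ⟨E₁, e₁, hE₁, hM₁⟩ := ih _ (Submodule.finrank_lt hne) (D.sub W hW)
    (fun S hS => hD S (hS.of_injective (D.subι W hW) Subtype.val_injective)) rfl
  obtain ⟨r, hr, q, g, hg, ⟨j⟩, rfl⟩ := hD _ (hirr.isIrreducibleComponent (D.quotπ W hW)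
    W.mkQ_surjective)
  have hq : (0 : ℚ) < ((q : ℕ) : ℚ) := by exact_mod_cast q.pos
  have hg0 : g.order < 0 := by
    by_contra hlt
    have h0 : (0 : ℚ) ≤ (g.order : ℚ) := by exact_mod_cast not_lt.1 hlt
    exact hr.not_ge (div_nonneg h0 hq.le)
  obtain ⟨p, hp⟩ : ∃ p : ℕ+, g.order = -((p : ℕ) : ℤ) :=
    ⟨⟨(-g.order).toNat, by lia⟩, by simp only [PNat.mk_coe]; lia⟩
  obtain ⟨f, e, hford, hM⟩ := exists_isMellinTransform_D q p g hg hp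
  obtain ⟨e₂, hM₂⟩ := hM.of_difference_iso j.symm
  have hE₂ := isIrreducible_E hford hM₂ hirr
  obtain ⟨a₁, b₁, c₁, c₁'⟩ := isMellinTransform_iff.1 hM₁
  obtain ⟨a₂, b₂, c₂, c₂'⟩ := isMellinTransform_iff.1 hM₂
  have hex : Function.Exact (D.subι W hW).toLinearMap (D.quotπ W hW).toLinearMap := fun v =>
    (Submodule.Quotient.mk_eq_zero W).trans ⟨fun h => ⟨⟨v, h⟩, rfl⟩, by rintro ⟨w, rfl⟩; exact w.2⟩
  have b₁' : ∀ d, e₁.symm ((D.sub W hW).Phi d) = xpow k (-1) • e₁.symm d := fun d => by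
    rw [LinearEquiv.symm_apply_eq, ← b₁, e₁.apply_symm_apply]
  have b₂' : ∀ d, e₂.symm ((D.quot W hW).Phi d) = xpow k (-1) • e₂.symm d := fun d => by
    rw [LinearEquiv.symm_apply_eq, ← b₂, e₂.apply_symm_apply]
  obtain ⟨ε, hε, hεi, hεπ, hc, hc'⟩ := exists_equiv_of_exact (i := (D.subι W hW).toLinearMap)
    (π := (D.quotπ W hW).toLinearMap) Subtype.val_injective W.mkQ_surjective hex
    (N₁ := (D.sub W hW).Phi) (N := D.Phi) (N₂ := (D.quot W hW).Phi) D.adicCont_Phi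
    (fun _ => rfl) (fun _ => rfl) b₁' b₂' c₁' c₁ c₂' c₂
  have hε' : ∀ v, D.Phi (ε.symm v) = ε.symm (xpow k (-1) • v) := fun v => by
    rw [LinearEquiv.eq_symm_apply, hε, ε.apply_symm_apply]
  let E := formalConnectionOf D _ ε.symm hε' hc' hc
  have hME : IsMellinTransform E D ε.symm :=
    isMellinTransform_formalConnectionOf D _ ε.symm hε' hc' hc
  have heul : ∀ d, E.euler (ε d) = ε (xpow k (-1) • d) := by
    intro d
    have h := (isMellinTransform_iff.1 hME).1 (ε d)
    have h' : ε.symm (E.euler (ε d)) = xpow k (-1) • d :=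
      h.trans (congrArg _ (ε.symm_apply_apply d))
    exact (ε.apply_symm_apply _).symm.trans (congrArg ε h')
  have ha₁ : ∀ v, e₁ (E₁.euler v) = xpow k (-1) • e₁ v := a₁
  let ι : E₁ ⟶ E := (⟨LinearMap.inl (LaurentSeries k) E₁.carrier _, fun v => by
    -- Commutation is checked for `ζ ∇` and then multiplied by `ζ⁻¹`.
    have key : LinearMap.inl (LaurentSeries k) E₁.carrier (FormalConnection.E p f).carrier
        (E₁.euler v) = E.euler (LinearMap.inl (LaurentSeries k) E₁.carrier _ v) := by
      obtain ⟨d, rfl⟩ := e₁.symm.surjective v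
      have h1 : E₁.euler (e₁.symm d) = e₁.symm (xpow k (-1) • d) := by
        rw [LinearEquiv.eq_symm_apply, ha₁, e₁.apply_symm_apply]
      rw [h1]
      refine (hεi _).symm.trans (Eq.trans ?_ (congrArg E.euler (hεi d)))
      rw [heul, map_smul]
    exact (congrArg (LinearMap.inl _ _ _) (E₁.nabla_eq v)).trans
      (((LinearMap.inl (LaurentSeries k) E₁.carrier (FormalConnection.E p f).carrier).map_smul
        (xpow k (-1)) _).trans ((congrArg (fun w : E.carrier => xpow k (-1) • w) key).trans
          (E.nabla_eq _).symm))⟩ : FormalConnection.Hom E₁ E)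
  let π : E ⟶ FormalConnection.E p f := (⟨LinearMap.snd (LaurentSeries k) _ _, fun v => by
    have key : (LinearMap.snd (LaurentSeries k) E₁.carrier (FormalConnection.E p f).carrier)
        (E.euler v) = (FormalConnection.E p f).euler
          ((LinearMap.snd (LaurentSeries k) E₁.carrier _) v) := by
      obtain ⟨d, rfl⟩ := ε.surjective v
      refine (congrArg Prod.snd (heul d)).trans ((hεπ _).trans ?_)
      refine Eq.trans ?_ (congrArg (FormalConnection.E p f).euler (hεπ d).symm)
      rw [LinearEquiv.symm_apply_eq, a₂, e₂.apply_symm_apply, map_smul]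
    exact (congrArg (LinearMap.snd (LaurentSeries k) E₁.carrier
      (FormalConnection.E p f).carrier) (E.nabla_eq v)).trans
      (((LinearMap.snd (LaurentSeries k) E₁.carrier (FormalConnection.E p f).carrier).map_smul
        (xpow k (-1)) _).trans ((congrArg (xpow k (-1) • ·) key).trans
          (FormalConnection.nabla_eq _ _).symm))⟩ : FormalConnection.Hom E _)
  refine ⟨E, ε.symm, fun S hS => ?_, hME⟩
  rcases hS.of_exact ι π LinearMap.inl_injective Function.Exact.inl_snd hE₂ with h | ⟨⟨i⟩⟩
  · exact hE₁ S h
  · refine ⟨_, ?_, p, f, ⟨i⟩, rfl⟩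
    have hp0 : (0 : ℚ) < ((p : ℕ) : ℚ) := by exact_mod_cast p.pos
    rw [hford]
    push_cast
    refine lt_max_of_lt_right ?_
    rw [neg_div, neg_neg]
    exact div_pos hq hp0

end Existence

/-! ### The functor, its equivalence and its uniqueness. -/

section Functor

variable {k : Type u} [Field k]

theorem IsMellinTransform.mapHom_id_bijective {E : FormalConnection k} {D D' : DifferenceModule k}
    {e : E.carrier ≃ₗ[k] D.carrier} {e' : E.carrier ≃ₗ[k] D'.carrier}
    (h : IsMellinTransform E D e) (h' : IsMellinTransform E D' e') :
    Function.Bijective (h.mapHom h' (𝟙 E)).toLinearMap :=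
  (e.symm.trans e').bijective

variable [CharZero k]

/-- Two Mellin transforms of the same connection are isomorphic. -/
def IsMellinTransform.isoOfNegOrder {E : FormalConnection k} {D D' : NNeg k}
    {e : E.carrier ≃ₗ[k] D.obj.carrier} {e' : E.carrier ≃ₗ[k] D'.obj.carrier}
    (h : IsMellinTransform E D.obj e) (h' : IsMellinTransform E D'.obj e') : D ≅ D' :=
  (DifferenceModule.negOrder k).isoMk
    (DifferenceModule.isoOfBijective _ (h.mapHom_id_bijective h'))

theorem IsMellinTransform.isoOfNegOrder_hom_apply {E : FormalConnection k} {D D' : NNeg k}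
    {e : E.carrier ≃ₗ[k] D.obj.carrier} {e' : E.carrier ≃ₗ[k] D'.obj.carrier}
    (h : IsMellinTransform E D.obj e) (h' : IsMellinTransform E D'.obj e') (v : E.carrier) :
    (h.isoOfNegOrder h').hom.hom.toLinearMap (e v) = e' v :=
  congrArg e' (e.symm_apply_apply v)

theorem FormalConnection.hom_ext_apply {E E' : FormalConnection k} {f g : E ⟶ E'}
    (h : ∀ v, f.toLinearMap v = g.toLinearMap v) : f = g :=
  FormalConnection.Hom.ext (LinearMap.ext h)

theorem DifferenceModule.hom_ext_apply {D D' : DifferenceModule k} {f g : D ⟶ D'}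
    (h : ∀ v, f.toLinearMap v = g.toLinearMap v) : f = g :=
  DifferenceModule.Hom.ext (LinearMap.ext h)

variable [IsAlgClosed k]

/-- The difference module `(V_θ, Φ)` of a connection `E = (V, ∇)` with positive slopes. -/
def mellinObj (E : CInftyPos k) : NNeg k :=
  ⟨(exists_isMellinTransform_of_posSlope E.obj E.property).choose,
    (exists_isMellinTransform_of_posSlope E.obj E.property).choose_spec.choose_spec.1⟩

/-- The identification of the spaces underlying `E` and its local Mellin transform. -/
def mellinEquiv (E : CInftyPos k) : E.obj.carrier ≃ₗ[k] (mellinObj E).obj.carrier :=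
  (exists_isMellinTransform_of_posSlope E.obj E.property).choose_spec.choose

theorem isMellinTransform_mellinEquiv (E : CInftyPos k) :
    IsMellinTransform E.obj (mellinObj E).obj (mellinEquiv E) :=
  (exists_isMellinTransform_of_posSlope E.obj E.property).choose_spec.choose_spec.2

/-- The local Mellin transform. -/
def mellin (k : Type u) [Field k] [CharZero k] [IsAlgClosed k] : CInftyPos k ⥤ NNeg k where
  obj := mellinObj
  map {E E'} f := ⟨(isMellinTransform_mellinEquiv E).mapHom (isMellinTransform_mellinEquiv E') f.hom⟩
  map_id E := by
    ext1
    exact DifferenceModule.hom_ext_apply fun v => (mellinEquiv E).apply_symm_apply v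
  map_comp {E E' E''} f g := by
    ext1
    exact DifferenceModule.hom_ext_apply fun v =>
      congrArg (fun w => mellinEquiv E'' (g.hom.toLinearMap w))
        ((mellinEquiv E').symm_apply_apply _).symm

theorem mellin_map_apply {E E' : CInftyPos k} (f : E ⟶ E') (v : E.obj.carrier) :
    ((mellin k).map f).hom.toLinearMap (mellinEquiv E v) = mellinEquiv E' (f.hom.toLinearMap v) :=
  congrArg (fun w => mellinEquiv E' (f.hom.toLinearMap w)) ((mellinEquiv E).symm_apply_apply v)

theorem isLocalMellin_mellin : IsLocalMellin (mellin k) :=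
  ⟨mellinEquiv, isMellinTransform_mellinEquiv, fun _ _ => mellin_map_apply⟩

instance : (mellin k).Faithful where
  map_injective {E E' f g} h := by
    ext1
    refine FormalConnection.hom_ext_apply fun v => (mellinEquiv E').injective ?_
    rw [← mellin_map_apply, ← mellin_map_apply, h]

instance : (mellin k).Full where
  map_surjective {E E'} g := by
    refine ⟨⟨(isMellinTransform_mellinEquiv E).comapHom (isMellinTransform_mellinEquiv E') g.hom⟩, ?_⟩
    ext1
    refine DifferenceModule.hom_ext_apply fun d => ?_
    obtain ⟨v, rfl⟩ := (mellinEquiv E).surjective d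
    rw [mellin_map_apply]
    exact (mellinEquiv E').apply_symm_apply _

/-- The connection constructed from `D` has `D` as one transform and `mellinObj` as another; the
identity of the underlying space is an isomorphism between them. -/
instance : (mellin k).EssSurj where
  mem_essImage D := by
    obtain ⟨E, e, hE, h⟩ := exists_isMellinTransform_of_negOrder D.obj D.property
    exact ⟨⟨E, hE⟩, ⟨(isMellinTransform_mellinEquiv ⟨E, hE⟩).isoOfNegOrder h⟩⟩

/-- Two transforms of the same connection differ by the `k((θ))`-linear identity of the underlying
space. Naturality holds because both functors leave underlying maps unchanged. -/
theorem IsLocalMellin.nonempty_iso {M : CInftyPos k ⥤ NNeg k} (hM : IsLocalMellin M) :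
    Nonempty (M ≅ mellin k) := by
  obtain ⟨e, he, hmap⟩ := hM
  refine ⟨NatIso.ofComponents
    (fun E => (he E).isoOfNegOrder (isMellinTransform_mellinEquiv E)) fun {E E'} f => ?_⟩
  ext1
  refine DifferenceModule.hom_ext_apply fun d => ?_
  obtain ⟨v, rfl⟩ := (e E).surjective d
  change ((he E').isoOfNegOrder (isMellinTransform_mellinEquiv E')).hom.hom.toLinearMap
      ((M.map f).hom.toLinearMap (e E v)) = ((mellin k).map f).hom.toLinearMap
      (((he E).isoOfNegOrder (isMellinTransform_mellinEquiv E)).hom.hom.toLinearMap (e E v))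
  rw [hmap, IsMellinTransform.isoOfNegOrder_hom_apply, IsMellinTransform.isoOfNegOrder_hom_apply,
    mellin_map_apply]

end Functor

end LocalMellin

end

theorem mainTheorem4 (k : Type u) [Field k] [IsAlgClosed k] [CharZero k] :
    ∃ M : LocalMellin.CInftyPos k ⥤ LocalMellin.NNeg k,
      LocalMellin.IsLocalMellin M ∧ M.IsEquivalence ∧
      ∀ M' : LocalMellin.CInftyPos k ⥤ LocalMellin.NNeg k,
        LocalMellin.IsLocalMellin M' → Nonempty (M' ≅ M) :=
  ⟨LocalMellin.mellin k, LocalMellin.isLocalMellin_mellin, {}, fun _ h => h.nonempty_iso⟩
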